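/- Let $\boldsymbol X:\mathbb R^2\to\mathbb C^3$ be a $C^\infty$ parametrization of a complexified surface with $\boldsymbol X(\boldsymbol 0)=\boldsymbol 0$. For $\boldsymbol x\in\mathbb C^3$ let $r(\boldsymbol x)=\sqrt{x_1^2+x_2^2+x_3^2}$ (principal branch, no complex conjugation) be the complexified distance. Let $A=\big(\partial_{v_i}\boldsymbol X(\boldsymbol 0)\cdot\partial_{v_j}\boldsymbol X(\boldsymbol 0)\big)_{i,j=1,2}$, with the bilinear dot product, be the first fundamental form of $\boldsymbol X$ at $\boldsymbol 0$, a complex symmetric matrix, and assume that $\operatorname{Re}A$ is positive definite (for complex symmetric $A$ this implies that $\operatorname{Re}(A^{-1})$ is positive definite). Let $s\in\mathbb R$ with $s<1$, and let $g:\mathbb R^2\to\mathbb C$ be $C^\infty$, such that * $r(\boldsymbol X(\boldsymbol v))^2\notin(-\infty,0]$ for every $\boldsymbol v\ne\boldsymbol 0$ in the support of $g$, so that the integrand $g(\boldsymbol v)/r(\boldsymbol X(\boldsymbol v))^{2s}$ is smooth away from $\boldsymbol 0$; * $g$ decays sufficiently rapidly at infinity, in the sense that the partial derivatives of all orders (including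 order $0$) of the integrand are absolutely integrable on $\{|\boldsymbol v|\ge1\}$ (for instance, $g$ has compact support). Let $Z_A(s)$ be the Epstein zeta function, that is, the analytic extension to $\mathbb C\setminus\{1\}$ of $\sum_{\boldsymbol j\in\mathbb Z^2\setminus\{\boldsymbol 0\}}(\boldsymbol j^TA\boldsymbol j)^{-s}$, $\operatorname{Re}s>1$. Then this series converges absolutely for $\operatorname{Re}s>1$ and the extension exists; the integral and the sums $$I_r=\int_{\mathbb R^2}\frac{g(\boldsymbol v)}{r(\boldsymbol X(\boldsymbol v))^{2s}}\,d\boldsymbol v,\qquad T_{r,h}=\sum_{\boldsymbol j\in\mathbb Z^2\setminus\{\boldsymbol 0\}}\frac{g(\boldsymbol jh)}{r(\boldsymbol X(\boldsymbol jh))^{2s}}\,h^2\quad(h>0)$$ converge absolutely; and $$\big|I_r-T_{r,h}+Z_A(s)\,g(\boldsymbol 0)\,h^{2-2s}\big|=O(h^{4-2s})\qquad\text{as }h\to0^+ .$$ -/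

import Mathlib

open Filter Topology MeasureTheory Asymptotics
open scoped ContDiff Matrix

noncomputable section

namespace TrapezoidalRule

/-- The parameter plane `ℝ²`. -/
abbrev Plane : Type := EuclideanSpace ℝ (Fin 2)

/-- The ambient space `ℂ³`. -/
abbrev Space : Type := EuclideanSpace ℂ (Fin 3)

/-- The squared complexified distance `x₁² + x₂² + x₃²` (no complex conjugation). -/
def distSq (x : Space) : ℂ := ∑ k, x k ^ 2

/-- The complexified distance `r(x) = √(x₁² + x₂² + x₃²)`, with the principal square root. -/
def dist (x : Space) : ℂ := distSq x ^ (1 / 2 : ℂ)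

/-- The partial derivative `∂X/∂vᵢ` at `v`. -/
def partialDeriv (X : Plane → Space) (i : Fin 2) (v : Plane) : Space :=
  fderiv ℝ X v (EuclideanSpace.single i 1)

/-- The first fundamental form of `X` at `v`: the complex symmetric matrix of the products
`∂ᵢX · ∂ⱼX` for the bilinear (not the Hermitian) dot product of `ℂ³`. -/
def firstFundamentalForm (X : Plane → Space) (v : Plane) : Matrix (Fin 2) (Fin 2) ℂ :=
  Matrix.of fun i j => ∑ k, partialDeriv X i v k * partialDeriv X j v k

/-- The quadratic form `Q_A(v) = vᵀ A v`. -/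
def quadForm (A : Matrix (Fin 2) (Fin 2) ℂ) (v : Fin 2 → ℂ) : ℂ := v ⬝ᵥ (A *ᵥ v)

/-- The index set `ℤ² ∖ {0}` of the primed sums. -/
abbrev PuncturedLattice : Type := {j : Fin 2 → ℤ // j ≠ 0}

/-- `Z` is an analytic extension to `ℂ ∖ {1}` of the Epstein zeta series
`∑' Q_A(j)^{-s}`, which is required to converge (absolutely) for `Re s > 1`. -/
def IsEpsteinZeta (A : Matrix (Fin 2) (Fin 2) ℂ) (Z : ℂ → ℂ) : Prop :=
  AnalyticOnNhd ℂ Z {1}ᶜ ∧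
    ∀ s : ℂ, 1 < s.re →
      HasSum (fun j : PuncturedLattice => quadForm A (fun i => (j.1 i : ℂ)) ^ (-s)) (Z s)

open Classical in
/-- The Epstein zeta function `Z_A(s)`, analytically continued in `s`. The extension is unique on
`ℂ ∖ {1}` by the identity theorem; the value is `0` if there is none. -/
def epsteinZeta (A : Matrix (Fin 2) (Fin 2) ℂ) (s : ℂ) : ℂ :=
  if h : ∃ Z : ℂ → ℂ, IsEpsteinZeta A Z then h.choose s else 0

/-- The integrand `g(v) / r(X(v))^{2s}`. -/
def integrand (X : Plane → Space) (g : Plane → ℂ) (s : ℝ) (v : Plane) : ℂ :=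
  g v / dist (X v) ^ ((2 * s : ℝ) : ℂ)

/-- The grid point `j h` of the parameter plane. -/
def gridPoint (h : ℝ) (j : Fin 2 → ℤ) : Plane := WithLp.toLp 2 fun i => (j i : ℝ) * h

/-- The punctured trapezoidal rule `T_{r,h} = ∑' g(jh) / r(X(jh))^{2s} h²`. -/
def puncturedTrapezoidal (X : Plane → Space) (g : Plane → ℂ) (s h : ℝ) : ℂ :=
  ∑' j : PuncturedLattice, integrand X g s (gridPoint h j.1) * (h : ℂ) ^ 2

end TrapezoidalRule

end

open Filter Topology MeasureTheory Asymptotics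
open scoped ContDiff Matrix

noncomputable section

namespace TrapezoidalRule

/-! By Poisson summation, the trapezoidal error of a smooth function is the sum of its Fourier
transform over nonzero frequencies (`exists_norm_tsum_int_sub_integral_le`). If all derivatives are
integrable and the function vanishes at `0`, so that the puncture is harmless, the error is smaller
than every power of `h`. Hence only the germ of the integrand at the origin matters.

Near the origin the tool is scaling. Let `W` behave like a homogeneous function of degree `d > -2`.
Its piece on the annulus of radius about `2^{-k}`, rescaled to unit size, contributes `2^{-k(d+2)}`
times the error of a smooth function at step `2^k h`. That error is `O((2^k h)^N)` when `2^k h ≤ 1`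
and merely bounded otherwise, so the total is `O(h^{d+2})` (`IsConormal.exists_norm_ruleError_le`).

In blow-up coordinates `v = tu` one has `r(X(tu))² = t² H(t,u)` with `H` smooth and `H(0,u) =
Q_A(u)`, so the integrand is `t^{-2s}` times a smooth function of `(t,u)`. Lattice and Lebesgue
measure are symmetric under `v ↦ -v`, so only the even part counts; there the smooth factor is even
in `t`. Subtracting `g(0) Q_A^{-s}` therefore leaves a remainder of degree `2-2s`, not `1-2s`
(`exists_isConormal_integrand`), whose error is `O(h^{4-2s})`.

The model `Q_A^{-s}` is treated by dilating the same annulus outwards. For `Re s > 1`, the lattice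
sum over the `k`-th annulus is `2^{k(2-2s)}` times the integral of `Q_A^{-s}` over the unit annulus,
minus `2^{k(2-2s)}` times the rule error at step `h/2^k`. The first terms form a geometric series
with sum `J/(2-2s)`, where `J` integrates `Q_A^{-s}` against the radial derivative of the cutoff.
The second series converges for every `s` and is `O(h^M)` for every `M`. This continues the zeta
function (`scaledZeta_eq`). For `s < 1` the integral of `Q_A^{-s}` times the cutoff is `-J/(2-2s)`,
which cancels the pole term: rule error plus `h^{2-2s} Z_A(s)` is just the negligible series
(`ruleError_homog_mul_cutoff`). -/

/-! ### Poisson summation and lattice sums in one variable -/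

theorem hasCompactSupport_iteratedDeriv {f : ℝ → ℂ} (hc : HasCompactSupport f) (n : ℕ) :
    HasCompactSupport (iteratedDeriv n f) := by
  induction n with
  | zero => simpa
  | succ n ih => rw [iteratedDeriv_succ]; exact ih.deriv

-- Poisson summation turns the sum over `n` into a sum of `𝓕 f n`, whose term at `0` is the
-- integral. The others are at most `∫ ‖f⁽ᴺ⁾‖ / (2π|n|)^N`, and the factor `(2π)^N ≥ 1` is thrown
-- away.
open scoped FourierTransform in
theorem exists_norm_tsum_int_sub_integral_le {N : ℕ} (hN : 2 ≤ N) :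
    ∃ B : ℝ, 0 ≤ B ∧ ∀ f : ℝ → ℂ, ContDiff ℝ ∞ f → HasCompactSupport f →
      ‖∑' n : ℤ, f n - ∫ x, f x‖ ≤ B * ∫ x, ‖iteratedDeriv N f x‖ := by
  have hsum : Summable fun n : ℤ => |1 / (n : ℝ) ^ N| :=
    (Real.summable_one_div_int_pow.2 (by omega)).abs
  -- The term at `n = 0` is `1 / 0 = 0`, so this is the sum over nonzero frequencies.
  refine ⟨∑' n : ℤ, |1 / (n : ℝ) ^ N|, tsum_nonneg fun _ => abs_nonneg _, fun f hf hc => ?_⟩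
  set I := ∫ x, ‖iteratedDeriv N f x‖ with hI
  have hbound : ∀ n : ℤ, n ≠ 0 → ‖𝓕 f (n : ℝ)‖ ≤ |1 / (n : ℝ) ^ N| * I := by
    intro n hn
    have h1 := congrFun (Real.fourier_iteratedDeriv (f := f) (N := ⊤) (n := N) hf
      (fun n _ => (hf.continuous_iteratedDeriv n (by exact_mod_cast le_top)).integrable_of_hasCompactSupport
        (hasCompactSupport_iteratedDeriv hc n)) le_top) (n : ℝ)
    have h2 : ‖𝓕 (iteratedDeriv N f) (n : ℝ)‖ ≤ I :=
      VectorFourier.norm_fourierIntegral_le_integral_norm _ _ _ _ _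
    rw [h1, norm_smul, norm_pow] at h2
    have h3 : ‖(2 * (Real.pi : ℂ) * Complex.I * ((n : ℝ) : ℂ))‖ = 2 * Real.pi * |(n : ℝ)| := by
      simp [abs_of_pos Real.pi_pos]
    rw [h3, mul_pow] at h2
    have hn' : 0 < |(n : ℝ)| := by positivity
    have h4 : 1 ≤ (2 * Real.pi) ^ N := one_le_pow₀ (by linarith [Real.pi_gt_three])
    rw [abs_div, abs_one, abs_pow, one_div, inv_mul_eq_div, le_div_iff₀ (by positivity)]
    have h5 : |(n : ℝ)| ^ N ≤ (2 * Real.pi) ^ N * |(n : ℝ)| ^ N :=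
      le_mul_of_one_le_left (by positivity) h4
    calc ‖𝓕 f (n : ℝ)‖ * |(n : ℝ)| ^ N
        ≤ ‖𝓕 f (n : ℝ)‖ * ((2 * Real.pi) ^ N * |(n : ℝ)| ^ N) := by gcongr
      _ ≤ I := by linarith
  have hF : Summable fun n : ℤ => if n = 0 then 0 else 𝓕 f (n : ℝ) := by
    refine Summable.of_norm_bounded (hsum.mul_right I) fun n => ?_
    split_ifs with h
    · simp only [norm_zero]
      exact mul_nonneg (abs_nonneg _) (integral_nonneg fun _ => norm_nonneg _)
    · exact hbound n h
  have hF' : Summable fun n : ℤ => 𝓕 f (n : ℝ) := by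
    refine (summable_congr_cofinite ?_).1 hF
    filter_upwards [(Set.finite_singleton (0 : ℤ)).compl_mem_cofinite] with n hn
    simp at hn
    simp [hn]
  have hP := SchwartzMap.tsum_eq_tsum_fourier (hc.toSchwartzMap hf) 0
  have hP' : ∑' n : ℤ, f n = ∑' n : ℤ, 𝓕 f (n : ℝ) := by
    have hco : ⇑(hc.toSchwartzMap hf) = f := rfl
    simpa [SchwartzMap.fourier_coe, hco] using hP
  have h0 : 𝓕 f ((0 : ℤ) : ℝ) = ∫ x, f x := by simp [Real.fourier_eq]
  rw [hP', hF'.tsum_eq_add_tsum_ite 0, h0, add_sub_cancel_left, ← tsum_mul_right]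
  refine tsum_of_norm_bounded (hsum.mul_right I).hasSum fun n => ?_
  split_ifs with h
  · simp only [norm_zero]
    exact mul_nonneg (abs_nonneg _) (integral_nonneg fun _ => norm_nonneg _)
  · exact hbound n h

/-- For each `x` in the unit interval, `f a` differs from `f x` by at most the integral of `‖f'‖`;
average over `x`. -/
theorem norm_le_setIntegral_norm_add_norm_deriv {E : Type*} [NormedAddCommGroup E]
    [NormedSpace ℝ E] [CompleteSpace E] {f : ℝ → E} (hf : ContDiff ℝ 1 f) (a : ℝ) :
    ‖f a‖ ≤ ∫ x in Set.Ioc a (a + 1), (‖f x‖ + ‖deriv f x‖) := by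
  have hd : Continuous (deriv f) := hf.continuous_deriv le_rfl
  have hle : a ≤ a + 1 := by linarith
  have key : ∀ x ∈ Set.Icc a (a + 1), ‖f a‖ - ∫ t in a..a + 1, ‖deriv f t‖ ≤ ‖f x‖ := by
    intro x hx
    have h1 : ∫ t in a..x, deriv f t = f x - f a :=
      intervalIntegral.integral_deriv_eq_sub
        (fun t _ => (hf.differentiable one_ne_zero).differentiableAt) (hd.intervalIntegrable _ _)
    have h2 : ‖f x - f a‖ ≤ ∫ t in a..a + 1, ‖deriv f t‖ := by
      rw [← h1]
      refine (intervalIntegral.norm_integral_le_integral_norm hx.1).trans ?_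
      exact intervalIntegral.integral_mono_interval le_rfl hx.1 hx.2
        (Eventually.of_forall fun _ => norm_nonneg _) (hd.norm.intervalIntegrable _ _)
    have h3 := norm_sub_norm_le (f a) (f x)
    rw [norm_sub_rev] at h3
    linarith
  have := intervalIntegral.integral_mono_on (μ := volume) hle
    (_root_.intervalIntegrable_const) (hf.continuous.norm.intervalIntegrable a (a + 1)) key
  rw [← intervalIntegral.integral_of_le hle, intervalIntegral.integral_add
    (hf.continuous.norm.intervalIntegrable _ _) (hd.norm.intervalIntegrable _ _)]
  simp at this
  linarith

theorem sum_norm_le_integral_norm_add_norm_deriv {E : Type*} [NormedAddCommGroup E]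
    [NormedSpace ℝ E] [CompleteSpace E] {f : ℝ → E} (hf : ContDiff ℝ 1 f)
    (hc : HasCompactSupport f) (s : Finset ℤ) :
    ∑ n ∈ s, ‖f n‖ ≤ ∫ x, (‖f x‖ + ‖deriv f x‖) := by
  have hd : Continuous (deriv f) := hf.continuous_deriv le_rfl
  have hint : Integrable fun x => ‖f x‖ + ‖deriv f x‖ :=
    (hf.continuous.integrable_of_hasCompactSupport hc).norm.add
      (hd.integrable_of_hasCompactSupport hc.deriv).norm
  calc ∑ n ∈ s, ‖f n‖ ≤ ∑ n ∈ s, ∫ x in Set.Ioc (n : ℝ) (n + 1), (‖f x‖ + ‖deriv f x‖) :=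
        Finset.sum_le_sum fun n _ => norm_le_setIntegral_norm_add_norm_deriv hf n
    _ = ∫ x in ⋃ n ∈ s, Set.Ioc (n : ℝ) (n + 1), (‖f x‖ + ‖deriv f x‖) := by
        rw [integral_biUnion_finset s (fun _ _ => measurableSet_Ioc)
          (fun i _ j _ h => by simpa using! Set.pairwise_disjoint_Ioc_intCast ℝ h)
          (fun _ _ => hint.integrableOn)]
    _ ≤ _ := setIntegral_le_integral hint (Eventually.of_forall fun _ => by positivity)

theorem norm_iteratedFDeriv_comp_affine_le {E E' G : Type*} [NormedAddCommGroup E]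
    [NormedSpace ℝ E] [NormedAddCommGroup E'] [NormedSpace ℝ E'] [NormedAddCommGroup G]
    [NormedSpace ℝ G] {f : E → G} (hf : ContDiff ℝ ∞ f) (c : E) (L : E' →L[ℝ] E) (m : ℕ) (x : E') :
    ‖iteratedFDeriv ℝ m (fun x => f (c + L x)) x‖ ≤ ‖iteratedFDeriv ℝ m f (c + L x)‖ * ‖L‖ ^ m := by
  have h1 : ContDiff ℝ ∞ fun y => f (c + y) := hf.comp (contDiff_const.add contDiff_id)
  have h2 := L.iteratedFDeriv_comp_right h1 x (i := m) (by exact_mod_cast le_top)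
  rw [iteratedFDeriv_comp_add_left] at h2
  have h3 : (fun x => f (c + L x)) = (fun y => f (c + y)) ∘ L := rfl
  rw [h3, h2]
  refine (ContinuousMultilinearMap.norm_compContinuousLinearMap_le _ _).trans_eq ?_
  simp

/-! ### Lattice sums in two variables -/

section Product

theorem hasCompactSupport_slice_right {E : Type*} [NormedAddCommGroup E] {F : ℝ × ℝ → E} (hc : HasCompactSupport F) (x : ℝ) :
    HasCompactSupport fun y => F (x, y) :=
  HasCompactSupport.intro (hc.isCompact.image continuous_snd) fun _ hy =>
    image_eq_zero_of_notMem_tsupport fun h => hy ⟨_, h, rfl⟩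

theorem hasCompactSupport_slice_left {E : Type*} [NormedAddCommGroup E] {F : ℝ × ℝ → E} (hc : HasCompactSupport F) (y : ℝ) :
    HasCompactSupport fun x => F (x, y) :=
  HasCompactSupport.intro (hc.isCompact.image continuous_fst) fun _ hx =>
    image_eq_zero_of_notMem_tsupport fun h => hx ⟨_, h, rfl⟩

variable {E : Type*} [NormedAddCommGroup E] [NormedSpace ℝ E]

theorem sum_norm_slice_right_le [CompleteSpace E] {F : ℝ × ℝ → E} (hf : ContDiff ℝ 1 F)
    (hc : HasCompactSupport F) (x : ℝ) (s : Finset ℤ) :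
    ∑ k ∈ s, ‖F (x, k)‖ ≤ ∫ y, (‖F (x, y)‖ + ‖fderiv ℝ F (x, y)‖) := by
  have hs : ContDiff ℝ 1 fun y => F (x, y) := hf.comp (contDiff_const.prodMk contDiff_id)
  have hcs := hasCompactSupport_slice_right hc x
  refine (sum_norm_le_integral_norm_add_norm_deriv hs hcs s).trans ?_
  have hd : Continuous (fderiv ℝ F) := hf.continuous_fderiv one_ne_zero
  have h1 : Integrable fun y => ‖F (x, y)‖ :=
    (hs.continuous.integrable_of_hasCompactSupport hcs).norm
  refine integral_mono
    (h1.add ((hs.continuous_deriv le_rfl).integrable_of_hasCompactSupport hcs.deriv).norm)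
    (h1.add ((hd.comp (by fun_prop)).integrable_of_hasCompactSupport
      (hasCompactSupport_slice_right (hc.fderiv ℝ) x)).norm) fun y => ?_
  have h2 : HasDerivAt (fun y => F (x, y)) (fderiv ℝ F (x, y) (0, 1)) y :=
    ((hf.differentiable one_ne_zero) (x, y)).hasFDerivAt.comp_hasDerivAt y
      ((hasDerivAt_const y x).prodMk (hasDerivAt_id y))
  have h3 := (fderiv ℝ F (x, y)).le_opNorm (0, 1)
  simp only [Prod.norm_mk, norm_zero, norm_one, zero_le_one, sup_of_le_right, mul_one] at h3
  simp only [h2.deriv]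
  linarith

theorem sum_norm_slice_left_le [CompleteSpace E] {F : ℝ × ℝ → E} (hf : ContDiff ℝ 1 F)
    (hc : HasCompactSupport F) (y : ℝ) (s : Finset ℤ) :
    ∑ k ∈ s, ‖F (k, y)‖ ≤ ∫ x, (‖F (x, y)‖ + ‖fderiv ℝ F (x, y)‖) := by
  have hs : ContDiff ℝ 1 fun x => F (x, y) := hf.comp (contDiff_id.prodMk contDiff_const)
  have hcs := hasCompactSupport_slice_left hc y
  refine (sum_norm_le_integral_norm_add_norm_deriv hs hcs s).trans ?_
  have hd : Continuous (fderiv ℝ F) := hf.continuous_fderiv one_ne_zero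
  have h1 : Integrable fun x => ‖F (x, y)‖ :=
    (hs.continuous.integrable_of_hasCompactSupport hcs).norm
  refine integral_mono
    (h1.add ((hs.continuous_deriv le_rfl).integrable_of_hasCompactSupport hcs.deriv).norm)
    (h1.add ((hd.comp (by fun_prop)).integrable_of_hasCompactSupport
      (hasCompactSupport_slice_left (hc.fderiv ℝ) y)).norm) fun x => ?_
  have h2 : HasDerivAt (fun x => F (x, y)) (fderiv ℝ F (x, y) (1, 0)) x :=
    ((hf.differentiable one_ne_zero) (x, y)).hasFDerivAt.comp_hasDerivAt x
      ((hasDerivAt_id x).prodMk (hasDerivAt_const x y))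
  have h3 := (fderiv ℝ F (x, y)).le_opNorm (1, 0)
  simp only [Prod.norm_mk, norm_zero, norm_one, zero_le_one, sup_of_le_left, mul_one] at h3
  simp only [h2.deriv]
  linarith

theorem integrable_norm_iteratedFDeriv {V : Type*} [NormedAddCommGroup V] [NormedSpace ℝ V]
    [MeasurableSpace V] [BorelSpace V] {μ : Measure V} [IsFiniteMeasureOnCompacts μ]
    {F : V → E} (hf : ContDiff ℝ ∞ F) (hc : HasCompactSupport F)
    (m : ℕ) : Integrable (fun p => ‖iteratedFDeriv ℝ m F p‖) μ :=
  (hf.continuous_iteratedFDeriv (m := m) (by exact_mod_cast le_top)).norm.integrable_of_hasCompactSupport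
    (hc.iteratedFDeriv m).norm

/-- The one-variable bound is used in the second variable, then in the first on both `F` and `fderiv
ℝ F`; hence the derivatives of order `0, 1, 1, 2`. -/
theorem sum_sum_norm_le_integral [CompleteSpace E] {F : ℝ × ℝ → E} (hf : ContDiff ℝ ∞ F)
    (hc : HasCompactSupport F) (s t : Finset ℤ) :
    ∑ j ∈ s, ∑ k ∈ t, ‖F (j, k)‖ ≤ ∫ p, (‖iteratedFDeriv ℝ 0 F p‖ + ‖iteratedFDeriv ℝ 1 F p‖ +
      (‖iteratedFDeriv ℝ 1 F p‖ + ‖iteratedFDeriv ℝ 2 F p‖)) := by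
  have hI := integrable_norm_iteratedFDeriv (μ := (volume : Measure (ℝ × ℝ))) hf hc
  have hf' : ContDiff ℝ ∞ (fderiv ℝ F) := hf.fderiv_right (by simp)
  have e0 : ∀ p, ‖F p‖ = ‖iteratedFDeriv ℝ 0 F p‖ := fun p => (norm_iteratedFDeriv_zero).symm
  have e1 : ∀ p, ‖fderiv ℝ F p‖ = ‖iteratedFDeriv ℝ 1 F p‖ := fun p => (norm_iteratedFDeriv_one F).symm
  have e2 : ∀ p, ‖fderiv ℝ (fderiv ℝ F) p‖ = ‖iteratedFDeriv ℝ 2 F p‖ := fun p => by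
    rw [← norm_iteratedFDeriv_one, norm_iteratedFDeriv_fderiv]
  have hi : ∀ j : ℤ, Integrable fun y : ℝ => ‖F (j, y)‖ + ‖fderiv ℝ F (j, y)‖ := fun j =>
    ((hf.continuous.comp (by fun_prop : Continuous fun y : ℝ => ((j : ℝ), y))).integrable_of_hasCompactSupport
        (hasCompactSupport_slice_right hc j)).norm.add
      ((hf'.continuous.comp (by fun_prop : Continuous fun y : ℝ => ((j : ℝ), y))).integrable_of_hasCompactSupport
        (hasCompactSupport_slice_right (hc.fderiv ℝ) j)).norm
  have hint : Integrable fun p => ‖iteratedFDeriv ℝ 0 F p‖ + ‖iteratedFDeriv ℝ 1 F p‖ +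
      (‖iteratedFDeriv ℝ 1 F p‖ + ‖iteratedFDeriv ℝ 2 F p‖) :=
    ((hI 0).add (hI 1)).add ((hI 1).add (hI 2))
  calc ∑ j ∈ s, ∑ k ∈ t, ‖F (j, k)‖
      ≤ ∑ j ∈ s, ∫ y, (‖F (j, y)‖ + ‖fderiv ℝ F (j, y)‖) :=
        Finset.sum_le_sum fun j _ => sum_norm_slice_right_le (hf.of_le (by exact_mod_cast le_top)) hc j t
    _ = ∫ y, ∑ j ∈ s, (‖F (j, y)‖ + ‖fderiv ℝ F (j, y)‖) :=
        (integral_finsetSum s fun j _ => hi j).symm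
    _ ≤ ∫ y, ∫ x, (‖iteratedFDeriv ℝ 0 F (x, y)‖ + ‖iteratedFDeriv ℝ 1 F (x, y)‖ +
          (‖iteratedFDeriv ℝ 1 F (x, y)‖ + ‖iteratedFDeriv ℝ 2 F (x, y)‖)) := by
        refine integral_mono (integrable_finsetSum s fun j _ => hi j) hint.integral_prod_right
          fun y => ?_
        have a1 := sum_norm_slice_left_le (hf.of_le (by exact_mod_cast le_top)) hc y s
        have a2 := sum_norm_slice_left_le (hf'.of_le (by exact_mod_cast le_top)) (hc.fderiv ℝ) y s
        simp only [e0, e1, e2] at a1 a2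
        simp only [e0, e1]
        have sl : ∀ m, Integrable fun x : ℝ => ‖iteratedFDeriv ℝ m F (x, y)‖ := fun m =>
          (((hf.continuous_iteratedFDeriv (m := m) (by exact_mod_cast le_top)).comp
            (by fun_prop : Continuous fun x : ℝ => (x, y))).integrable_of_hasCompactSupport
            (hasCompactSupport_slice_left (hc.iteratedFDeriv m) y)).norm
        have sl' : ∀ m n, Integrable fun x : ℝ => ‖iteratedFDeriv ℝ m F (x, y)‖ +
            ‖iteratedFDeriv ℝ n F (x, y)‖ := fun m n => (sl m).add (sl n)
        rw [Finset.sum_add_distrib, integral_add (sl' 0 1) (sl' 1 2)]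
        exact add_le_add a1 a2
    _ = _ := by rw [Measure.volume_eq_prod, integral_prod_symm _ hint]

/-- Sum over the second variable to get `S`. The error splits into the one-variable error of `S` and
the integral over `x` of the one-variable error of the slice at `x`. Bounding the lattice sum inside
the `N`-th derivative of `S` by an integral costs one more derivative, whence order `N + 1`. -/
theorem exists_norm_tsum_int_prod_sub_integral_le {N : ℕ} (hN : 2 ≤ N) :
    ∃ B : ℝ, 0 ≤ B ∧ ∀ F : ℝ × ℝ → ℂ, ContDiff ℝ ∞ F → HasCompactSupport F →
      ‖∑' j : ℤ × ℤ, F (j.1, j.2) - ∫ p, F p‖ ≤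
        B * ∫ p, (‖iteratedFDeriv ℝ N F p‖ + ‖iteratedFDeriv ℝ (N + 1) F p‖) := by
  obtain ⟨B, hB, h1⟩ := exists_norm_tsum_int_sub_integral_le hN
  refine ⟨2 * B, by positivity, fun F hf hc => ?_⟩
  have hI := integrable_norm_iteratedFDeriv (μ := (volume : Measure (ℝ × ℝ))) hf hc
  obtain ⟨R, hR⟩ := hc.isCompact.isBounded.subset_closedBall 0
  obtain ⟨M, hM⟩ := exists_nat_gt R
  -- A window containing every lattice coordinate that the support can meet, so all sums below are
  -- finite.
  set K : Finset ℤ := Finset.Icc (-M) M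
  have hz : ∀ p : ℝ × ℝ, R < ‖p‖ → F p = 0 := fun p hp =>
    image_eq_zero_of_notMem_tsupport fun h => by
      have := hR h; simp only [Metric.mem_closedBall, dist_zero_right] at this; linarith
  have hK : ∀ k : ℤ, k ∉ K → R < |(k : ℝ)| := by
    intro k hk
    have : (M : ℤ) < |k| := by
      by_contra! h
      exact hk (Finset.mem_Icc.2 (abs_le.1 h))
    have : (M : ℝ) < |(k : ℝ)| := by exact_mod_cast this
    linarith
  have hzx : ∀ k ∉ K, ∀ y : ℝ, F (k, y) = 0 := fun k hk y =>
    hz _ ((hK k hk).trans_le (norm_fst_le ((k : ℝ), y)))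
  have hzy : ∀ k ∉ K, ∀ x : ℝ, F (x, k) = 0 := fun k hk x =>
    hz _ ((hK k hk).trans_le (norm_snd_le (x, (k : ℝ))))
  have hslx : ∀ y : ℝ, ContDiff ℝ ∞ fun x => F (x, y) := fun y =>
    hf.comp (contDiff_id.prodMk contDiff_const)
  have hsly : ∀ x : ℝ, ContDiff ℝ ∞ fun y => F (x, y) := fun x =>
    hf.comp (contDiff_const.prodMk contDiff_id)
  have hdx : ∀ (m : ℕ) (x y : ℝ), ‖iteratedFDeriv ℝ m (fun x => F (x, y)) x‖ ≤
      ‖iteratedFDeriv ℝ m F (x, y)‖ := by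
    intro m x y
    have := norm_iteratedFDeriv_comp_affine_le hf (0, y) (ContinuousLinearMap.inl ℝ ℝ ℝ) m x
    simp only [ContinuousLinearMap.inl_apply, Prod.mk_add_mk, zero_add, add_zero] at this
    exact this.trans (mul_le_of_le_one_right (norm_nonneg _)
      (pow_le_one₀ (norm_nonneg _) (ContinuousLinearMap.norm_inl_le_one ℝ ℝ ℝ)))
  have hdy : ∀ (m : ℕ) (x y : ℝ), ‖iteratedFDeriv ℝ m (fun y => F (x, y)) y‖ ≤
      ‖iteratedFDeriv ℝ m F (x, y)‖ := by
    intro m x y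
    have := norm_iteratedFDeriv_comp_affine_le hf (x, 0) (ContinuousLinearMap.inr ℝ ℝ ℝ) m y
    simp only [ContinuousLinearMap.inr_apply, Prod.mk_add_mk, zero_add, add_zero] at this
    exact this.trans (mul_le_of_le_one_right (norm_nonneg _)
      (pow_le_one₀ (norm_nonneg _) (ContinuousLinearMap.norm_inr_le_one ℝ ℝ ℝ)))
  set S : ℝ → ℂ := fun x => ∑ k ∈ K, F (x, k) with hS
  have hSd : ContDiff ℝ ∞ S := ContDiff.sum fun k _ => hslx k
  have hSc : HasCompactSupport S := by
    refine HasCompactSupport.intro (isCompact_closedBall (0 : ℝ) R) fun x hx => ?_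
    refine Finset.sum_eq_zero fun k _ => hz _ ?_
    simp only [Metric.mem_closedBall, dist_zero_right, not_le] at hx
    exact hx.trans_le (norm_fst_le (x, (k : ℝ)))
  have htsum : ∑' j : ℤ × ℤ, F (j.1, j.2) = ∑' n : ℤ, S n := by
    rw [tsum_eq_sum (s := K ×ˢ K), tsum_eq_sum (s := K), Finset.sum_product]
    · intro k hk; exact Finset.sum_eq_zero fun l _ => hzx k hk l
    · intro k hk
      simp only [Finset.mem_product, not_and_or] at hk
      rcases hk with h | h
      · exact hzx _ h _
      · exact hzy _ h _
  have hFint : Integrable F := hf.continuous.integrable_of_hasCompactSupport hc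
  have hINN : Integrable fun p => ‖iteratedFDeriv ℝ N F p‖ + ‖iteratedFDeriv ℝ (N + 1) F p‖ :=
    (hI N).add (hI (N + 1))
  have p1 : ‖∑' n : ℤ, S n - ∫ x, S x‖ ≤
      B * ∫ p, (‖iteratedFDeriv ℝ N F p‖ + ‖iteratedFDeriv ℝ (N + 1) F p‖) := by
    refine (h1 S hSd hSc).trans ?_
    gcongr
    rw [Measure.volume_eq_prod, integral_prod _ hINN]
    have hIs := integrable_norm_iteratedFDeriv (μ := (volume : Measure ℝ)) hSd hSc N
    simp only [norm_iteratedFDeriv_eq_norm_iteratedDeriv] at hIs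
    refine integral_mono hIs (hINN.integral_prod_left) fun x => ?_
    have hN' : ContDiff ℝ ∞ (iteratedFDeriv ℝ N F) :=
      hf.iteratedFDeriv_right (by exact_mod_cast le_top)
    have a := sum_norm_slice_right_le (hN'.of_le (by exact_mod_cast le_top)) (hc.iteratedFDeriv N) x K
    simp only [norm_fderiv_iteratedFDeriv] at a
    refine le_trans ?_ a
    rw [← norm_iteratedFDeriv_eq_norm_iteratedDeriv, hS, iteratedFDeriv_fun_sum_apply (fun (k : ℤ) _ =>
      ((hslx (k : ℝ)).of_le (by exact_mod_cast le_top)).contDiffAt)]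
    exact (norm_sum_le _ _).trans (Finset.sum_le_sum fun k _ => hdx N x k)
  have p2 : ‖(∫ x, S x) - ∫ p, F p‖ ≤
      B * ∫ p, (‖iteratedFDeriv ℝ N F p‖ + ‖iteratedFDeriv ℝ (N + 1) F p‖) := by
    have hSi : Integrable S := hSd.continuous.integrable_of_hasCompactSupport hSc
    rw [Measure.volume_eq_prod, integral_prod _ hFint, ← integral_sub hSi hFint.integral_prod_left]
    rw [← Measure.volume_eq_prod] at *
    refine (norm_integral_le_integral_norm _).trans ?_
    rw [Measure.volume_eq_prod, integral_prod _ hINN, ← integral_const_mul]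
    refine integral_mono (hSi.sub hFint.integral_prod_left).norm
      ((hINN.integral_prod_left).const_mul B) fun x => ?_
    have a := h1 (fun y => F (x, y)) (hsly x) (hasCompactSupport_slice_right hc x)
    have b : ∑' k : ℤ, F (x, k) = S x := tsum_eq_sum fun k hk => hzy k hk x
    rw [b] at a
    refine a.trans ?_
    have hsl : ∀ m, Integrable fun y : ℝ => ‖iteratedFDeriv ℝ m F (x, y)‖ := fun m =>
      (((hf.continuous_iteratedFDeriv (m := m) (by exact_mod_cast le_top)).comp
        (by fun_prop : Continuous fun y : ℝ => (x, y))).integrable_of_hasCompactSupport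
          (hasCompactSupport_slice_right (hc.iteratedFDeriv m) x)).norm
    refine mul_le_mul_of_nonneg_left ?_ hB
    have hIs := integrable_norm_iteratedFDeriv (μ := (volume : Measure ℝ)) (hsly x)
      (hasCompactSupport_slice_right hc x) N
    simp only [norm_iteratedFDeriv_eq_norm_iteratedDeriv] at hIs
    refine integral_mono hIs ((hsl N).add (hsl (N + 1))) fun y => ?_
    rw [← norm_iteratedFDeriv_eq_norm_iteratedDeriv]
    exact (hdy N x y).trans (le_add_of_nonneg_right (norm_nonneg _))
  rw [htsum]
  calc _ ≤ ‖∑' n : ℤ, S n - ∫ x, S x‖ + ‖(∫ x, S x) - ∫ p, F p‖ := by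
        simpa using norm_add_le (∑' n : ℤ, S n - ∫ x, S x) ((∫ x, S x) - ∫ p, F p)
    _ ≤ _ := by linarith

end Product

/-! ### Hadamard's lemma -/

/-- Induction by differentiating under the integral sign. The target space is quantified inside the
induction because the derivative takes values in `P →L[ℝ] F`. -/
theorem contDiff_parametric_intervalIntegral_nat {P : Type} [NormedAddCommGroup P]
    [NormedSpace ℝ P] [ProperSpace P] (n : ℕ) : ∀ {F : Type} [NormedAddCommGroup F]
    [NormedSpace ℝ F] [CompleteSpace F] {g : P × ℝ → F}, ContDiff ℝ ∞ g →
    ContDiff ℝ n fun p => ∫ τ in (0 : ℝ)..1, g (p, τ) := by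
  induction n with
  | zero =>
    intro F _ _ _ g hg
    exact contDiff_zero.2 (intervalIntegral.continuous_parametric_intervalIntegral_of_continuous'
      (f := fun p τ => g (p, τ)) (by simpa using! hg.continuous) 0 1)
  | succ n ih =>
    intro F _ _ _ g hg
    have hg' : ContDiff ℝ ∞ (fderiv ℝ g) := hg.fderiv_right (by simp)
    set g' : P × ℝ → P →L[ℝ] F := fun q => (fderiv ℝ g q).comp (ContinuousLinearMap.inl ℝ P ℝ)
      with hgdef
    have hgd : ContDiff ℝ ∞ g' := hg'.clm_comp contDiff_const
    push_cast
    refine contDiff_succ_iff_hasFDerivAt.2 ⟨fun p => ∫ τ in (0 : ℝ)..1, g' (p, τ), ih hgd, fun p => ?_⟩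
    obtain ⟨C, hC⟩ := ((isCompact_closedBall p 1).prod (isCompact_Icc (a := (0 : ℝ)) (b := 1))).exists_bound_of_continuousOn
      hgd.continuous.continuousOn
    have hcont : ∀ q : P, Continuous fun τ => g (q, τ) := fun q => hg.continuous.comp (by fun_prop)
    have hcont' : ∀ q : P, Continuous fun τ => g' (q, τ) := fun q => hgd.continuous.comp (by fun_prop)
    refine intervalIntegral.hasFDerivAt_integral_of_dominated_of_fderiv_le (bound := fun _ => C)
      (F := fun p τ => g (p, τ)) (F' := fun p τ => g' (p, τ))
      (Metric.closedBall_mem_nhds p one_pos)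
      (Eventually.of_forall fun q => (hcont q).aestronglyMeasurable) ((hcont p).intervalIntegrable _ _)
      (hcont' p).aestronglyMeasurable (Eventually.of_forall fun t ht q hq => hC (q, t) ⟨hq, ?_⟩)
      intervalIntegrable_const (Eventually.of_forall fun t _ q _ => ?_)
    · rw [Set.uIoc_of_le zero_le_one] at ht
      exact ⟨ht.1.le, ht.2⟩
    · exact (((hg.differentiable (by simp)) (q, t)).hasFDerivAt).comp q (hasFDerivAt_prodMk_left q t)

theorem contDiff_parametric_intervalIntegral {P F : Type} [NormedAddCommGroup P]
    [NormedSpace ℝ P] [ProperSpace P] [NormedAddCommGroup F]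
    [NormedSpace ℝ F] [CompleteSpace F] {g : P × ℝ → F} (hg : ContDiff ℝ ∞ g) :
    ContDiff ℝ ∞ fun p => ∫ τ in (0 : ℝ)..1, g (p, τ) :=
  contDiff_infty.2 fun n => contDiff_parametric_intervalIntegral_nat n hg

/-- Hadamard's lemma with parameters. -/
theorem exists_contDiff_eq_smul {E F : Type} [NormedAddCommGroup E] [NormedSpace ℝ E]
    [ProperSpace E] [NormedAddCommGroup F] [NormedSpace ℝ F] [CompleteSpace F] {f : ℝ × E → F}
    (hf : ContDiff ℝ ∞ f) (h0 : ∀ u, f (0, u) = 0) :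
    ∃ k : ℝ × E → F, ContDiff ℝ ∞ k ∧ ∀ t u, f (t, u) = t • k (t, u) := by
  -- The quotient is `∫₀¹ ∂₁f(τt, u) dτ`, by the fundamental theorem of calculus for `τ ↦ f(τt, u)`.
  set g : (ℝ × E) × ℝ → F := fun q => fderiv ℝ f (q.2 * q.1.1, q.1.2) (1, 0) with hgdef
  have hf' : ContDiff ℝ ∞ (fderiv ℝ f) := hf.fderiv_right (by simp)
  have hg : ContDiff ℝ ∞ g := by
    refine ContDiff.clm_apply (hf'.comp ?_) contDiff_const
    fun_prop
  refine ⟨_, contDiff_parametric_intervalIntegral hg, fun t u => ?_⟩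
  have hd : ∀ τ : ℝ, HasDerivAt (fun τ : ℝ => f (τ * t, u)) (t • g ((t, u), τ)) τ := by
    intro τ
    have h1 : HasDerivAt (fun τ : ℝ => (τ * t, u)) (t, 0) τ := by
      simpa using! ((hasDerivAt_id τ).mul_const t).prodMk (hasDerivAt_const τ u)
    have h2 := ((hf.differentiable (by simp)) (τ * t, u)).hasFDerivAt.comp_hasDerivAt τ h1
    have h3 : ((t, 0) : ℝ × E) = t • (1, 0) := by simp
    rw [h3, map_smul] at h2
    exact h2
  have hcont : Continuous fun τ => t • g ((t, u), τ) :=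
    (hg.continuous.comp (by fun_prop : Continuous fun τ : ℝ => ((t, u), τ))).const_smul t
  have h4 := intervalIntegral.integral_eq_sub_of_hasDerivAt (a := 0) (b := 1) (fun τ _ => hd τ)
    (hcont.intervalIntegrable 0 1)
  simp only [one_mul, zero_mul, h0, sub_zero] at h4
  rw [← h4, intervalIntegral.integral_smul]

/-! ### The grid of step `h` in the plane -/

/-- The identification of `ℝ × ℝ` with the parameter plane. -/
def prodEquivPlane : (ℝ × ℝ) ≃L[ℝ] Plane :=
  (ContinuousLinearEquiv.finTwoArrow ℝ ℝ).symm.trans (PiLp.continuousLinearEquiv 2 ℝ _).symm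

theorem measurePreserving_prodEquivPlane :
    MeasurePreserving prodEquivPlane (volume : Measure (ℝ × ℝ)) (volume : Measure Plane) :=
  (PiLp.volume_preserving_toLp (Fin 2)).comp (volume_preserving_finTwoArrow ℝ).symm

theorem gridPoint_eq_smul_prodEquivPlane (h : ℝ) (j : Fin 2 → ℤ) :
    gridPoint h j = h • prodEquivPlane ((j 0 : ℝ), (j 1 : ℝ)) := by
  ext i
  fin_cases i <;> exact mul_comm _ _

theorem integral_smul_prodEquivPlane (f : Plane → ℝ) (h : ℝ) :
    ∫ p, f (h • prodEquivPlane p) = (h ^ 2)⁻¹ * ∫ v, f v := by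
  have h1 := measurePreserving_prodEquivPlane.integral_comp
    prodEquivPlane.toHomeomorph.measurableEmbedding (fun v => f (h • v))
  rw [h1, Measure.integral_comp_smul]
  simp

theorem integral_smul_prodEquivPlane_complex (f : Plane → ℂ) (h : ℝ) :
    ∫ p, f (h • prodEquivPlane p) = ((h : ℂ) ^ 2)⁻¹ * ∫ v, f v := by
  have h1 := measurePreserving_prodEquivPlane.integral_comp
    prodEquivPlane.toHomeomorph.measurableEmbedding (fun v => f (h • v))
  rw [h1, Measure.integral_comp_smul]
  simp

/-- The dilated identification `p ↦ h • p`. -/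
def scaledPlane (h : ℝ) : (ℝ × ℝ) →L[ℝ] Plane := h • (prodEquivPlane : (ℝ × ℝ) →L[ℝ] Plane)

theorem scaledPlane_apply (h : ℝ) (p : ℝ × ℝ) : scaledPlane h p = h • prodEquivPlane p := rfl

theorem norm_iteratedFDeriv_comp_scaledPlane_le {F : Plane → ℂ} (hf : ContDiff ℝ ∞ F) {h : ℝ}
    (hh : 0 < h) (m : ℕ) (p : ℝ × ℝ) :
    ‖iteratedFDeriv ℝ m (fun p => F (h • prodEquivPlane p)) p‖ ≤
      (‖(prodEquivPlane : (ℝ × ℝ) →L[ℝ] Plane)‖ ^ m * h ^ m) *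
        ‖iteratedFDeriv ℝ m F (h • prodEquivPlane p)‖ := by
  have := norm_iteratedFDeriv_comp_affine_le hf 0 (scaledPlane h) m p
  simp only [zero_add, scaledPlane_apply] at this
  refine this.trans_eq ?_
  rw [scaledPlane, norm_smul, Real.norm_of_nonneg hh.le]
  ring

theorem hasCompactSupport_comp_scaledPlane {E : Type*} [Zero E] {F : Plane → E}
    (hc : HasCompactSupport F) {h : ℝ} (hh : 0 < h) :
    HasCompactSupport fun p => F (h • prodEquivPlane p) :=
  hc.comp_homeomorph (prodEquivPlane.toHomeomorph.trans (Homeomorph.smulOfNeZero h hh.ne'))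

/-- Dilating by `h` gives each derivative of order `m` a factor `h^m`, while the Jacobian `h⁻²`
cancels the weight `h²`. The restriction `h ≤ 1` absorbs `h^{N+1}` into `h^N`. -/
theorem exists_norm_tsum_gridPoint_sub_integral_le {N : ℕ} (hN : 2 ≤ N) :
    ∃ B : ℝ, 0 ≤ B ∧ ∀ F : Plane → ℂ, ContDiff ℝ ∞ F → HasCompactSupport F → ∀ h : ℝ, 0 < h →
      h ≤ 1 → ‖∑' j : Fin 2 → ℤ, F (gridPoint h j) * (h : ℂ) ^ 2 - ∫ v, F v‖ ≤
        B * h ^ N * ∫ v, (‖iteratedFDeriv ℝ N F v‖ + ‖iteratedFDeriv ℝ (N + 1) F v‖) := by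
  obtain ⟨B, hB, hP⟩ := exists_norm_tsum_int_prod_sub_integral_le hN
  set M := ‖(prodEquivPlane : (ℝ × ℝ) →L[ℝ] Plane)‖
  refine ⟨B * (M ^ N + M ^ (N + 1)), by positivity, fun F hf hc h hh h1 => ?_⟩
  set G : ℝ × ℝ → ℂ := fun p => F (h • prodEquivPlane p) with hG
  have hGd : ContDiff ℝ ∞ G := hf.comp (scaledPlane h).contDiff
  have hGc : HasCompactSupport G := hasCompactSupport_comp_scaledPlane hc hh
  have key := hP G hGd hGc
  have hh' : (h : ℂ) ≠ 0 := by exact_mod_cast hh.ne'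
  have e1 : ∑' j : Fin 2 → ℤ, F (gridPoint h j) * (h : ℂ) ^ 2 =
      (∑' j : ℤ × ℤ, G (j.1, j.2)) * (h : ℂ) ^ 2 := by
    rw [tsum_mul_right, ← (finTwoArrowEquiv ℤ).tsum_eq]
    simp [hG, gridPoint_eq_smul_prodEquivPlane]
  have e2 : ∫ v, F v = (∫ p, G p) * (h : ℂ) ^ 2 := by
    rw [hG, integral_smul_prodEquivPlane_complex F h]
    field_simp
  rw [e1, e2, ← sub_mul, norm_mul, norm_pow, Complex.norm_real, Real.norm_of_nonneg hh.le]
  have hI := integrable_norm_iteratedFDeriv (μ := (volume : Measure (ℝ × ℝ))) hGd hGc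
  have hJ : ∀ m, Integrable fun p => ‖iteratedFDeriv ℝ m F (h • prodEquivPlane p)‖ := fun m =>
    ((((hf.continuous_iteratedFDeriv (m := m) (by exact_mod_cast le_top)).comp
      (scaledPlane h).continuous).norm).integrable_of_hasCompactSupport
        (hasCompactSupport_comp_scaledPlane (hc.iteratedFDeriv m).norm hh))
  have hle : ∫ p, (‖iteratedFDeriv ℝ N G p‖ + ‖iteratedFDeriv ℝ (N + 1) G p‖) ≤
      (M ^ N + M ^ (N + 1)) * h ^ N * ((h ^ 2)⁻¹ *
        ∫ v, (‖iteratedFDeriv ℝ N F v‖ + ‖iteratedFDeriv ℝ (N + 1) F v‖)) := by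
    rw [← integral_smul_prodEquivPlane (fun v => ‖iteratedFDeriv ℝ N F v‖ +
      ‖iteratedFDeriv ℝ (N + 1) F v‖) h, ← integral_const_mul]
    refine integral_mono ((hI N).add (hI (N + 1))) (((hJ N).add (hJ (N + 1))).const_mul _) fun p => ?_
    have a1 := norm_iteratedFDeriv_comp_scaledPlane_le hf hh N p
    have a2 := norm_iteratedFDeriv_comp_scaledPlane_le hf hh (N + 1) p
    have hp : h ^ (N + 1) ≤ h ^ N := pow_le_pow_of_le_one hh.le h1 (by omega)
    calc _ ≤ _ := add_le_add a1 a2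
      _ ≤ (M ^ N * h ^ N) * ‖iteratedFDeriv ℝ N F (h • prodEquivPlane p)‖ +
          (M ^ (N + 1) * h ^ N) * ‖iteratedFDeriv ℝ (N + 1) F (h • prodEquivPlane p)‖ := by gcongr
      _ ≤ ((M ^ N + M ^ (N + 1)) * h ^ N) * ‖iteratedFDeriv ℝ N F (h • prodEquivPlane p)‖ +
          ((M ^ N + M ^ (N + 1)) * h ^ N) * ‖iteratedFDeriv ℝ (N + 1) F (h • prodEquivPlane p)‖ := by
          gcongr
          · exact le_add_of_nonneg_right (by positivity)
          · exact le_add_of_nonneg_left (by positivity)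
      _ = _ := by ring
  calc _ ≤ (B * ∫ p, (‖iteratedFDeriv ℝ N G p‖ + ‖iteratedFDeriv ℝ (N + 1) G p‖)) * h ^ 2 := by
        gcongr
    _ ≤ (B * ((M ^ N + M ^ (N + 1)) * h ^ N * ((h ^ 2)⁻¹ *
        ∫ v, (‖iteratedFDeriv ℝ N F v‖ + ‖iteratedFDeriv ℝ (N + 1) F v‖)))) * h ^ 2 := by gcongr
    _ = _ := by field_simp

/-- The constant depends on `h`: this serves only for absolute convergence of the sums, not for the
rate. -/
theorem exists_sum_norm_gridPoint_le {h : ℝ} (hh : 0 < h) :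
    ∃ B : ℝ, 0 ≤ B ∧ ∀ F : Plane → ℂ, ContDiff ℝ ∞ F → HasCompactSupport F →
      ∀ s : Finset (Fin 2 → ℤ), ∑ j ∈ s, ‖F (gridPoint h j)‖ ≤
        B * ∫ v, (‖iteratedFDeriv ℝ 0 F v‖ + ‖iteratedFDeriv ℝ 1 F v‖ +
          ‖iteratedFDeriv ℝ 2 F v‖) := by
  set M := ‖(prodEquivPlane : (ℝ × ℝ) →L[ℝ] Plane)‖
  set C : ℝ := 1 + 2 * (M * h) + M ^ 2 * h ^ 2
  have hM : 0 ≤ M := norm_nonneg _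
  have hC : 0 ≤ C := by positivity
  refine ⟨C * (h ^ 2)⁻¹, by positivity, fun F hf hc s => ?_⟩
  set G : ℝ × ℝ → ℂ := fun p => F (h • prodEquivPlane p) with hG
  have hGd : ContDiff ℝ ∞ G := hf.comp (scaledPlane h).contDiff
  have hGc : HasCompactSupport G := hasCompactSupport_comp_scaledPlane hc hh
  have hI := integrable_norm_iteratedFDeriv (μ := (volume : Measure (ℝ × ℝ))) hGd hGc
  have hJ : ∀ m, Integrable fun p => ‖iteratedFDeriv ℝ m F (h • prodEquivPlane p)‖ := fun m =>
    ((((hf.continuous_iteratedFDeriv (m := m) (by exact_mod_cast le_top)).comp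
      (scaledPlane h).continuous).norm).integrable_of_hasCompactSupport
        (hasCompactSupport_comp_scaledPlane (hc.iteratedFDeriv m).norm hh))
  set s₁ := s.image fun j => j 0
  set s₂ := s.image fun j => j 1
  calc ∑ j ∈ s, ‖F (gridPoint h j)‖ = ∑ p ∈ s.map (finTwoArrowEquiv ℤ).toEmbedding,
          ‖G (p.1, p.2)‖ := by
        rw [Finset.sum_map]
        simp [hG, gridPoint_eq_smul_prodEquivPlane]
    _ ≤ ∑ p ∈ s₁ ×ˢ s₂, ‖G (p.1, p.2)‖ := by
        refine Finset.sum_le_sum_of_subset_of_nonneg (fun p hp => ?_) fun _ _ _ => norm_nonneg _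
        obtain ⟨j, hj, rfl⟩ := Finset.mem_map.1 hp
        exact Finset.mem_product.2 ⟨Finset.mem_image.2 ⟨j, hj, rfl⟩, Finset.mem_image.2 ⟨j, hj, rfl⟩⟩
    _ = ∑ j ∈ s₁, ∑ k ∈ s₂, ‖G (j, k)‖ := Finset.sum_product _ _ _
    _ ≤ _ := sum_sum_norm_le_integral hGd hGc s₁ s₂
    _ ≤ ∫ p, C * (‖iteratedFDeriv ℝ 0 F (h • prodEquivPlane p)‖ +
          ‖iteratedFDeriv ℝ 1 F (h • prodEquivPlane p)‖ +
          ‖iteratedFDeriv ℝ 2 F (h • prodEquivPlane p)‖) := by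
        refine integral_mono (((hI 0).add (hI 1)).add ((hI 1).add (hI 2)))
          ((((hJ 0).add (hJ 1)).add (hJ 2)).const_mul _) fun p => ?_
        have a0 := norm_iteratedFDeriv_comp_scaledPlane_le hf hh 0 p
        have a1 := norm_iteratedFDeriv_comp_scaledPlane_le hf hh 1 p
        have a2 := norm_iteratedFDeriv_comp_scaledPlane_le hf hh 2 p
        simp only [pow_zero, pow_one, one_mul] at a0 a1 a2
        set x0 := ‖iteratedFDeriv ℝ 0 F (h • prodEquivPlane p)‖
        set x1 := ‖iteratedFDeriv ℝ 1 F (h • prodEquivPlane p)‖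
        set x2 := ‖iteratedFDeriv ℝ 2 F (h • prodEquivPlane p)‖
        have c0 : x0 ≤ C * x0 := le_mul_of_one_le_left (norm_nonneg _) (by simp only [C]; nlinarith [mul_nonneg hM hh.le, sq_nonneg (M * h)])
        have c1 : 2 * (M * h) * x1 ≤ C * x1 := by
          gcongr; simp only [C]; nlinarith [sq_nonneg (M * h)]
        have c2 : M ^ 2 * h ^ 2 * x2 ≤ C * x2 := by
          gcongr; simp only [C]; nlinarith [mul_nonneg hM hh.le]
        calc _ ≤ x0 + M * h * x1 + (M * h * x1 + M ^ 2 * h ^ 2 * x2) := by gcongr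
          _ ≤ _ := by linarith
    _ = _ := by
        rw [integral_const_mul, integral_smul_prodEquivPlane (fun v => ‖iteratedFDeriv ℝ 0 F v‖ +
          ‖iteratedFDeriv ℝ 1 F v‖ + ‖iteratedFDeriv ℝ 2 F v‖) h, mul_assoc]

/-! ### Cutoffs, and the punctured rule for smooth functions with integrable derivatives -/

/-- A smooth even cutoff, equal to `1` on the ball of radius `1/4` and supported in the ball of
radius `1/2`. -/
def cutoffBump : ContDiffBump (0 : Plane) := ⟨1 / 4, 1 / 2, by norm_num, by norm_num⟩

/-- The cutoff as a complex-valued function. -/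
def cutoff (v : Plane) : ℂ := (cutoffBump v : ℝ)

theorem contDiff_cutoff : ContDiff ℝ ∞ cutoff :=
  Complex.ofRealCLM.contDiff.comp cutoffBump.contDiff

theorem cutoff_neg (v : Plane) : cutoff (-v) = cutoff v := by simp [cutoff, cutoffBump.neg]

theorem cutoff_eq_one {v : Plane} (hv : ‖v‖ ≤ 1 / 4) : cutoff v = 1 := by
  simp [cutoff, cutoffBump.one_of_mem_closedBall (by simpa [cutoffBump] using hv)]

theorem cutoff_eq_zero {v : Plane} (hv : 1 / 2 ≤ ‖v‖) : cutoff v = 0 := by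
  simp [cutoff, cutoffBump.zero_of_le_dist (by simpa [cutoffBump] using hv)]

theorem norm_cutoff_le_one (v : Plane) : ‖cutoff v‖ ≤ 1 := by
  rw [cutoff, Complex.norm_real, Real.norm_of_nonneg cutoffBump.nonneg]
  exact cutoffBump.le_one

theorem hasCompactSupport_cutoff : HasCompactSupport cutoff :=
  HasCompactSupport.intro (isCompact_closedBall 0 (1 / 2)) fun v hv => cutoff_eq_zero (by
    simp only [Metric.mem_closedBall, dist_zero_right, not_le] at hv
    exact hv.le)

theorem contDiff_cutoff_smul (a : ℝ) : ContDiff ℝ ∞ fun v => cutoff (a • v) :=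
  contDiff_cutoff.comp (contDiff_const_smul a)

theorem hasCompactSupport_cutoff_smul {a : ℝ} (ha : a ≠ 0) :
    HasCompactSupport fun v => cutoff (a • v) :=
  hasCompactSupport_cutoff.comp_homeomorph (Homeomorph.smulOfNeZero a ha)

theorem exists_norm_iteratedFDeriv_cutoff_smul_le (m : ℕ) :
    ∃ C : ℝ, 0 ≤ C ∧ ∀ a : ℝ, |a| ≤ 1 → ∀ v,
      ‖iteratedFDeriv ℝ m (fun v => cutoff (a • v)) v‖ ≤ C := by
  obtain ⟨C, hC⟩ := (hasCompactSupport_cutoff.iteratedFDeriv (𝕜 := ℝ) m).exists_bound_of_continuous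
    (contDiff_cutoff.continuous_iteratedFDeriv (m := m) (by exact_mod_cast le_top))
  refine ⟨C, (norm_nonneg _).trans (hC 0), fun a ha v => ?_⟩
  have := norm_iteratedFDeriv_comp_affine_le contDiff_cutoff 0
    (a • ContinuousLinearMap.id ℝ Plane) m v
  simp only [zero_add, smul_apply, ContinuousLinearMap.id_apply] at this
  refine (this.trans (mul_le_of_le_one_right (norm_nonneg _) (pow_le_one₀ (norm_nonneg _) ?_))).trans
    (hC _)
  rw [norm_smul]
  exact mul_le_one₀ ha (norm_nonneg _) ContinuousLinearMap.norm_id_le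

theorem tendsto_cutoff_smul (v : Plane) :
    Tendsto (fun m : ℕ => cutoff ((1 / ((m : ℝ) + 1)) • v)) atTop (𝓝 1) := by
  have h1 : Tendsto (fun m : ℕ => (1 / ((m : ℝ) + 1)) • v) atTop (𝓝 ((0 : ℝ) • v)) :=
    tendsto_one_div_add_atTop_nhds_zero_nat.smul_const v
  rw [zero_smul] at h1
  have := (contDiff_cutoff.continuous.tendsto 0).comp h1
  rwa [cutoff_eq_one (by simp)] at this

/-- The punctured lattice sum `h² ∑' F(jh)`. -/
def puncturedSum (h : ℝ) (F : Plane → ℂ) : ℂ :=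
  ∑' j : PuncturedLattice, F (gridPoint h j.1) * (h : ℂ) ^ 2

/-- The error `∫ F - h² ∑' F(jh)` of the punctured trapezoidal rule. -/
def ruleError (h : ℝ) (F : Plane → ℂ) : ℂ := (∫ v, F v) - puncturedSum h F

theorem gridPoint_zero (h : ℝ) : gridPoint h 0 = 0 := by ext i; simp [gridPoint]

theorem puncturedSum_eq_tsum {F : Plane → ℂ} (h0 : F 0 = 0) (h : ℝ) :
    puncturedSum h F = ∑' j : Fin 2 → ℤ, F (gridPoint h j) * (h : ℂ) ^ 2 :=
  tsum_subtype_eq_of_support_subset (s := {j : Fin 2 → ℤ | j ≠ 0})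
    (f := fun j => F (gridPoint h j) * (h : ℂ) ^ 2) fun j hj hj0 => hj (by
      simp [hj0, gridPoint_zero, h0])

theorem exists_norm_ruleError_le {N : ℕ} (hN : 2 ≤ N) :
    ∃ B : ℝ, 0 ≤ B ∧ ∀ F : Plane → ℂ, ContDiff ℝ ∞ F → HasCompactSupport F → F 0 = 0 →
      ∀ h : ℝ, 0 < h → h ≤ 1 → ‖ruleError h F‖ ≤
        B * h ^ N * ∫ v, (‖iteratedFDeriv ℝ N F v‖ + ‖iteratedFDeriv ℝ (N + 1) F v‖) := by
  obtain ⟨B, hB, hP⟩ := exists_norm_tsum_gridPoint_sub_integral_le hN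
  refine ⟨B, hB, fun F hf hc h0 h hh h1 => ?_⟩
  rw [ruleError, norm_sub_rev, puncturedSum_eq_tsum h0]
  exact hP F hf hc h hh h1

/-- Leibniz' rule: for `|a| ≤ 1` the derivatives of `cutoff (a • v)` are bounded independently of
`a`, so bounds for truncations survive the limit `a → 0`. -/
theorem exists_integral_norm_iteratedFDeriv_mul_cutoff_le {G : Plane → ℂ} (hG : ContDiff ℝ ∞ G)
    (hI : ∀ m, Integrable fun v => ‖iteratedFDeriv ℝ m G v‖) 
    (n : ℕ) :
    ∃ D : ℝ, 0 ≤ D ∧ ∀ a : ℝ, |a| ≤ 1 → a ≠ 0 →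
      ∫ v, ‖iteratedFDeriv ℝ n (fun v => G v * cutoff (a • v)) v‖ ≤ D := by
  choose C hC0 hC using exists_norm_iteratedFDeriv_cutoff_smul_le
  refine ⟨∫ v, ∑ i ∈ Finset.range (n + 1), (n.choose i : ℝ) * ‖iteratedFDeriv ℝ i G v‖ * C (n - i),
    integral_nonneg fun v => Finset.sum_nonneg fun i _ => by have := hC0 (n - i); positivity,
    fun a ha ha0 => ?_⟩
  refine integral_mono (integrable_norm_iteratedFDeriv (hG.mul (contDiff_cutoff_smul a))
    ((hasCompactSupport_cutoff_smul ha0).mul_left) n)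
    (integrable_finsetSum _ fun i _ => ((hI i).const_mul _).mul_const _) fun v => ?_
  refine (norm_iteratedFDeriv_mul_le hG (contDiff_cutoff_smul a) v
    (by exact_mod_cast le_top)).trans ?_
  gcongr with i _
  exact hC _ a ha v

theorem summable_gridPoint {G : Plane → ℂ} (hG : ContDiff ℝ ∞ G)
    (hI : ∀ m, Integrable fun v => ‖iteratedFDeriv ℝ m G v‖) 
    {h : ℝ} (hh : 0 < h) :
    Summable fun j : Fin 2 → ℤ => ‖G (gridPoint h j)‖ := by
  obtain ⟨B, hB, hP⟩ := exists_sum_norm_gridPoint_le hh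
  choose D hD0 hD using exists_integral_norm_iteratedFDeriv_mul_cutoff_le hG hI
  refine summable_of_sum_le (c := B * (D 0 + D 1 + D 2)) (fun _ => norm_nonneg _) fun s => ?_
  have hlim : Tendsto (fun m : ℕ => ∑ j ∈ s,
      ‖G (gridPoint h j) * cutoff ((1 / ((m : ℝ) + 1)) • gridPoint h j)‖) atTop
      (𝓝 (∑ j ∈ s, ‖G (gridPoint h j)‖)) := by
    refine tendsto_finsetSum _ fun j _ => ?_
    simpa using ((tendsto_cutoff_smul (gridPoint h j)).const_mul (G (gridPoint h j))).norm
  refine le_of_tendsto' hlim fun m => ?_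
  have ha : |1 / ((m : ℝ) + 1)| ≤ 1 := by
    rw [abs_of_pos (by positivity)]
    exact (div_le_one (by positivity)).2 (by linarith [Nat.cast_nonneg (α := ℝ) m])
  have ha0 : 1 / ((m : ℝ) + 1) ≠ 0 := by positivity
  set a := 1 / ((m : ℝ) + 1)
  have hd := hG.mul (contDiff_cutoff_smul a)
  have hc : HasCompactSupport fun v => G v * cutoff (a • v) :=
    (hasCompactSupport_cutoff_smul ha0).mul_left
  have hJ := integrable_norm_iteratedFDeriv (μ := (volume : Measure Plane)) hd hc
  have hJ01 : Integrable fun v => ‖iteratedFDeriv ℝ 0 (fun v => G v * cutoff (a • v)) v‖ +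
    ‖iteratedFDeriv ℝ 1 (fun v => G v * cutoff (a • v)) v‖ := (hJ 0).add (hJ 1)
  refine (hP _ hd hc s).trans (mul_le_mul_of_nonneg_left ?_ hB)
  rw [integral_add hJ01 (hJ 2), integral_add (hJ 0) (hJ 1)]
  exact add_le_add (add_le_add (hD 0 a ha ha0) (hD 1 a ha ha0)) (hD 2 a ha ha0)

/-- The compactly supported estimate holds uniformly for the truncations of `G`; their errors
converge to that of `G` by dominated convergence, in the integral and in the sum. -/
theorem exists_norm_ruleError_le_of_integrable {G : Plane → ℂ} (hG : ContDiff ℝ ∞ G)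
    (hI : ∀ m, Integrable fun v => ‖iteratedFDeriv ℝ m G v‖) 
    {N : ℕ} (hN : 2 ≤ N) (h0 : G 0 = 0) :
    ∃ B : ℝ, ∀ h : ℝ, 0 < h → h ≤ 1 → ‖ruleError h G‖ ≤ B * h ^ N := by
  obtain ⟨B, hB, hP⟩ := exists_norm_ruleError_le hN
  choose D hD0 hD using exists_integral_norm_iteratedFDeriv_mul_cutoff_le hG hI
  refine ⟨B * (D N + D (N + 1)), fun h hh h1 => ?_⟩
  have hGi : Integrable fun v => ‖G v‖ := by simpa using hI 0
  have hlim : Tendsto (fun m : ℕ => ruleError h fun v => G v * cutoff ((1 / ((m : ℝ) + 1)) • v))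
      atTop (𝓝 (ruleError h G)) := by
    have hbd : ∀ (a : ℝ) v, ‖G v * cutoff (a • v)‖ ≤ ‖G v‖ := fun a v => by
      rw [norm_mul]; exact mul_le_of_le_one_right (norm_nonneg _) (norm_cutoff_le_one _)
    refine Tendsto.sub ?_ ?_
    · refine tendsto_integral_of_dominated_convergence (fun v => ‖G v‖) (fun m => ?_) hGi
        (fun m => Eventually.of_forall fun v => hbd _ v) (Eventually.of_forall fun v => ?_)
      · exact (hG.continuous.mul (contDiff_cutoff_smul _).continuous).aestronglyMeasurable
      · simpa using (tendsto_cutoff_smul v).const_mul (G v)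
    · refine tendsto_tsum_of_dominated_convergence
        (bound := fun j : PuncturedLattice => ‖G (gridPoint h j.1)‖ * h ^ 2) ?_ (fun j => ?_)
        (Eventually.of_forall fun m j => ?_)
      · exact ((summable_gridPoint hG hI hh).subtype _).mul_right _
      · simpa using ((tendsto_cutoff_smul (gridPoint h j.1)).const_mul
          (G (gridPoint h j.1))).mul_const ((h : ℂ) ^ 2)
      · rw [norm_mul, norm_pow, Complex.norm_real, Real.norm_of_nonneg hh.le]
        gcongr
        exact hbd _ _
  refine le_of_tendsto' hlim.norm fun m => ?_
  have ha : |1 / ((m : ℝ) + 1)| ≤ 1 := by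
    rw [abs_of_pos (by positivity)]
    exact (div_le_one (by positivity)).2 (by linarith [Nat.cast_nonneg (α := ℝ) m])
  have ha0 : 1 / ((m : ℝ) + 1) ≠ 0 := by positivity
  set a := 1 / ((m : ℝ) + 1)
  have hd := hG.mul (contDiff_cutoff_smul a)
  have hc : HasCompactSupport fun v => G v * cutoff (a • v) :=
    (hasCompactSupport_cutoff_smul ha0).mul_left
  have hJ := integrable_norm_iteratedFDeriv (μ := (volume : Measure Plane)) hd hc
  refine (hP _ hd hc (by simp [h0]) h hh h1).trans ?_
  rw [integral_add (hJ N) (hJ (N + 1))]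
  have := add_le_add (hD N a ha ha0) (hD (N + 1) a ha ha0)
  calc _ ≤ B * h ^ N * (D N + D (N + 1)) := by gcongr
    _ = _ := by ring

/-! ### Dyadic annuli and the scaling of the error -/

/-- A smooth even function supported in the annulus `1/4 ≤ ‖v‖ ≤ 1`, whose dyadic dilations sum to
`1` away from the origin. -/
def annulus (v : Plane) : ℂ := cutoff ((1 / 2 : ℝ) • v) - cutoff v

theorem contDiff_annulus : ContDiff ℝ ∞ annulus :=
  (contDiff_cutoff_smul _).sub contDiff_cutoff

theorem annulus_neg (v : Plane) : annulus (-v) = annulus v := by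
  simp [annulus, cutoff_neg, smul_neg]

theorem annulus_eq_zero_of_one_le {v : Plane} (hv : 1 ≤ ‖v‖) : annulus v = 0 := by
  rw [annulus, cutoff_eq_zero, cutoff_eq_zero (by linarith), sub_zero]
  rw [norm_smul]; norm_num; linarith

theorem annulus_eq_zero_of_le {v : Plane} (hv : ‖v‖ ≤ 1 / 4) : annulus v = 0 := by
  rw [annulus, cutoff_eq_one, cutoff_eq_one hv, sub_self]
  rw [norm_smul]; norm_num; linarith [norm_nonneg v]

theorem sum_annulus_dilation (k₀ n : ℕ) (v : Plane) :
    ∑ i ∈ Finset.range n, annulus ((2 : ℝ) ^ (k₀ + 1 + i) • v) =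
      cutoff ((2 : ℝ) ^ k₀ • v) - cutoff ((2 : ℝ) ^ (k₀ + n) • v) := by
  have : ∀ i, annulus ((2 : ℝ) ^ (k₀ + 1 + i) • v) =
      cutoff ((2 : ℝ) ^ (k₀ + i) • v) - cutoff ((2 : ℝ) ^ (k₀ + (i + 1)) • v) := by
    intro i
    rw [annulus, smul_smul]
    congr 3
    · ring_nf
    · ring_nf
  simp_rw [this]
  rw [Finset.sum_range_sub' (fun i => cutoff ((2 : ℝ) ^ (k₀ + i) • v)), add_zero]

theorem le_norm_gridPoint {h : ℝ} (hh : 0 < h) {j : Fin 2 → ℤ} (hj : j ≠ 0) :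
    h ≤ ‖gridPoint h j‖ := by
  obtain ⟨i, hi⟩ := Function.ne_iff.1 hj
  have h1 : (1 : ℝ) ≤ |(j i : ℝ)| := by exact_mod_cast Int.one_le_abs hi
  have h2 := PiLp.norm_apply_le (gridPoint h j) i
  have h3 : ‖gridPoint h j i‖ = |(j i : ℝ)| * h := by
    simp [gridPoint, abs_of_pos hh]
  rw [h3] at h2
  nlinarith

theorem gridPoint_mul (a h : ℝ) (j : Fin 2 → ℤ) : gridPoint (a * h) j = a • gridPoint h j := by
  ext i
  simp [gridPoint]
  ring

theorem ruleError_const_mul (h : ℝ) (c : ℂ) (F : Plane → ℂ) :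
    ruleError h (fun v => c * F v) = c * ruleError h F := by
  simp_rw [ruleError, puncturedSum, integral_const_mul, mul_assoc, tsum_mul_left]
  ring

theorem ruleError_comp_smul {a : ℝ} (ha : 0 < a) (h : ℝ) (F : Plane → ℂ) :
    ruleError h (fun v => F (a • v)) = ((a : ℂ) ^ 2)⁻¹ * ruleError (a * h) F := by
  have ha' : (a : ℂ) ≠ 0 := by exact_mod_cast ha.ne'
  have h1 : ∫ v, F (a • v) = ((a : ℂ) ^ 2)⁻¹ * ∫ v, F v := by
    rw [Measure.integral_comp_smul]; simp
  rw [ruleError, ruleError, h1, mul_sub]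
  congr 1
  rw [puncturedSum, puncturedSum, tsum_mul_right, tsum_mul_right]
  simp_rw [gridPoint_mul]
  push_cast
  field_simp

theorem summable_puncturedSum {F : Plane → ℂ} (hf : ContDiff ℝ ∞ F) (hc : HasCompactSupport F)
    {h : ℝ} (hh : 0 < h) :
    Summable fun j : PuncturedLattice => F (gridPoint h j.1) * (h : ℂ) ^ 2 :=
  (((summable_gridPoint hf (integrable_norm_iteratedFDeriv hf hc) hh).of_norm).subtype
    {j | j ≠ 0}).mul_right _

theorem ruleError_add {F G : Plane → ℂ} {h : ℝ} (hF : Integrable F) (hG : Integrable G)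
    (hF' : Summable fun j : PuncturedLattice => F (gridPoint h j.1) * (h : ℂ) ^ 2)
    (hG' : Summable fun j : PuncturedLattice => G (gridPoint h j.1) * (h : ℂ) ^ 2) :
    ruleError h (fun v => F v + G v) = ruleError h F + ruleError h G := by
  simp_rw [ruleError, puncturedSum, add_mul]
  rw [integral_add hF hG, hF'.tsum_add hG']
  ring

theorem ruleError_sum {ι : Type*} (s : Finset ι) {F : ι → Plane → ℂ} {h : ℝ}
    (hF : ∀ i ∈ s, Integrable (F i))
    (hF' : ∀ i ∈ s, Summable fun j : PuncturedLattice => F i (gridPoint h j.1) * (h : ℂ) ^ 2) :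
    ruleError h (fun v => ∑ i ∈ s, F i v) = ∑ i ∈ s, ruleError h (F i) := by
  simp_rw [ruleError, puncturedSum, Finset.sum_mul]
  rw [integral_finsetSum s hF, Summable.tsum_finsetSum hF', Finset.sum_sub_distrib]

theorem hasCompactSupport_of_eq_zero {F : Plane → ℂ} (hz : ∀ v, 1 ≤ ‖v‖ → F v = 0) :
    HasCompactSupport F :=
  HasCompactSupport.intro (isCompact_closedBall 0 1) fun v hv => hz v (by
    simp only [Metric.mem_closedBall, dist_zero_right, not_le] at hv
    exact hv.le)

theorem integral_norm_le_of_eq_zero {E : Type*} [NormedAddCommGroup E] {F : Plane → E} {C : ℝ}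
    (hz : ∀ v, 1 < ‖v‖ → F v = 0) (hC : ∀ v, ‖F v‖ ≤ C) :
    ∫ v, ‖F v‖ ≤ C * volume.real (Metric.closedBall (0 : Plane) 1) := by
  have h1 : ∫ v, ‖F v‖ = ∫ v in Metric.closedBall (0 : Plane) 1, ‖F v‖ :=
    (setIntegral_eq_integral_of_forall_compl_eq_zero fun v hv => by
      simp only [Metric.mem_closedBall, dist_zero_right, not_le] at hv
      simp [hz v hv]).symm
  rw [h1]
  refine (Real.le_norm_self _).trans (norm_setIntegral_le_of_norm_le_const
    (isCompact_closedBall _ _).measure_lt_top fun v _ => ?_)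
  simpa using hC v

theorem iteratedFDeriv_eq_zero_of_eq_zero {F : Plane → ℂ} (hz : ∀ v, 1 ≤ ‖v‖ → F v = 0) (m : ℕ)
    {v : Plane} (hv : 1 < ‖v‖) : iteratedFDeriv ℝ m F v = 0 := by
  by_contra h
  have h1 := support_iteratedFDeriv_subset (𝕜 := ℝ) m h
  have h2 : tsupport F ⊆ Metric.closedBall 0 1 := closure_minimal (fun w hw => by
    by_contra h3
    simp only [Metric.mem_closedBall, dist_zero_right, not_le] at h3
    exact hw (hz w h3.le)) Metric.isClosed_closedBall
  have := h2 h1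
  simp only [Metric.mem_closedBall, dist_zero_right] at this
  linarith

/-- At step `h ≥ 1` no nonzero grid point lies in the open unit ball, so the punctured sum vanishes.
-/
theorem ruleError_eq_integral {F : Plane → ℂ} (hz : ∀ v, 1 ≤ ‖v‖ → F v = 0) {h : ℝ} (hh : 1 ≤ h) :
    ruleError h F = ∫ v, F v := by
  have : puncturedSum h F = 0 := by
    rw [puncturedSum]
    convert! tsum_zero with j
    rw [hz _ (hh.trans (le_norm_gridPoint (by linarith) j.2)), zero_mul]
  rw [ruleError, this, sub_zero]

theorem exists_norm_ruleError_le_of_bound {N : ℕ} (hN : 2 ≤ N) :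
    ∃ B : ℝ, 0 ≤ B ∧ ∀ (F : Plane → ℂ) (C : ℝ), ContDiff ℝ ∞ F → (∀ v, 1 ≤ ‖v‖ → F v = 0) →
      F 0 = 0 → (∀ v, ‖iteratedFDeriv ℝ N F v‖ ≤ C) → (∀ v, ‖iteratedFDeriv ℝ (N + 1) F v‖ ≤ C) →
      ∀ h : ℝ, 0 < h → h ≤ 1 → ‖ruleError h F‖ ≤ B * C * h ^ N := by
  obtain ⟨B, hB, hP⟩ := exists_norm_ruleError_le hN
  set V := volume.real (Metric.closedBall (0 : Plane) 1)
  refine ⟨B * (2 * V), by positivity, fun F C hf hz h0 h1 h2 h hh hh1 => ?_⟩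
  have hc := hasCompactSupport_of_eq_zero hz
  refine (hP F hf hc h0 h hh hh1).trans ?_
  have hJ := integrable_norm_iteratedFDeriv (μ := (volume : Measure Plane)) hf hc
  rw [integral_add (hJ N) (hJ (N + 1))]
  have a1 := integral_norm_le_of_eq_zero (fun v => iteratedFDeriv_eq_zero_of_eq_zero hz N) h1
  have a2 := integral_norm_le_of_eq_zero (fun v => iteratedFDeriv_eq_zero_of_eq_zero hz (N + 1)) h2
  calc _ ≤ B * h ^ N * (C * V + C * V) := by gcongr
    _ = _ := by ring

/-- The terms increase geometrically up to `2^k ≈ 1/h` and decrease geometrically afterwards, so the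
sum is comparable to the peak value `h^p`. -/
theorem exists_sum_dyadic_le {p : ℝ} (hp : 0 < p) {N : ℕ} (hN : p < N) :
    ∃ C : ℝ, 0 ≤ C ∧ ∀ h : ℝ, 0 < h → h ≤ 1 → ∀ s : Finset ℕ,
      ∑ k ∈ s, ((2 : ℝ) ^ k) ^ (-p) * min 1 (((2 : ℝ) ^ k * h) ^ N) ≤ C * h ^ p := by
  -- Above the peak the decay exponent is `p`, below it `N - p`; the smaller one serves both sides.
  set q : ℝ := min p (N - p) with hq
  have hq0 : 0 < q := lt_min hp (by linarith)
  set r : ℝ := (2 : ℝ) ^ (-q) with hr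
  have hr0 : 0 < r := by positivity
  have hr1 : r < 1 := Real.rpow_lt_one_of_one_lt_of_neg one_lt_two (by linarith)
  have hgeom : ∀ n : ℕ, ∑ i ∈ Finset.range n, r ^ i ≤ (1 - r)⁻¹ := fun n => by
    rw [← tsum_geometric_of_lt_one hr0.le hr1]
    exact (summable_geometric_of_lt_one hr0.le hr1).sum_le_tsum _ fun _ _ => by positivity
  have hrpow : ∀ i : ℕ, r ^ i = ((2 : ℝ) ^ i) ^ (-q) := fun i => by
    rw [hr, ← Real.rpow_natCast, ← Real.rpow_natCast, ← Real.rpow_mul zero_le_two,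
      ← Real.rpow_mul zero_le_two, mul_comm]
  refine ⟨2 * (1 - r)⁻¹, by have := sub_pos.2 hr1; positivity, fun h hh h1 s => ?_⟩
  -- The peak: `2^m ≤ 1/h < 2^{m+1}`.
  obtain ⟨m, hm1, hm2⟩ := exists_nat_pow_near (one_le_inv_iff₀.2 ⟨hh, h1⟩) one_lt_two
  have hm1' : (2 : ℝ) ^ m * h ≤ 1 := by
    calc _ ≤ h⁻¹ * h := by gcongr
      _ = 1 := inv_mul_cancel₀ hh.ne'
  have hm2' : 1 ≤ (2 : ℝ) ^ (m + 1) * h := by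
    calc 1 = h⁻¹ * h := (inv_mul_cancel₀ hh.ne').symm
      _ ≤ _ := by gcongr
  set f : ℕ → ℝ := fun k => ((2 : ℝ) ^ k) ^ (-p) * min 1 (((2 : ℝ) ^ k * h) ^ N) with hf
  have hf0 : ∀ k, 0 ≤ f k := fun k => by positivity
  have hfx : ∀ k, ((2 : ℝ) ^ k) ^ (-p) = h ^ p * ((2 : ℝ) ^ k * h) ^ (-p) := fun k => by
    rw [Real.mul_rpow (by positivity) hh.le, mul_left_comm, ← Real.rpow_add hh, add_neg_cancel,
      Real.rpow_zero, mul_one]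
  have hsmall : ∀ i ≤ m, f (m - i) ≤ h ^ p * r ^ i := by
    intro i hi
    set x := (2 : ℝ) ^ (m - i) * h with hx
    have hx0 : 0 < x := by positivity
    have hxi : x ≤ ((2 : ℝ) ^ i)⁻¹ := by
      rw [le_inv_comm₀ hx0 (by positivity), le_inv_comm₀ (by positivity) hx0, hx,
        pow_sub₀ _ two_ne_zero hi, mul_right_comm]
      exact mul_le_of_le_one_left (by positivity) hm1'
    have hx1 : x ≤ 1 := hxi.trans (inv_le_one_of_one_le₀ (one_le_pow₀ one_le_two))
    calc f (m - i) ≤ h ^ p * x ^ (-p) * x ^ N := by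
          rw [hf]; simp only; rw [hfx]; gcongr; exact min_le_right _ _
      _ = h ^ p * x ^ ((N : ℝ) - p) := by
          rw [mul_assoc, ← Real.rpow_natCast, ← Real.rpow_add hx0]; ring_nf
      _ ≤ h ^ p * x ^ q := by
          gcongr h ^ p * ?_
          exact Real.rpow_le_rpow_of_exponent_ge hx0 hx1 (min_le_right _ _)
      _ ≤ h ^ p * (((2 : ℝ) ^ i)⁻¹) ^ q := by gcongr
      _ = _ := by rw [hrpow, Real.inv_rpow (by positivity), Real.rpow_neg (by positivity)]
  have hlarge : ∀ i, f (m + 1 + i) ≤ h ^ p * r ^ i := by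
    intro i
    set x := (2 : ℝ) ^ (m + 1 + i) * h with hx
    have hxi : (2 : ℝ) ^ i ≤ x := by
      rw [hx, pow_add, mul_right_comm]
      exact le_mul_of_one_le_left (by positivity) hm2'
    have hx1 : 1 ≤ x := (one_le_pow₀ one_le_two).trans hxi
    calc f (m + 1 + i) ≤ h ^ p * x ^ (-p) * 1 := by
          rw [hf]; simp only; rw [hfx]; gcongr; exact min_le_left _ _
      _ ≤ h ^ p * x ^ (-q) := by
          rw [mul_one]
          gcongr h ^ p * ?_
          exact Real.rpow_le_rpow_of_exponent_le hx1 (neg_le_neg (min_le_left _ _))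
      _ ≤ h ^ p * ((2 : ℝ) ^ i) ^ (-q) := by
          gcongr h ^ p * ?_
          exact Real.rpow_le_rpow_of_nonpos (by positivity) hxi (by linarith)
      _ = _ := by rw [hrpow]
  obtain ⟨n, hn⟩ := s.exists_nat_subset_range
  calc ∑ k ∈ s, f k ≤ ∑ k ∈ Finset.range (m + 1 + n), f k :=
        Finset.sum_le_sum_of_subset_of_nonneg
          (hn.trans (Finset.range_subset_range.2 (by omega))) fun _ _ _ => hf0 _
    _ = ∑ i ∈ Finset.range (m + 1), f (m - i) + ∑ i ∈ Finset.range n, f (m + 1 + i) := by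
        rw [Finset.sum_range_add, ← Finset.sum_range_reflect f (m + 1)]
        congr 1
    _ ≤ ∑ i ∈ Finset.range (m + 1), h ^ p * r ^ i + ∑ i ∈ Finset.range n, h ^ p * r ^ i := by
        gcongr with i hi i hi
        · exact hsmall i (by simp at hi; omega)
        · exact hlarge i
    _ ≤ h ^ p * (1 - r)⁻¹ + h ^ p * (1 - r)⁻¹ := by
        rw [← Finset.mul_sum, ← Finset.mul_sum]
        gcongr <;> exact hgeom _
    _ = _ := by ring

/-! ### Singularities of homogeneous type -/

/-- `W` behaves near the origin like a function which is homogeneous of degree `d`: its dilations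
`2^{kd} W(2^{-k} ·)`, `k > k₀`, are smooth on the annulus with uniform bounds for all derivatives. -/
structure IsConormal (W : Plane → ℂ) (k₀ : ℕ) (d : ℝ) (w : ℕ → Plane → ℂ) : Prop where
  dilation : ∀ k > k₀, ∀ v, W (((2 : ℝ) ^ k)⁻¹ • v) * annulus v =
    ((((2 : ℝ) ^ k) ^ (-d) : ℝ) : ℂ) * w k v
  contDiff : ∀ k > k₀, ContDiff ℝ ∞ (w k)
  eq_zero : ∀ k > k₀, ∀ v, 1 ≤ ‖v‖ → w k v = 0
  zero : ∀ k > k₀, w k 0 = 0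
  bound : ∀ m : ℕ, ∃ C : ℝ, ∀ k > k₀, ∀ v, ‖iteratedFDeriv ℝ m (w k) v‖ ≤ C

variable {W : Plane → ℂ} {k₀ : ℕ} {d : ℝ} {w : ℕ → Plane → ℂ}

theorem IsConormal.mul_annulus (hW : IsConormal W k₀ d w) {k : ℕ} (hk : k₀ < k) (v : Plane) :
    W v * annulus ((2 : ℝ) ^ k • v) =
      ((((2 : ℝ) ^ k) ^ (-d) : ℝ) : ℂ) * w k ((2 : ℝ) ^ k • v) := by
  have := hW.dilation k hk ((2 : ℝ) ^ k • v)
  rwa [smul_smul, inv_mul_cancel₀ (by positivity), one_smul] at this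

theorem IsConormal.contDiff_mul_annulus (hW : IsConormal W k₀ d w) {k : ℕ} (hk : k₀ < k) :
    ContDiff ℝ ∞ fun v => W v * annulus ((2 : ℝ) ^ k • v) := by
  simp_rw [hW.mul_annulus hk]
  exact contDiff_const.mul ((hW.contDiff k hk).comp (contDiff_const_smul _))

theorem hasCompactSupport_mul_annulus (W : Plane → ℂ) (k : ℕ) :
    HasCompactSupport fun v => W v * annulus ((2 : ℝ) ^ k • v) := by
  refine HasCompactSupport.mul_left ?_
  exact (hasCompactSupport_of_eq_zero fun v hv => annulus_eq_zero_of_one_le hv).comp_homeomorph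
    (Homeomorph.smulOfNeZero ((2 : ℝ) ^ k) (by positivity))

theorem two_pow_rpow_neg_mul_inv_sq (k : ℕ) (d : ℝ) :
    ((2 : ℝ) ^ k) ^ (-d) * (((2 : ℝ) ^ k) ^ 2)⁻¹ = ((2 : ℝ) ^ k) ^ (-(d + 2)) := by
  have h2 : ((2 : ℝ) ^ k) ^ 2 = ((2 : ℝ) ^ k) ^ (2 : ℝ) := by norm_cast
  rw [neg_add, Real.rpow_add (by positivity), Real.rpow_neg (by positivity) 2, h2]

theorem IsConormal.ruleError_mul_annulus (hW : IsConormal W k₀ d w) {k : ℕ} (hk : k₀ < k) (h : ℝ) :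
    ruleError h (fun v => W v * annulus ((2 : ℝ) ^ k • v)) =
      ((((2 : ℝ) ^ k) ^ (-(d + 2)) : ℝ) : ℂ) * ruleError ((2 : ℝ) ^ k * h) (w k) := by
  simp_rw [hW.mul_annulus hk]
  rw [ruleError_const_mul, ruleError_comp_smul (by positivity), ← mul_assoc,
    ← two_pow_rpow_neg_mul_inv_sq]
  push_cast
  rfl

theorem IsConormal.integral_norm_mul_annulus (hW : IsConormal W k₀ d w) {k : ℕ} (hk : k₀ < k) :
    ∫ v, ‖W v * annulus ((2 : ℝ) ^ k • v)‖ = ((2 : ℝ) ^ k) ^ (-(d + 2)) * ∫ v, ‖w k v‖ := by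
  simp_rw [hW.mul_annulus hk, norm_mul, Complex.norm_real]
  rw [integral_const_mul, Measure.integral_comp_smul volume (fun v => ‖w k v‖),
    ← two_pow_rpow_neg_mul_inv_sq, Real.norm_of_nonneg (by positivity)]
  simp [mul_assoc]

theorem mul_one_sub_cutoff_eq_sum (W : Plane → ℂ) (k₀ : ℕ) (n : ℕ) (v : Plane) :
    W v * cutoff ((2 : ℝ) ^ k₀ • v) * (1 - cutoff ((2 : ℝ) ^ (k₀ + (n + 1)) • v)) =
      ∑ i ∈ Finset.range (n + 1), W v * annulus ((2 : ℝ) ^ (k₀ + 1 + i) • v) := by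
  rw [← Finset.mul_sum, sum_annulus_dilation, mul_assoc]
  congr 1
  -- The product of the two cutoffs is the inner one, since the outer cutoff equals `1` wherever the
  -- inner one can be nonzero.
  by_cases hv : ‖(2 : ℝ) ^ (k₀ + (n + 1)) • v‖ < 1 / 2
  · rw [cutoff_eq_one (v := (2 : ℝ) ^ k₀ • v), one_mul]
    rw [norm_smul, Real.norm_of_nonneg (by positivity)] at hv ⊢
    have h1 : (2 : ℝ) ≤ 2 ^ (n + 1) := by
      rw [pow_succ]; linarith [one_le_pow₀ (M₀ := ℝ) one_le_two (n := n)]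
    rw [pow_add, mul_assoc, mul_left_comm] at hv
    have h2 : 0 ≤ (2 : ℝ) ^ k₀ * ‖v‖ := by positivity
    nlinarith
  · rw [cutoff_eq_zero (not_lt.1 hv)]
    ring

theorem IsConormal.exists_integral_norm_le (hW : IsConormal W k₀ d w) (hd : -2 < d) :
    ∃ C : ℝ, ∀ s : Finset ℕ,
      ∑ i ∈ s, ∫ v, ‖W v * annulus ((2 : ℝ) ^ (k₀ + 1 + i) • v)‖ ≤ C := by
  obtain ⟨C, hC⟩ := hW.bound 0
  simp only [norm_iteratedFDeriv_zero] at hC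
  set V := volume.real (Metric.closedBall (0 : Plane) 1)
  have hC0 : 0 ≤ C := (norm_nonneg _).trans (hC (k₀ + 1) (by omega) 0)
  obtain ⟨N, hN⟩ := exists_nat_gt (d + 2)
  obtain ⟨D, -, hD⟩ := exists_sum_dyadic_le (by linarith : 0 < d + 2) hN
  refine ⟨D * (C * V), fun s => ?_⟩
  calc ∑ i ∈ s, ∫ v, ‖W v * annulus ((2 : ℝ) ^ (k₀ + 1 + i) • v)‖
      ≤ ∑ i ∈ s, ((2 : ℝ) ^ (k₀ + 1 + i)) ^ (-(d + 2)) * (C * V) := by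
        refine Finset.sum_le_sum fun i _ => ?_
        rw [hW.integral_norm_mul_annulus (by omega)]
        gcongr
        exact integral_norm_le_of_eq_zero (fun v hv => hW.eq_zero _ (by omega) v hv.le)
          (hC _ (by omega))
    -- At `h = 1` every minimum in the dyadic lemma is `1`, so that lemma yields the geometric bound
    -- needed here.
    _ = (∑ k ∈ s.map (addLeftEmbedding (k₀ + 1)),
          ((2 : ℝ) ^ k) ^ (-(d + 2)) * min 1 (((2 : ℝ) ^ k * 1) ^ N)) * (C * V) := by
        rw [Finset.sum_map, Finset.sum_mul]
        refine Finset.sum_congr rfl fun i _ => ?_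
        rw [min_eq_left (one_le_pow₀ (by rw [mul_one]; exact one_le_pow₀ one_le_two)), mul_one]
        rfl
    _ ≤ _ := by
        gcongr
        simpa using hD 1 one_pos le_rfl (s.map (addLeftEmbedding (k₀ + 1)))

/-- After rescaling, annulus `k` is seen at step `2^k h`. For `2^k h ≤ 1` the smooth estimate of
order `N` applies uniformly in `k`; for `2^k h ≥ 1` the error is the bare integral, which is
bounded. -/
theorem IsConormal.exists_sum_norm_ruleError_le (hW : IsConormal W k₀ d w) (hd : -2 < d) :
    ∃ C : ℝ, ∀ h : ℝ, 0 < h → h ≤ 1 → ∀ s : Finset ℕ,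
      ∑ i ∈ s, ‖ruleError h (fun v => W v * annulus ((2 : ℝ) ^ (k₀ + 1 + i) • v))‖ ≤
        C * h ^ (d + 2) := by
  set V := volume.real (Metric.closedBall (0 : Plane) 1)
  obtain ⟨N', hN'⟩ := exists_nat_gt (d + 2)
  -- The dyadic sum needs `N > d + 2`, Poisson summation needs `N ≥ 2`.
  set N := max N' 2
  have hN : d + 2 < N := hN'.trans_le (by exact_mod_cast le_max_left _ _)
  obtain ⟨C0, hC0⟩ := hW.bound 0
  obtain ⟨C1, hC1⟩ := hW.bound N
  obtain ⟨C2, hC2⟩ := hW.bound (N + 1)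
  simp only [norm_iteratedFDeriv_zero] at hC0
  obtain ⟨B, hB0, hB⟩ := exists_norm_ruleError_le_of_bound (le_max_right N' 2)
  obtain ⟨D, -, hD⟩ := exists_sum_dyadic_le (by linarith : 0 < d + 2) hN
  set K := max (C0 * V) (B * max C1 C2)
  have hE : ∀ k > k₀, ∀ h : ℝ, 0 < h → ‖ruleError h (w k)‖ ≤ K * min 1 (h ^ N) := by
    intro k hk h hh
    rcases le_total h 1 with h1 | h1
    · rw [min_eq_right (pow_le_one₀ hh.le h1)]
      refine (hB (w k) (max C1 C2) (hW.contDiff k hk) (hW.eq_zero k hk) (hW.zero k hk)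
        (fun v => (hC1 k hk v).trans (le_max_left _ _))
        (fun v => (hC2 k hk v).trans (le_max_right _ _)) h hh h1).trans ?_
      gcongr
      exact le_max_right _ _
    · rw [min_eq_left (one_le_pow₀ h1), ruleError_eq_integral (hW.eq_zero k hk) h1, mul_one]
      exact (norm_integral_le_integral_norm _).trans ((integral_norm_le_of_eq_zero
        (fun v hv => hW.eq_zero k hk v hv.le) (hC0 k hk)).trans (le_max_left _ _))
  have hK : 0 ≤ K := by
    have := (norm_nonneg _).trans (hE (k₀ + 1) (by omega) 1 one_pos)
    simpa using this
  refine ⟨K * D, fun h hh h1 s => ?_⟩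
  calc _ ≤ ∑ i ∈ s, K * (((2 : ℝ) ^ (k₀ + 1 + i)) ^ (-(d + 2)) *
          min 1 (((2 : ℝ) ^ (k₀ + 1 + i) * h) ^ N)) := by
        refine Finset.sum_le_sum fun i _ => ?_
        rw [hW.ruleError_mul_annulus (by omega), norm_mul, Complex.norm_real,
          Real.norm_of_nonneg (by positivity), mul_left_comm]
        gcongr
        exact hE _ (by omega) _ (by positivity)
    _ = K * ∑ k ∈ s.map (addLeftEmbedding (k₀ + 1)),
          ((2 : ℝ) ^ k) ^ (-(d + 2)) * min 1 (((2 : ℝ) ^ k * h) ^ N) := by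
        rw [Finset.sum_map, Finset.mul_sum]
        rfl
    _ ≤ K * (D * h ^ (d + 2)) := by
        gcongr
        exact hD h hh h1 _
    _ = _ := by ring

theorem exists_cutoff_two_pow_eq_zero (k₀ : ℕ) {ε : ℝ} (hε : 0 < ε) :
    ∀ᶠ n : ℕ in atTop, ∀ v : Plane, ε ≤ ‖v‖ → cutoff ((2 : ℝ) ^ (k₀ + (n + 1)) • v) = 0 := by
  obtain ⟨M, hM⟩ := pow_unbounded_of_one_lt (1 / 2 / ε) (one_lt_two : (1 : ℝ) < 2)
  filter_upwards [eventually_ge_atTop M] with n hn v hv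
  refine cutoff_eq_zero ?_
  rw [norm_smul, Real.norm_of_nonneg (by positivity)]
  rw [div_lt_iff₀ hε] at hM
  refine hM.le.trans ?_
  gcongr
  · exact one_le_two
  · omega

theorem IsConormal.integrable (hW : IsConormal W k₀ d w) (hd : -2 < d) :
    Integrable fun v => W v * cutoff ((2 : ℝ) ^ k₀ • v) := by
  obtain ⟨C, hC⟩ := hW.exists_integral_norm_le hd
  have hi : ∀ i, Integrable fun v => W v * annulus ((2 : ℝ) ^ (k₀ + 1 + i) • v) := fun i =>
    (hW.contDiff_mul_annulus (by omega)).continuous.integrable_of_hasCompactSupport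
      (hasCompactSupport_mul_annulus W _)
  set S : ℕ → Plane → ℂ := fun n v =>
    ∑ i ∈ Finset.range (n + 1), W v * annulus ((2 : ℝ) ^ (k₀ + 1 + i) • v)
  have hS : ∀ n, Integrable (S n) := fun n => integrable_finsetSum _ fun i _ => hi i
  set φ : ℕ → Set Plane := fun n => {v | ((2 : ℝ) ^ (k₀ + (n + 1)))⁻¹ ≤ ‖v‖}
  have hφS : ∀ n, ∀ v ∈ φ n, W v * cutoff ((2 : ℝ) ^ k₀ • v) = S n v := by
    intro n v hv
    change _ = ∑ i ∈ Finset.range (n + 1), W v * annulus ((2 : ℝ) ^ (k₀ + 1 + i) • v)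
    rw [← mul_one_sub_cutoff_eq_sum, cutoff_eq_zero (v := (2 : ℝ) ^ (k₀ + (n + 1)) • v), sub_zero,
      mul_one]
    rw [norm_smul, Real.norm_of_nonneg (by positivity)]
    have : 1 ≤ (2 : ℝ) ^ (k₀ + (n + 1)) * ‖v‖ := by
      calc (1 : ℝ) = (2 : ℝ) ^ (k₀ + (n + 1)) * ((2 : ℝ) ^ (k₀ + (n + 1)))⁻¹ :=
            (mul_inv_cancel₀ (by positivity)).symm
        _ ≤ _ := by gcongr; exact hv
    linarith
  have hφm : ∀ n, MeasurableSet (φ n) := fun n => measurableSet_le measurable_const measurable_norm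
  have hcov : AECover volume atTop φ := by
    refine ⟨?_, hφm⟩
    have : ∀ᵐ v : Plane, v ≠ 0 := by simp [ae_iff]
    filter_upwards [this] with v hv
    obtain ⟨M, hM⟩ := pow_unbounded_of_one_lt ‖v‖⁻¹ (one_lt_two : (1 : ℝ) < 2)
    filter_upwards [eventually_ge_atTop M] with n hn
    refine inv_le_of_inv_le₀ (norm_pos_iff.2 hv) (hM.le.trans ?_)
    gcongr
    · exact one_le_two
    · omega
  refine hcov.integrable_of_integral_norm_bounded C (fun n => ?_) (Eventually.of_forall fun n => ?_)
  · exact (hS n).integrableOn.congr_fun (fun v hv => (hφS n v hv).symm) (hφm n)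
  · rw [setIntegral_congr_fun (hφm n) (fun v hv => by rw [hφS n v hv])]
    refine (setIntegral_le_integral (hS n).norm (Eventually.of_forall fun _ => norm_nonneg _)).trans
      (le_trans ?_ (hC (Finset.range (n + 1))))
    rw [← integral_finsetSum _ fun i _ => (hi i).norm]
    exact integral_mono (hS n).norm (integrable_finsetSum _ fun i _ => (hi i).norm)
      fun v => norm_sum_le _ _

/-- Adding annuli inwards fills the punctured neighbourhood. The integrals converge by domination,
while the lattice sums are eventually constant, since nonzero grid points stay at distance at least
`h` from the origin. -/
theorem IsConormal.tendsto_ruleError (hW : IsConormal W k₀ d w) (hd : -2 < d) {h : ℝ} (hh : 0 < h) :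
    Tendsto (fun n => ∑ i ∈ Finset.range (n + 1),
      ruleError h (fun v => W v * annulus ((2 : ℝ) ^ (k₀ + 1 + i) • v))) atTop
      (𝓝 (ruleError h fun v => W v * cutoff ((2 : ℝ) ^ k₀ • v))) := by
  have hi : ∀ i, Integrable fun v => W v * annulus ((2 : ℝ) ^ (k₀ + 1 + i) • v) := fun i =>
    (hW.contDiff_mul_annulus (by omega)).continuous.integrable_of_hasCompactSupport
      (hasCompactSupport_mul_annulus W _)
  have hs : ∀ i, Summable fun j : PuncturedLattice => W (gridPoint h j.1) *
      annulus ((2 : ℝ) ^ (k₀ + 1 + i) • gridPoint h j.1) * (h : ℂ) ^ 2 := fun i =>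
    summable_puncturedSum (hW.contDiff_mul_annulus (by omega))
      (hasCompactSupport_mul_annulus W _) hh
  have hsum : ∀ n, ∑ i ∈ Finset.range (n + 1),
      ruleError h (fun v => W v * annulus ((2 : ℝ) ^ (k₀ + 1 + i) • v)) =
      ruleError h fun v => W v * cutoff ((2 : ℝ) ^ k₀ • v) *
        (1 - cutoff ((2 : ℝ) ^ (k₀ + (n + 1)) • v)) := by
    intro n
    rw [← ruleError_sum _ (fun i _ => hi i) (fun i _ => hs i)]
    simp_rw [mul_one_sub_cutoff_eq_sum]
  simp_rw [hsum]
  refine Tendsto.sub ?_ ?_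
  · refine tendsto_integral_of_dominated_convergence
      (fun v => 2 * ‖W v * cutoff ((2 : ℝ) ^ k₀ • v)‖) (fun n => ?_)
      ((hW.integrable hd).norm.const_mul 2) (fun n => Eventually.of_forall fun v => ?_) ?_
    · simp_rw [mul_one_sub_cutoff_eq_sum]
      exact (integrable_finsetSum _ fun i _ => hi i).aestronglyMeasurable
    · rw [norm_mul, mul_comm 2]
      gcongr
      refine (norm_sub_le _ _).trans ?_
      rw [norm_one]
      linarith [norm_cutoff_le_one ((2 : ℝ) ^ (k₀ + (n + 1)) • v)]
    · have : ∀ᵐ v : Plane, v ≠ 0 := by simp [ae_iff]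
      filter_upwards [this] with v hv
      refine tendsto_const_nhds.congr' ?_
      filter_upwards [exists_cutoff_two_pow_eq_zero k₀ (norm_pos_iff.2 hv)] with n hn
      rw [hn v le_rfl, sub_zero, mul_one]
  · refine tendsto_const_nhds.congr' ?_
    filter_upwards [exists_cutoff_two_pow_eq_zero k₀ hh] with n hn
    refine tsum_congr fun j => ?_
    beta_reduce
    rw [hn _ (le_norm_gridPoint hh j.2), sub_zero, mul_one]

theorem IsConormal.exists_norm_ruleError_le (hW : IsConormal W k₀ d w) (hd : -2 < d) :
    ∃ C : ℝ, ∀ h : ℝ, 0 < h → h ≤ 1 →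
      ‖ruleError h fun v => W v * cutoff ((2 : ℝ) ^ k₀ • v)‖ ≤ C * h ^ (d + 2) := by
  obtain ⟨C, hC⟩ := hW.exists_sum_norm_ruleError_le hd
  exact ⟨C, fun h hh h1 => le_of_tendsto' (hW.tendsto_ruleError hd hh).norm fun n =>
    (norm_sum_le _ _).trans (hC h hh h1 _)⟩

/-! ### Complex powers of the quadratic form -/

/-- The quadratic form of a complex matrix on the real plane. -/
def planeForm (A : Matrix (Fin 2) (Fin 2) ℂ) (v : Plane) : ℂ := quadForm A fun i => (v i : ℂ)

theorem planeForm_eq_sum (A : Matrix (Fin 2) (Fin 2) ℂ) (v : Plane) :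
    planeForm A v = ∑ i, ∑ j, A i j * ((v i : ℂ) * v j) := by
  simp only [planeForm, quadForm, dotProduct, Matrix.mulVec, Finset.mul_sum]
  exact Finset.sum_congr rfl fun i _ => Finset.sum_congr rfl fun j _ => by ring

theorem contDiff_planeForm (A : Matrix (Fin 2) (Fin 2) ℂ) : ContDiff ℝ ∞ (planeForm A) := by
  have h : ∀ i : Fin 2, ContDiff ℝ ∞ fun v : Plane => (v i : ℂ) := fun i =>
    Complex.ofRealCLM.contDiff.comp (EuclideanSpace.proj (𝕜 := ℝ) i).contDiff
  have : planeForm A = fun v => ∑ i, ∑ j, A i j * ((v i : ℂ) * v j) :=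
    funext (planeForm_eq_sum A)
  rw [this]
  exact ContDiff.sum fun i _ => ContDiff.sum fun j _ => contDiff_const.mul ((h i).mul (h j))

theorem planeForm_smul (A : Matrix (Fin 2) (Fin 2) ℂ) (t : ℝ) (v : Plane) :
    planeForm A (t • v) = (t : ℂ) ^ 2 * planeForm A v := by
  simp only [planeForm_eq_sum, Finset.mul_sum, PiLp.smul_apply, smul_eq_mul, Complex.ofReal_mul]
  exact Finset.sum_congr rfl fun i _ => Finset.sum_congr rfl fun j _ => by ring

theorem planeForm_neg (A : Matrix (Fin 2) (Fin 2) ℂ) (v : Plane) :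
    planeForm A (-v) = planeForm A v := by
  simpa using planeForm_smul A (-1) v

theorem planeForm_re_pos {A : Matrix (Fin 2) (Fin 2) ℂ} (hA : (A.map Complex.re).PosDef)
    {v : Plane} (hv : v ≠ 0) : 0 < (planeForm A v).re := by
  have h := hA.dotProduct_mulVec_pos (x := fun i => v i) (fun h => hv (by
    ext i; exact congrFun h i))
  have e : (planeForm A v).re = star (fun i => v i) ⬝ᵥ (A.map Complex.re *ᵥ fun i => v i) := by
    simp only [planeForm, quadForm, dotProduct, Matrix.mulVec, Complex.re_sum,
      Pi.star_apply, star_trivial, Matrix.map_apply]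
    refine Finset.sum_congr rfl fun i _ => ?_
    rw [Complex.re_ofReal_mul, Complex.re_sum]
    congr 1
    refine Finset.sum_congr rfl fun j _ => ?_
    rw [Complex.re_mul_ofReal]
  rw [e]
  exact h

theorem planeForm_mem_slitPlane {A : Matrix (Fin 2) (Fin 2) ℂ} (hA : (A.map Complex.re).PosDef)
    {v : Plane} (hv : v ≠ 0) : planeForm A v ∈ Complex.slitPlane :=
  Or.inl (planeForm_re_pos hA hv)

theorem sq_mul_cpow {t : ℝ} (ht : 0 < t) {z : ℂ} (hz : z ≠ 0) (c : ℂ) :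
    ((t : ℂ) ^ 2 * z) ^ c = (t : ℂ) ^ (2 * c) * z ^ c := by
  have ht' : (t : ℂ) ≠ 0 := by exact_mod_cast ht.ne'
  have h1 : (t : ℂ) ^ 2 * z = ((t ^ 2 : ℝ) : ℂ) * z := by push_cast; rfl
  rw [Complex.cpow_def_of_ne_zero (by positivity), Complex.cpow_def_of_ne_zero ht',
    Complex.cpow_def_of_ne_zero hz, ← Complex.exp_add, h1,
    Complex.log_ofReal_mul (by positivity) hz, Real.log_pow, ← Complex.ofReal_log ht.le]
  push_cast
  ring_nf

/-- The homogeneous function `v ↦ Q_A(v)^{-s}`. -/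
def homog (A : Matrix (Fin 2) (Fin 2) ℂ) (s : ℂ) (v : Plane) : ℂ := planeForm A v ^ (-s)

variable {A : Matrix (Fin 2) (Fin 2) ℂ}

theorem homog_smul (hA : (A.map Complex.re).PosDef) (s : ℂ) {t : ℝ} (ht : 0 < t) (v : Plane) :
    homog A s (t • v) = (t : ℂ) ^ (-(2 * s)) * homog A s v := by
  rcases eq_or_ne v 0 with rfl | hv
  · rcases eq_or_ne s 0 with rfl | hs
    · simp [homog]
    · simp [homog, planeForm, quadForm, hs]
  · rw [homog, planeForm_smul, sq_mul_cpow ht (Complex.slitPlane_ne_zero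
      (planeForm_mem_slitPlane hA hv)), mul_neg, homog]

theorem differentiable_homog (hA : (A.map Complex.re).PosDef) {v : Plane} (hv : v ≠ 0) :
    Differentiable ℂ fun s => homog A s v := fun _ =>
  (differentiableAt_id.neg).const_cpow
    (Or.inl (Complex.slitPlane_ne_zero (planeForm_mem_slitPlane hA hv)))

/-- A smooth function supported in the annulus `1/4 ≤ ‖v‖ ≤ 1`. -/
structure IsAnnular (η : Plane → ℂ) : Prop where
  contDiff : ContDiff ℝ ∞ η
  eq_zero_of_one_le : ∀ v, 1 ≤ ‖v‖ → η v = 0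
  eq_zero_of_lt : ∀ v, ‖v‖ < 1 / 4 → η v = 0

theorem isAnnular_annulus : IsAnnular annulus :=
  ⟨contDiff_annulus, fun _ => annulus_eq_zero_of_one_le, fun _ hv => annulus_eq_zero_of_le hv.le⟩

variable {η : Plane → ℂ}

theorem contDiffAt_cpow_of_slitPlane {E : Type*} [NormedAddCommGroup E] [NormedSpace ℝ E]
    {f c : E → ℂ} {x : E} (hf : ContDiffAt ℝ ∞ f x) (hc : ContDiffAt ℝ ∞ c x)
    (hx : f x ∈ Complex.slitPlane) : ContDiffAt ℝ ∞ (fun y => f y ^ c y) x := by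
  have h1 : ContDiffAt ℝ ∞ (fun y => Complex.exp (Complex.log (f y) * c y)) x :=
    ((((Complex.contDiffAt_log hx).restrict_scalars ℝ).comp x hf).mul hc).cexp
  refine h1.congr_of_eventuallyEq ?_
  filter_upwards [hf.continuousAt.eventually_ne (Complex.slitPlane_ne_zero hx)] with y hy
  exact Complex.cpow_def_of_ne_zero hy _

/-- Smoothness jointly in `(s, v)` is what makes the derivative bounds uniform for `s` in a compact
set. -/
theorem contDiff_homog_mul (hA : (A.map Complex.re).PosDef) (hη : IsAnnular η) :
    ContDiff ℝ ∞ fun p : ℂ × Plane => homog A p.1 p.2 * η p.2 := by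
  refine contDiff_iff_contDiffAt.2 fun p => ?_
  by_cases hp : ‖p.2‖ < 1 / 4
  · refine (contDiffAt_const (c := (0 : ℂ))).congr_of_eventuallyEq ?_
    filter_upwards [(continuous_snd.norm.continuousAt (x := p)).eventually_lt continuousAt_const hp]
      with q hq
    rw [hη.eq_zero_of_lt _ hq, mul_zero]
  · have hp0 : p.2 ≠ 0 := fun h => hp (by rw [h, norm_zero]; norm_num)
    exact (contDiffAt_cpow_of_slitPlane ((contDiff_planeForm A).comp contDiff_snd).contDiffAt
      contDiff_fst.neg.contDiffAt (planeForm_mem_slitPlane hA hp0)).mul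
      (hη.contDiff.comp contDiff_snd).contDiffAt

theorem exists_norm_iteratedFDeriv_slice_le {E : Type*} [NormedAddCommGroup E] [NormedSpace ℝ E]
    {f : E × Plane → ℂ} (hf : ContDiff ℝ ∞ f) (hz : ∀ p v, 1 ≤ ‖v‖ → f (p, v) = 0) {K : Set E}
    (hK : IsCompact K) (m : ℕ) :
    ∃ C : ℝ, ∀ p ∈ K, ∀ v, ‖iteratedFDeriv ℝ m (fun v => f (p, v)) v‖ ≤ C := by
  obtain ⟨C, hC⟩ := (hK.prod (isCompact_closedBall (0 : Plane) 1)).exists_bound_of_continuousOn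
    (hf.continuous_iteratedFDeriv (m := m) (by exact_mod_cast le_top)).continuousOn
  refine ⟨C, fun p hp v => ?_⟩
  have hC0 : 0 ≤ C := (norm_nonneg _).trans (hC (p, 0) ⟨hp, by simp⟩)
  rcases lt_or_ge 1 ‖v‖ with hv | hv
  · rw [iteratedFDeriv_eq_zero_of_eq_zero (hz p) m hv, norm_zero]
    exact hC0
  · have := norm_iteratedFDeriv_comp_affine_le hf (p, 0) (ContinuousLinearMap.inr ℝ E Plane) m v
    simp only [ContinuousLinearMap.inr_apply, Prod.mk_add_mk, zero_add, add_zero] at this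
    exact (this.trans (mul_le_of_le_one_right (norm_nonneg _)
      (pow_le_one₀ (norm_nonneg _) (ContinuousLinearMap.norm_inr_le_one ℝ E Plane)))).trans
      (hC (p, v) ⟨hp, by simpa using hv⟩)

theorem exists_norm_ruleError_homog_le (hA : (A.map Complex.re).PosDef) (hη : IsAnnular η)
    {K : Set ℂ} (hK : IsCompact K) {N : ℕ} (hN : 2 ≤ N) :
    ∃ C : ℝ, 0 ≤ C ∧ ∀ s ∈ K, ∀ h : ℝ, 0 < h → h ≤ 1 →
      ‖ruleError h fun v => homog A s v * η v‖ ≤ C * h ^ N := by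
  have hf := contDiff_homog_mul hA hη
  have hz : ∀ (s : ℂ) (v : Plane), 1 ≤ ‖v‖ → homog A s v * η v = 0 := fun s v hv => by
    rw [hη.eq_zero_of_one_le v hv, mul_zero]
  obtain ⟨C₁, h1⟩ := exists_norm_iteratedFDeriv_slice_le hf hz hK N
  obtain ⟨C₂, h2⟩ := exists_norm_iteratedFDeriv_slice_le hf hz hK (N + 1)
  obtain ⟨B, hB, hP⟩ := exists_norm_ruleError_le_of_bound hN
  refine ⟨B * (|C₁| + |C₂|), by positivity, fun s hs h hh hh1 => ?_⟩
  exact hP _ _ (hf.comp (contDiff_const.prodMk contDiff_id)) (hz s)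
    (by simp [hη.eq_zero_of_lt 0 (by simp)])
    (fun v => (h1 s hs v).trans ((le_abs_self _).trans (le_add_of_nonneg_right (abs_nonneg _))))
    (fun v => (h2 s hs v).trans ((le_abs_self _).trans (le_add_of_nonneg_left (abs_nonneg _)))) h hh hh1

theorem finite_setOf_norm_gridPoint_lt {h : ℝ} (hh : 0 < h) (R : ℝ) :
    {j : PuncturedLattice | ‖gridPoint h j.1‖ < R}.Finite := by
  obtain ⟨M, hM⟩ := exists_nat_gt (R / h)
  have : {j : PuncturedLattice | ‖gridPoint h j.1‖ < R} ⊆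
      Subtype.val ⁻¹' (Set.Icc (fun _ => (-M : ℤ)) (fun _ => (M : ℤ)) : Set (Fin 2 → ℤ)) := by
    intro j hj
    have h1 : ∀ i, |j.1 i| ≤ (M : ℤ) := fun i => by
      have h2 := PiLp.norm_apply_le (gridPoint h j.1) i
      have h3 : ‖gridPoint h j.1 i‖ = |(j.1 i : ℝ)| * h := by simp [gridPoint, abs_of_pos hh]
      rw [h3] at h2
      have h4 : |(j.1 i : ℝ)| < M := ((lt_div_iff₀ hh).2 (h2.trans_lt hj)).trans hM
      exact_mod_cast h4.le
    exact ⟨fun i => (abs_le.1 (h1 i)).1, fun i => (abs_le.1 (h1 i)).2⟩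
  exact ((Set.finite_Icc _ _).preimage Subtype.val_injective.injOn).subset this

theorem puncturedSum_eq_sum {F : Plane → ℂ} (hz : ∀ v, 1 ≤ ‖v‖ → F v = 0) {h : ℝ} (hh : 0 < h) :
    puncturedSum h F =
      ∑ j ∈ (finite_setOf_norm_gridPoint_lt hh 1).toFinset, F (gridPoint h j.1) * (h : ℂ) ^ 2 :=
  tsum_eq_sum fun j hj => by
    rw [hz _ (by simpa using hj), zero_mul]

theorem gridPoint_ne_zero {h : ℝ} (hh : 0 < h) (j : PuncturedLattice) : gridPoint h j.1 ≠ 0 :=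
  norm_pos_iff.1 (hh.trans_le (le_norm_gridPoint hh j.2))

theorem differentiable_puncturedSum_homog (hA : (A.map Complex.re).PosDef)
    (hz : ∀ v, 1 ≤ ‖v‖ → η v = 0) {h : ℝ} (hh : 0 < h) :
    Differentiable ℂ fun s => puncturedSum h fun v => homog A s v * η v := by
  have : ∀ s, (puncturedSum h fun v => homog A s v * η v) = _ := fun s =>
    puncturedSum_eq_sum (fun v hv => by rw [hz v hv, mul_zero]) hh
  simp_rw [this]
  exact Differentiable.fun_sum fun j _ =>
    ((differentiable_homog hA (gridPoint_ne_zero hh j)).mul_const _).mul_const _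

/-- The Riemann sums at steps `1/(n+1)` are finite sums of entire functions of `s`, and the error
bound makes them converge locally uniformly; no differentiation under the integral is needed. -/
theorem differentiable_integral_homog (hA : (A.map Complex.re).PosDef) (hη : IsAnnular η) :
    Differentiable ℂ fun s => ∫ v, homog A s v * η v := by
  rw [← differentiableOn_univ]
  refine TendstoLocallyUniformlyOn.differentiableOn (φ := atTop)
    (F := fun (n : ℕ) s => puncturedSum (1 / ((n : ℝ) + 1)) fun v => homog A s v * η v)
    ?_ (Eventually.of_forall fun n => (differentiable_puncturedSum_homog hA hη.eq_zero_of_one_le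
      (by positivity)).differentiableOn) isOpen_univ
  refine (tendstoLocallyUniformlyOn_iff_forall_isCompact isOpen_univ).2 fun K _ hK => ?_
  obtain ⟨C, hC0, hC⟩ := exists_norm_ruleError_homog_le hA hη hK le_rfl
  have hlim : Tendsto (fun n : ℕ => C * (1 / ((n : ℝ) + 1)) ^ 2) atTop (𝓝 0) := by
    simpa using (tendsto_one_div_add_atTop_nhds_zero_nat (𝕜 := ℝ)).pow 2 |>.const_mul C
  refine Metric.tendstoUniformlyOn_iff.2 fun ε hε => ?_
  filter_upwards [hlim.eventually_lt_const hε] with n hn s hs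
  rw [dist_eq_norm]
  refine (hC s hs (1 / ((n : ℝ) + 1)) (by positivity) ?_).trans_lt hn
  exact (div_le_one (by positivity)).2 (by linarith [Nat.cast_nonneg (α := ℝ) n])

theorem differentiable_ruleError_homog (hA : (A.map Complex.re).PosDef) (hη : IsAnnular η)
    {h : ℝ} (hh : 0 < h) : Differentiable ℂ fun s => ruleError h fun v => homog A s v * η v :=
  (differentiable_integral_homog hA hη).sub
    (differentiable_puncturedSum_homog hA hη.eq_zero_of_one_le hh)

/-! ### Euler's identity and the integral over an annulus -/

/-- The radial derivative of the cutoff. -/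
def radialCutoff (v : Plane) : ℂ := fderiv ℝ cutoff v v

theorem isAnnular_radialCutoff : IsAnnular radialCutoff := by
  refine ⟨(contDiff_cutoff.fderiv_right (m := ∞) (by simp)).clm_apply contDiff_id,
    fun v hv => ?_, fun v hv => ?_⟩
  · have : cutoff =ᶠ[𝓝 v] fun _ => 0 := by
      filter_upwards [continuous_norm.continuousAt.eventually_const_lt
        (show (1 / 2 : ℝ) < ‖v‖ by linarith)] with w hw
      exact cutoff_eq_zero hw.le
    simp [radialCutoff, this.fderiv_eq]
  · have : cutoff =ᶠ[𝓝 v] fun _ => 1 := by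
      filter_upwards [continuous_norm.continuousAt.eventually_lt_const hv] with w hw
      exact cutoff_eq_one hw.le
    simp [radialCutoff, this.fderiv_eq]

theorem fderiv_annulus_self (v : Plane) :
    fderiv ℝ annulus v v = radialCutoff ((1 / 2 : ℝ) • v) - radialCutoff v := by
  have hc := contDiff_cutoff.differentiable (by simp)
  have h1 : HasFDerivAt (fun v => cutoff ((1 / 2 : ℝ) • v))
      ((fderiv ℝ cutoff ((1 / 2 : ℝ) • v)).comp ((1 / 2 : ℝ) • ContinuousLinearMap.id ℝ Plane)) v :=
    (hc _).hasFDerivAt.comp v ((1 / 2 : ℝ) • ContinuousLinearMap.id ℝ Plane).hasFDerivAt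
  have h2 : HasFDerivAt annulus _ v := h1.sub (hc v).hasFDerivAt
  rw [h2.fderiv]
  simp [radialCutoff]

/-- The integrand is the divergence of the field `v ↦ P(v) v` in dimension two; integrate by parts
in each coordinate. -/
theorem integral_euler_eq_zero {P : Plane → ℂ} (hP : ContDiff ℝ ∞ P) (hc : HasCompactSupport P) :
    ∫ v, (2 * P v + fderiv ℝ P v v) = 0 := by
  have hP' : Continuous (fderiv ℝ P) := hP.continuous_fderiv (by simp)
  have hx : ∀ i : Fin 2, Continuous fun v : Plane => (v i : ℂ) := fun i =>
    Complex.continuous_ofReal.comp (EuclideanSpace.proj (𝕜 := ℝ) i).continuous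
  set L : Fin 2 → Plane →L[ℝ] ℂ := fun i => Complex.ofRealCLM.comp (EuclideanSpace.proj (𝕜 := ℝ) i)
  have hi1 : ∀ i : Fin 2, Integrable fun v : Plane => (v i : ℂ) *
      fderiv ℝ P v (EuclideanSpace.single i 1) := fun i =>
    ((hx i).mul (hP'.clm_apply continuous_const)).integrable_of_hasCompactSupport
      ((hc.fderiv_apply ℝ _).mul_left)
  have hPi : Integrable P := hP.continuous.integrable_of_hasCompactSupport hc
  have key : ∀ i : Fin 2, ∫ v : Plane, (v i : ℂ) * fderiv ℝ P v (EuclideanSpace.single i 1) =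
      -∫ v, P v := by
    intro i
    have hL : ∀ v, fderiv ℝ (fun v : Plane => (v i : ℂ)) v = L i := fun v => (L i).fderiv
    have := integral_mul_fderiv_eq_neg_fderiv_mul_of_integrable (μ := (volume : Measure Plane))
      (f := fun v : Plane => (v i : ℂ)) (g := P) (v := EuclideanSpace.single i 1) ?_ (hi1 i) ?_
      (fun v _ => (L i).differentiableAt) (fun v _ => hP.differentiable (by simp) v)
    · simpa [hL, L] using this
    · simpa [hL, L] using hPi
    · exact ((hx i).mul hP.continuous).integrable_of_hasCompactSupport hc.mul_left
  have hdec : ∀ v, fderiv ℝ P v v = ∑ i : Fin 2, (v i : ℂ) *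
      fderiv ℝ P v (EuclideanSpace.single i 1) := by
    intro v
    have hv : v = ∑ i : Fin 2, v i • EuclideanSpace.single i (1 : ℝ) := by
      ext i
      fin_cases i <;> simp [Fin.sum_univ_two]
    calc fderiv ℝ P v v = fderiv ℝ P v (∑ i : Fin 2, v i • EuclideanSpace.single i (1 : ℝ)) :=
          congrArg _ hv
      _ = _ := by simp
  have hsum : ∫ v, ∑ i : Fin 2, ((v i : ℂ) * fderiv ℝ P v (EuclideanSpace.single i 1)) =
      -(2 * ∫ v, P v) := by
    rw [integral_finsetSum _ fun i _ => hi1 i]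
    simp_rw [key]
    simp [two_mul]
  simp_rw [hdec]
  rw [integral_add (hPi.const_mul 2) (integrable_finsetSum _ fun i _ => hi1 i), hsum,
    integral_const_mul]
  ring

variable {A : Matrix (Fin 2) (Fin 2) ℂ} {η : Plane → ℂ}

theorem contDiff_homog_mul_slice (hA : (A.map Complex.re).PosDef) (hη : IsAnnular η) (s : ℂ) :
    ContDiff ℝ ∞ fun v => homog A s v * η v :=
  ContDiff.comp (g := fun p : ℂ × Plane => homog A p.1 p.2 * η p.2) (f := fun v : Plane => (s, v))
    (contDiff_homog_mul hA hη) (contDiff_const.prodMk contDiff_id)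

theorem hasCompactSupport_homog_mul (hη : IsAnnular η) (s : ℂ) :
    HasCompactSupport fun v => homog A s v * η v :=
  hasCompactSupport_of_eq_zero fun v hv => by rw [hη.eq_zero_of_one_le v hv, mul_zero]

theorem integrable_homog_mul (hA : (A.map Complex.re).PosDef) (hη : IsAnnular η) (s : ℂ) :
    Integrable fun v => homog A s v * η v :=
  (contDiff_homog_mul_slice hA hη s).continuous.integrable_of_hasCompactSupport
    (hasCompactSupport_homog_mul hη s)

/-- Euler's identity: the function of `t` obtained by restricting to the ray `tv` is differentiated
at `t = 1` by the chain rule and by homogeneity, and the two results agree. -/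
theorem fderiv_homog_mul_annulus_self (hA : (A.map Complex.re).PosDef) (s : ℂ) (v : Plane) :
    fderiv ℝ (fun v => homog A s v * annulus v) v v = -(2 * s) * (homog A s v * annulus v) +
      (homog A s v * radialCutoff ((1 / 2 : ℝ) • v) - homog A s v * radialCutoff v) := by
  have h1 : HasDerivAt (fun t : ℝ => t • v) v 1 := by
    simpa using (hasDerivAt_id (1 : ℝ)).smul_const v
  have hP := ((contDiff_homog_mul_slice hA isAnnular_annulus s).differentiable (by simp)
    ((1 : ℝ) • v)).hasFDerivAt.comp_hasDerivAt 1 h1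
  have hann := (contDiff_annulus.differentiable (by simp)
    ((1 : ℝ) • v)).hasFDerivAt.comp_hasDerivAt 1 h1
  rw [one_smul] at hP hann
  have hcp : HasDerivAt (fun t : ℝ => (t : ℂ) ^ (-(2 * s))) (-(2 * s)) 1 := by
    have := ((hasDerivAt_id (1 : ℂ)).cpow_const (c := -(2 * s)) (by simp)).comp_ofReal (z := 1)
    simpa using this
  have h2 := (hcp.mul_const (homog A s v)).mul hann
  have h3 : (fun t : ℝ => (t : ℂ) ^ (-(2 * s)) * homog A s v) * (annulus ∘ fun t : ℝ => t • v) =ᶠ[𝓝 1]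
      (fun v => homog A s v * annulus v) ∘ fun t : ℝ => t • v := by
    filter_upwards [lt_mem_nhds one_pos] with t ht
    simp [homog_smul hA s ht]
  have h4 := (h2.congr_of_eventuallyEq h3.symm).unique hP
  rw [← h4, fderiv_annulus_self]
  simp
  ring

/-- Summing `2^{k(2-2s)}` times the annulus integral gives a quotient by `1 - 2^{2-2s}`, which has
infinitely many zeros. This identity replaces the quotient by one with denominator `2 - 2s`, leaving
`s = 1` as the only possible pole. -/
theorem integral_homog_mul_annulus (hA : (A.map Complex.re).PosDef) (s : ℂ) :
    (2 - 2 * s) * ∫ v, homog A s v * annulus v =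
      (1 - (2 : ℂ) ^ (2 - 2 * s)) * ∫ v, homog A s v * radialCutoff v := by
  have hP := integral_euler_eq_zero (contDiff_homog_mul_slice hA isAnnular_annulus s)
    (hasCompactSupport_homog_mul isAnnular_annulus s)
  simp_rw [fderiv_homog_mul_annulus_self hA s] at hP
  have hscale : ∀ v, homog A s v * radialCutoff ((1 / 2 : ℝ) • v) = (2 : ℂ) ^ (-(2 * s)) *
      (homog A s ((1 / 2 : ℝ) • v) * radialCutoff ((1 / 2 : ℝ) • v)) := by
    intro v
    have := homog_smul hA s two_pos ((1 / 2 : ℝ) • v)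
    rw [smul_smul, mul_one_div_cancel two_ne_zero, one_smul] at this
    rw [this]
    push_cast
    ring
  have hJ := integrable_homog_mul hA isAnnular_radialCutoff s
  have hc := integrable_homog_mul hA isAnnular_annulus s
  have hJ2 : Integrable fun v => homog A s v * radialCutoff ((1 / 2 : ℝ) • v) := by
    simp_rw [hscale]
    exact (hJ.comp_smul (by norm_num : (1 / 2 : ℝ) ≠ 0)).const_mul _
  have hJ2' : ∫ v, homog A s v * radialCutoff ((1 / 2 : ℝ) • v) =
      (2 : ℂ) ^ (2 - 2 * s) * ∫ v, homog A s v * radialCutoff v := by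
    simp_rw [hscale]
    rw [integral_const_mul, Measure.integral_comp_smul volume
      (fun v => homog A s v * radialCutoff v), sub_eq_add_neg 2, Complex.cpow_add _ _ two_ne_zero]
    simp
    ring
  have hJJ : Integrable fun v => homog A s v * radialCutoff ((1 / 2 : ℝ) • v) -
    homog A s v * radialCutoff v := hJ2.sub hJ
  have hcJ : Integrable fun v => -(2 * s) * (homog A s v * annulus v) +
      (homog A s v * radialCutoff ((1 / 2 : ℝ) • v) - homog A s v * radialCutoff v) :=
    (hc.const_mul _).add hJJ
  rw [integral_add (hc.const_mul 2) hcJ, integral_add (hc.const_mul _) hJJ, integral_sub hJ2 hJ, integral_const_mul,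
    integral_const_mul, hJ2'] at hP
  linear_combination hP

/-! ### Analytic continuation of the Epstein zeta function -/

/-- The terms of the series for the regular part of the Epstein zeta function. -/
def zetaTerm (A : Matrix (Fin 2) (Fin 2) ℂ) (h : ℝ) (s : ℂ) (k : ℕ) : ℂ :=
  (((2 : ℝ) ^ k : ℝ) : ℂ) ^ (2 - 2 * s) *
    ruleError (h / (2 : ℝ) ^ k) fun v => homog A s v * annulus v

/-- The analytic continuation of `h^{2-2s} ∑' Q_A(j)^{-s}`. -/
def scaledZeta (A : Matrix (Fin 2) (Fin 2) ℂ) (h : ℝ) (s : ℂ) : ℂ :=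
  puncturedSum h (fun v => homog A s v * cutoff v) +
    (∫ v, homog A s v * radialCutoff v) / (2 - 2 * s) - ∑' k, zetaTerm A h s k

/-- The rule on the unit annulus at step `h/2^k` has error `O((h/2^k)^N)` for any `N`. Once `N - 1`
exceeds the real part of `2 - 2s` on the disc, this beats the growth `2^{k(2-2s)}` by a factor
`2^{-k}`, and it supplies any prescribed power of `h`. -/
theorem exists_norm_zetaTerm_le (hA : (A.map Complex.re).PosDef) (R : ℝ) (M : ℕ) :
    ∃ N ≥ M, ∃ C : ℝ, 0 ≤ C ∧ ∀ s : ℂ, ‖s‖ ≤ R → ∀ h : ℝ, 0 < h → h ≤ 1 → ∀ k,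
      ‖zetaTerm A h s k‖ ≤ C * h ^ N * (1 / 2) ^ k := by
  obtain ⟨N₀, hN₀⟩ := exists_nat_gt (2 + 2 * R)
  -- `N₀ + 1` rather than `N₀`: one power of `2^k` is kept for the geometric factor.
  set N := max M (max 2 (N₀ + 1))
  obtain ⟨C, hC0, hC⟩ := exists_norm_ruleError_homog_le hA isAnnular_annulus
    (isCompact_closedBall (0 : ℂ) R) (N := N) (by simp [N])
  refine ⟨N, le_max_left _ _, C, hC0, fun s hs h hh h1 k => ?_⟩
  have h2k : (1 : ℝ) ≤ (2 : ℝ) ^ k := one_le_pow₀ one_le_two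
  have hb := hC s (by simpa using hs) (h / (2 : ℝ) ^ k) (by positivity)
    ((div_le_one (by positivity)).2 (h1.trans h2k))
  have hre : (2 - 2 * s).re ≤ ((N - 1 : ℕ) : ℝ) := by
    have h3 : (N₀ : ℝ) ≤ ((N - 1 : ℕ) : ℝ) := by
      have : N₀ ≤ N - 1 := by
        have : N₀ + 1 ≤ N := (le_max_right _ _).trans (le_max_right _ _)
        omega
      exact_mod_cast this
    have h4 := (abs_le.1 ((Complex.abs_re_le_norm s).trans hs)).1
    simp only [Complex.sub_re, Complex.mul_re, Complex.re_ofNat, Complex.im_ofNat, zero_mul,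
      sub_zero]
    linarith
  have hN1 : N - 1 + 1 = N := by
    have : 2 ≤ N := (le_max_left _ _).trans (le_max_right _ _)
    omega
  rw [zetaTerm, norm_mul, Complex.norm_cpow_eq_rpow_re_of_pos (by positivity)]
  calc _ ≤ ((2 : ℝ) ^ k) ^ (N - 1) * (C * (h / (2 : ℝ) ^ k) ^ N) := by
        refine mul_le_mul ?_ hb (norm_nonneg _) (by positivity)
        rw [← Real.rpow_natCast _ (N - 1)]
        exact Real.rpow_le_rpow_of_exponent_le h2k hre
    _ = C * h ^ N * (1 / 2) ^ k := by
        obtain ⟨n, hn⟩ : ∃ n, N = n + 1 := ⟨N - 1, hN1.symm⟩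
        rw [hn, Nat.add_sub_cancel, div_pow, div_pow, one_pow, pow_succ ((2 : ℝ) ^ k) n]
        field_simp

theorem summable_zetaTerm (hA : (A.map Complex.re).PosDef) (s : ℂ) {h : ℝ} (hh : 0 < h)
    (h1 : h ≤ 1) : Summable (zetaTerm A h s) := by
  obtain ⟨N, -, C, -, hC⟩ := exists_norm_zetaTerm_le hA ‖s‖ 0
  exact Summable.of_norm_bounded ((summable_geometric_two).mul_left (C * h ^ N))
    fun k => hC s le_rfl h hh h1 k

theorem differentiable_tsum_zetaTerm (hA : (A.map Complex.re).PosDef) {h : ℝ} (hh : 0 < h)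
    (h1 : h ≤ 1) : Differentiable ℂ fun s => ∑' k, zetaTerm A h s k := by
  intro s
  obtain ⟨N, -, C, -, hC⟩ := exists_norm_zetaTerm_le hA (‖s‖ + 1) 0
  have hs : s ∈ Metric.ball (0 : ℂ) (‖s‖ + 1) := by simp
  refine (Complex.differentiableOn_tsum_of_summable_norm
    (u := fun k => C * h ^ N * (1 / 2) ^ k) ((summable_geometric_two).mul_left (C * h ^ N))
    (fun k => ?_) Metric.isOpen_ball fun k w hw => ?_).differentiableAt
    (Metric.isOpen_ball.mem_nhds hs)
  · refine Differentiable.differentiableOn ?_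
    refine Differentiable.mul ?_ (differentiable_ruleError_homog hA isAnnular_annulus (by positivity))
    exact fun w => ((differentiableAt_const _).sub (differentiableAt_id.const_mul _)).const_cpow
      (Or.inl (Complex.ofReal_ne_zero.2 (by positivity)))
  · exact hC w (by simpa using (Metric.mem_ball.1 hw).le) h hh h1 k

theorem analyticOnNhd_scaledZeta (hA : (A.map Complex.re).PosDef) {h : ℝ} (hh : 0 < h)
    (h1 : h ≤ 1) : AnalyticOnNhd ℂ (scaledZeta A h) {1}ᶜ := by
  refine DifferentiableOn.analyticOnNhd (fun s hs => ?_) isOpen_compl_singleton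
  refine (((differentiable_puncturedSum_homog hA (fun v hv => cutoff_eq_zero (by linarith)) hh s).add
    ((differentiable_integral_homog hA isAnnular_radialCutoff s).div (by fun_prop) ?_)).sub
    (differentiable_tsum_zetaTerm hA hh h1 s)).differentiableWithinAt
  intro h0
  exact hs (by simp only [Set.mem_singleton_iff]; linear_combination -h0 / 2)

variable {A : Matrix (Fin 2) (Fin 2) ℂ}

theorem continuousAt_homog (hA : (A.map Complex.re).PosDef) (s : ℂ) {v : Plane} (hv : v ≠ 0) :
    ContinuousAt (homog A s) v :=
  ((contDiff_planeForm A).continuous.continuousAt).cpow continuousAt_const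
    (planeForm_mem_slitPlane hA hv)

theorem exists_norm_homog_le (hA : (A.map Complex.re).PosDef) (s : ℂ) :
    ∃ C : ℝ, 0 ≤ C ∧ ∀ v ≠ 0, ‖homog A s v‖ ≤ C * ‖v‖ ^ (-(2 * s.re)) := by
  obtain ⟨C, hC⟩ := (isCompact_sphere (0 : Plane) 1).exists_bound_of_continuousOn
    (f := homog A s) fun v hv => (continuousAt_homog hA s fun h => by
      simp [h] at hv).continuousWithinAt
  refine ⟨|C|, abs_nonneg _, fun v hv => ?_⟩
  have hv' : 0 < ‖v‖ := norm_pos_iff.2 hv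
  have h1 := homog_smul hA s hv' (‖v‖⁻¹ • v)
  rw [smul_smul, mul_inv_cancel₀ hv'.ne', one_smul] at h1
  rw [h1, norm_mul, Complex.norm_cpow_eq_rpow_re_of_pos hv', mul_comm]
  have h2 : ‖homog A s (‖v‖⁻¹ • v)‖ ≤ |C| := (hC _ (by
    simp [norm_smul, hv'.ne'])).trans (le_abs_self _)
  have h3 : (-(2 * s)).re = -(2 * s.re) := by simp
  rw [h3]
  gcongr

theorem summable_homog_gridPoint (hA : (A.map Complex.re).PosDef) {s : ℂ} (hs : 1 < s.re) {h : ℝ}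
    (hh : 0 < h) : Summable fun j : PuncturedLattice => ‖homog A s (gridPoint h j.1)‖ := by
  obtain ⟨C, hC0, hC⟩ := exists_norm_homog_le hA s
  have hsum := (EisensteinSeries.summable_one_div_norm_rpow (k := 2 * s.re) (by linarith)).subtype
    {j : Fin 2 → ℤ | j ≠ 0}
  refine Summable.of_nonneg_of_le (fun _ => norm_nonneg _) (fun j => ?_)
    (hsum.mul_left (C * h ^ (-(2 * s.re))))
  refine (hC _ (gridPoint_ne_zero hh j)).trans ?_
  rw [mul_assoc]
  have hj : 0 < ‖j.1‖ := norm_pos_iff.2 j.2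
  have hle : h * ‖j.1‖ ≤ ‖gridPoint h j.1‖ := by
    have h1 : ‖j.1‖ ≤ ‖gridPoint h j.1‖ / h := (pi_norm_le_iff_of_nonneg (by positivity)).2 fun i => by
      have h2 := PiLp.norm_apply_le (gridPoint h j.1) i
      have h3 : ‖gridPoint h j.1 i‖ = ‖j.1 i‖ * h := by
        simp [gridPoint, abs_of_pos hh, Int.norm_eq_abs]
      rw [h3] at h2
      exact (le_div_iff₀ hh).2 h2
    rw [le_div_iff₀ hh] at h1
    linarith
  change C * _ ≤ C * (_ * ‖j.1‖ ^ (-(2 * s.re)))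
  rw [← Real.mul_rpow hh.le hj.le]
  gcongr C * ?_
  exact Real.rpow_le_rpow_of_nonpos (by positivity) hle (by linarith)

theorem puncturedSum_homog_mul_annulus (hA : (A.map Complex.re).PosDef) (s : ℂ) (h : ℝ) (k : ℕ) :
    puncturedSum h (fun v => homog A s v * annulus (((2 : ℝ) ^ k)⁻¹ • v)) =
      (((2 : ℝ) ^ k : ℝ) : ℂ) ^ (2 - 2 * s) * (∫ v, homog A s v * annulus v) - zetaTerm A h s k := by
  set a : ℝ := (2 : ℝ) ^ k
  have ha : 0 < a := by positivity
  have ha' : (a : ℂ) ≠ 0 := by exact_mod_cast ha.ne'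
  have h1 : puncturedSum (h / a) (fun v => homog A s v * annulus v) =
      (∫ v, homog A s v * annulus v) - ruleError (h / a) fun v => homog A s v * annulus v := by
    rw [ruleError, sub_sub_cancel]
  rw [zetaTerm, ← mul_sub, ← h1, puncturedSum, puncturedSum, ← tsum_mul_left]
  refine tsum_congr fun j => ?_
  have h2 : gridPoint (h / a) j.1 = a⁻¹ • gridPoint h j.1 := by
    rw [← gridPoint_mul, inv_mul_eq_div]
  have h3 : gridPoint h j.1 = a • gridPoint (h / a) j.1 := by
    rw [h2, smul_smul, mul_inv_cancel₀ ha.ne', one_smul]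
  beta_reduce
  rw [← h2, h3, homog_smul hA s ha, sub_eq_add_neg 2, Complex.cpow_add _ _ ha']
  push_cast
  rw [Complex.cpow_ofNat]
  field_simp

theorem mul_cutoff_eq_add_sum (s : ℂ) (n : ℕ) (v : Plane) :
    homog A s v * cutoff (((2 : ℝ) ^ n)⁻¹ • v) = homog A s v * cutoff v +
      ∑ k ∈ Finset.range n, homog A s v * annulus (((2 : ℝ) ^ k)⁻¹ • v) := by
  have : ∀ k, annulus (((2 : ℝ) ^ k)⁻¹ • v) =
      cutoff (((2 : ℝ) ^ (k + 1))⁻¹ • v) - cutoff (((2 : ℝ) ^ k)⁻¹ • v) := by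
    intro k
    rw [annulus, smul_smul, pow_succ, mul_inv, mul_comm, one_div]
  rw [← Finset.mul_sum, ← mul_add]
  simp_rw [this]
  rw [Finset.sum_range_sub fun k => cutoff (((2 : ℝ) ^ k)⁻¹ • v)]
  simp

theorem summable_of_eq_zero {F : Plane → ℂ} {R : ℝ} (hz : ∀ v, R ≤ ‖v‖ → F v = 0) {h : ℝ}
    (hh : 0 < h) : Summable fun j : PuncturedLattice => F (gridPoint h j.1) * (h : ℂ) ^ 2 :=
  summable_of_ne_finset_zero (s := (finite_setOf_norm_gridPoint_lt hh R).toFinset) fun j hj => by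
    rw [hz _ (by simpa using hj), zero_mul]

theorem puncturedSum_homog_mul_cutoff (hA : (A.map Complex.re).PosDef) (s : ℂ) {h : ℝ} (hh : 0 < h)
    (n : ℕ) :
    puncturedSum h (fun v => homog A s v * cutoff (((2 : ℝ) ^ n)⁻¹ • v)) =
      puncturedSum h (fun v => homog A s v * cutoff v) + ∑ k ∈ Finset.range n,
        ((((2 : ℝ) ^ k : ℝ) : ℂ) ^ (2 - 2 * s) * (∫ v, homog A s v * annulus v) -
          zetaTerm A h s k) := by
  simp_rw [← puncturedSum_homog_mul_annulus hA, mul_cutoff_eq_add_sum]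
  have h1 : Summable fun j : PuncturedLattice =>
      homog A s (gridPoint h j.1) * cutoff (gridPoint h j.1) * (h : ℂ) ^ 2 :=
    summable_of_eq_zero (F := fun v => homog A s v * cutoff v) (R := 1 / 2)
      (fun v hv => by rw [cutoff_eq_zero hv, mul_zero]) hh
  have h2 : ∀ k ∈ Finset.range n, Summable fun j : PuncturedLattice => homog A s (gridPoint h j.1) *
      annulus (((2 : ℝ) ^ k)⁻¹ • gridPoint h j.1) * (h : ℂ) ^ 2 := fun k _ =>
    summable_of_eq_zero (F := fun v => homog A s v * annulus (((2 : ℝ) ^ k)⁻¹ • v)) (R := (2 : ℝ) ^ k)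
      (fun v hv => by
        rw [annulus_eq_zero_of_one_le, mul_zero]
        rw [norm_smul, Real.norm_of_nonneg (by positivity), inv_mul_eq_div]
        exact (one_le_div (by positivity)).2 hv) hh
  simp_rw [puncturedSum, add_mul, Finset.sum_mul]
  rw [h1.tsum_add (summable_sum h2), Summable.tsum_finsetSum h2]

/-- The sum is the limit of its truncations at radius about `2^n`. Each added annulus contributes a
term of a geometric series, of ratio `2^{2-2s}` with modulus below `1`, minus a term `zetaTerm`. -/
theorem puncturedSum_homog (hA : (A.map Complex.re).PosDef) {s : ℂ} (hs : 1 < s.re) {h : ℝ}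
    (hh : 0 < h) (h1 : h ≤ 1) : puncturedSum h (homog A s) = scaledZeta A h s := by
  set q : ℂ := (2 : ℂ) ^ (2 - 2 * s) with hq
  set c := ∫ v, homog A s v * annulus v with hc
  have hq1 : ‖q‖ < 1 := by
    have := Complex.norm_cpow_eq_rpow_re_of_pos (x := 2) two_pos (2 - 2 * s)
    push_cast at this
    rw [hq, this]
    refine Real.rpow_lt_one_of_one_lt_of_neg one_lt_two ?_
    simp; linarith
  have hqk : ∀ k : ℕ, (((2 : ℝ) ^ k : ℝ) : ℂ) ^ (2 - 2 * s) = q ^ k := by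
    intro k
    rw [hq, Complex.cpow_def_of_ne_zero (by simp), Complex.cpow_def_of_ne_zero two_ne_zero,
      ← Complex.exp_nat_mul, ← Complex.ofReal_log (by positivity), Real.log_pow]
    push_cast
    rw [mul_assoc, Complex.ofReal_log zero_le_two, Complex.ofReal_ofNat]
  have hgeo : HasSum (fun k : ℕ => (((2 : ℝ) ^ k : ℝ) : ℂ) ^ (2 - 2 * s) * c)
      ((∫ v, homog A s v * radialCutoff v) / (2 - 2 * s)) := by
    have hne : 1 - q ≠ 0 := fun h => by
      rw [← sub_eq_zero.1 h, norm_one] at hq1; exact lt_irrefl _ hq1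
    have hne2 : 2 - 2 * s ≠ 0 := fun h => by
      have := congrArg Complex.re h
      simp at this; linarith
    have hcJ := integral_homog_mul_annulus hA s
    have h2 := (hasSum_geometric_of_norm_lt_one hq1).mul_right c
    simp_rw [hqk]
    convert! h2 using 1
    rw [div_eq_iff hne2, inv_mul_eq_div, div_mul_eq_mul_div, eq_div_iff hne]
    linear_combination -hcJ
  have hlim := ((hgeo.sub (summable_zetaTerm hA s hh h1).hasSum).tendsto_sum_nat).const_add
    (puncturedSum h fun v => homog A s v * cutoff v)
  simp_rw [hc, ← puncturedSum_homog_mul_cutoff hA s hh] at hlim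
  rw [← add_sub_assoc] at hlim
  refine tendsto_nhds_unique ?_ hlim
  refine tendsto_tsum_of_dominated_convergence
    (bound := fun j : PuncturedLattice => ‖homog A s (gridPoint h j.1)‖ * h ^ 2)
    ((summable_homog_gridPoint hA hs hh).mul_right _) (fun j => ?_)
    (Eventually.of_forall fun n j => ?_)
  · have h2 : Tendsto (fun n : ℕ => ((2 : ℝ) ^ n)⁻¹ • gridPoint h j.1) atTop (𝓝 0) := by
      have := (tendsto_inv_atTop_zero.comp
        (tendsto_pow_atTop_atTop_of_one_lt (one_lt_two : (1 : ℝ) < 2))).smul_const (gridPoint h j.1)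
      simpa using this
    have h3 := (contDiff_cutoff.continuous.tendsto 0).comp h2
    rw [cutoff_eq_one (by simp)] at h3
    simpa using (h3.const_mul (homog A s (gridPoint h j.1))).mul_const ((h : ℂ) ^ 2)
  · rw [norm_mul, norm_mul, norm_pow, Complex.norm_real, Real.norm_of_nonneg hh.le]
    gcongr
    exact mul_le_of_le_one_right (norm_nonneg _) (norm_cutoff_le_one _)

theorem homog_gridPoint (hA : (A.map Complex.re).PosDef) (s : ℂ) {h : ℝ} (hh : 0 < h)
    (j : Fin 2 → ℤ) :
    homog A s (gridPoint h j) = (h : ℂ) ^ (-(2 * s)) * quadForm A (fun i => (j i : ℂ)) ^ (-s) := by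
  have h1 : gridPoint h j = h • gridPoint 1 j := by rw [← gridPoint_mul, mul_one]
  rw [h1, homog_smul hA s hh]
  simp [homog, planeForm, gridPoint]

theorem isEpsteinZeta_scaledZeta (hA : (A.map Complex.re).PosDef) :
    IsEpsteinZeta A (scaledZeta A 1) := by
  refine ⟨analyticOnNhd_scaledZeta hA one_pos le_rfl, fun s hs => ?_⟩
  have h1 := (summable_homog_gridPoint hA hs one_pos).of_norm.hasSum
  rw [← puncturedSum_homog hA hs one_pos le_rfl, puncturedSum]
  simp only [homog_gridPoint hA s one_pos] at h1 ⊢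
  simpa using h1

theorem isEpsteinZeta_epsteinZeta (hA : (A.map Complex.re).PosDef) :
    IsEpsteinZeta A (epsteinZeta A) := by
  have h : ∃ Z : ℂ → ℂ, IsEpsteinZeta A Z := ⟨_, isEpsteinZeta_scaledZeta hA⟩
  have : epsteinZeta A = h.choose := funext fun s => by rw [epsteinZeta, dif_pos h]
  rw [this]
  exact h.choose_spec

/-- Both sides are analytic on the connected set `ℂ ∖ {1}` and equal the lattice sum for `Re s > 1`.
This is how the function picked by choice in `epsteinZeta` gets identified. -/
theorem scaledZeta_eq (hA : (A.map Complex.re).PosDef) {h : ℝ} (hh : 0 < h) (h1 : h ≤ 1) {s : ℂ}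
    (hs : s ≠ 1) : scaledZeta A h s = (h : ℂ) ^ (2 - 2 * s) * epsteinZeta A s := by
  have hZ := isEpsteinZeta_epsteinZeta hA
  have hh' : (h : ℂ) ≠ 0 := by exact_mod_cast hh.ne'
  have hpow : Differentiable ℂ fun s : ℂ => (h : ℂ) ^ (2 - 2 * s) := fun w =>
    ((differentiableAt_const _).sub (differentiableAt_id.const_mul _)).const_cpow (Or.inl hh')
  refine AnalyticOnNhd.eqOn_of_preconnected_of_eventuallyEq (z₀ := 2)
    (g := fun s => (h : ℂ) ^ (2 - 2 * s) * epsteinZeta A s)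
    (analyticOnNhd_scaledZeta hA hh h1)
    ((hpow.differentiableOn.mul hZ.1.differentiableOn).analyticOnNhd isOpen_compl_singleton)
    (isConnected_compl_singleton_of_one_lt_rank (by simp) 1).isPreconnected (by simp) ?_ hs
  have hU : {z : ℂ | 1 < z.re} ∈ 𝓝 (2 : ℂ) :=
    (isOpen_lt continuous_const Complex.continuous_re).mem_nhds (by simp)
  filter_upwards [hU] with z hz
  rw [← puncturedSum_homog hA hz hh h1, ← (hZ.2 z hz).tsum_eq, ← tsum_mul_left, puncturedSum]
  refine tsum_congr fun j => ?_
  rw [homog_gridPoint hA z hh, sub_eq_add_neg 2, Complex.cpow_add _ _ hh', Complex.cpow_ofNat]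
  ring

/-! ### The rule error of the homogeneous model -/

/-- A function smooth in blow-up coordinates has uniform bounds at all scales because every `2^{-k}`
lies in the compact interval `[0, 1]`. -/
theorem isConormal_of_contDiff {W : Plane → ℂ} {k₀ : ℕ} {d : ℝ} {f : ℝ × Plane → ℂ}
    (hf : ContDiff ℝ ∞ f) (hz : ∀ t v, 1 ≤ ‖v‖ → f (t, v) = 0) (h0 : ∀ t, f (t, 0) = 0)
    (hW : ∀ k > k₀, ∀ v, W (((2 : ℝ) ^ k)⁻¹ • v) * annulus v =
      (((((2 : ℝ) ^ k)⁻¹) ^ d : ℝ) : ℂ) * f (((2 : ℝ) ^ k)⁻¹, v)) :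
    IsConormal W k₀ d fun k v => f (((2 : ℝ) ^ k)⁻¹, v) where
  dilation k hk v := by
    rw [hW k hk, Real.inv_rpow (by positivity), Real.rpow_neg (by positivity)]
  contDiff k _ := hf.comp (contDiff_const.prodMk contDiff_id)
  eq_zero k _ v hv := hz _ v hv
  zero k _ := h0 _
  bound m := by
    obtain ⟨C, hC⟩ := exists_norm_iteratedFDeriv_slice_le hf hz (isCompact_Icc (a := 0) (b := 1)) m
    exact ⟨C, fun k _ v => hC _ ⟨by positivity, inv_le_one_of_one_le₀ (one_le_pow₀ one_le_two)⟩ v⟩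

variable {A : Matrix (Fin 2) (Fin 2) ℂ}

theorem homog_smul_ofReal (hA : (A.map Complex.re).PosDef) (s : ℝ) {t : ℝ} (ht : 0 < t) (v : Plane) :
    homog A s (t • v) = ((t ^ (-(2 * s)) : ℝ) : ℂ) * homog A s v := by
  rw [homog_smul hA s ht, Complex.ofReal_cpow ht.le]
  push_cast
  rfl

theorem isConormal_homog (hA : (A.map Complex.re).PosDef) (s : ℝ) (k₀ : ℕ) :
    IsConormal (homog A s) k₀ (-(2 * s)) fun _ v => homog A s v * annulus v :=
  isConormal_of_contDiff (f := fun p : ℝ × Plane => homog A s p.2 * annulus p.2)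
    (ContDiff.comp (g := fun v => homog A s v * annulus v) (f := fun p : ℝ × Plane => p.2)
      (contDiff_homog_mul_slice hA isAnnular_annulus s) contDiff_snd)
    (fun t v hv => by simp [annulus_eq_zero_of_one_le hv])
    (fun t => by simp [annulus_eq_zero_of_le]) fun k _ v => by
      rw [homog_smul_ofReal hA s (by positivity), mul_assoc]

theorem ruleError_one_homog_mul_annulus (hA : (A.map Complex.re).PosDef) (s : ℝ) (i : ℕ) :
    (ruleError 1 fun v => homog A s v * annulus ((2 : ℝ) ^ (0 + 1 + i) • v)) =
      (((2 : ℝ) ^ (-(2 - 2 * s)) : ℝ) : ℂ) ^ i * ((((2 : ℝ) ^ (-(2 - 2 * s)) : ℝ) : ℂ) *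
        ∫ v, homog A s v * annulus v) := by
  rw [(isConormal_homog hA s 0).ruleError_mul_annulus (by omega), ruleError_eq_integral (fun v hv => by
    rw [annulus_eq_zero_of_one_le hv, mul_zero]) (by rw [mul_one]; exact one_le_pow₀ one_le_two),
    ← mul_assoc, ← pow_succ, ← Complex.ofReal_pow]
  congr 2
  rw [← Real.rpow_natCast, ← Real.rpow_natCast, ← Real.rpow_mul zero_le_two,
    ← Real.rpow_mul zero_le_two]
  push_cast
  ring_nf

theorem eq_neg_div_of_tendsto_geometric {x c J : ℂ} {r s : ℝ} (hr0 : 0 < r) (hr1 : r < 1) (hs : s < 1)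
    (hlim : Tendsto (fun n => ∑ i ∈ Finset.range (n + 1), (r : ℂ) ^ i * (r * c)) atTop (𝓝 x))
    (hcJ : (2 - 2 * (s : ℂ)) * c = (1 - (r : ℂ)⁻¹) * J) : x = -(J / (2 - 2 * (s : ℂ))) := by
  have hnorm : ‖(r : ℂ)‖ < 1 := by rwa [Complex.norm_real, Real.norm_of_nonneg hr0.le]
  have hgeo := (hasSum_geometric_of_norm_lt_one hnorm).mul_right ((r : ℂ) * c)
  have hlim' : Tendsto (fun n => ∑ i ∈ Finset.range (n + 1), (r : ℂ) ^ i * (r * c)) atTop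
      (𝓝 ((1 - (r : ℂ))⁻¹ * (r * c))) :=
    (tendsto_add_atTop_iff_nat (f := fun n => ∑ i ∈ Finset.range n, (r : ℂ) ^ i * (r * c)) 1).2
      hgeo.tendsto_sum_nat
  rw [tendsto_nhds_unique hlim hlim']
  have hr' : (r : ℂ) ≠ 0 := by exact_mod_cast hr0.ne'
  have hr1' : 1 - (r : ℂ) ≠ 0 := by exact_mod_cast (sub_pos.2 hr1).ne'
  have hs' : 2 - 2 * (s : ℂ) ≠ 0 := by
    exact_mod_cast (by linarith : (0 : ℝ) < 2 - 2 * s).ne'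
  rw [inv_mul_eq_div, div_eq_iff hr1', ← neg_div, div_mul_eq_mul_div, eq_div_iff hs']
  calc (r : ℂ) * c * (2 - 2 * s) = r * ((2 - 2 * s) * c) := by ring
    _ = r * ((1 - (r : ℂ)⁻¹) * J) := by rw [hcJ]
    _ = _ := by field_simp; ring

/-- At step `1` all rule errors in question are plain integrals, so the inward decomposition becomes
a geometric series of ratio `2^{-(2-2s)}`, convergent for `s < 1`. Euler's identity sums it to the
opposite of the pole term of `scaledZeta`. -/
theorem integral_homog_mul_cutoff (hA : (A.map Complex.re).PosDef) {s : ℝ} (hs : s < 1) :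
    ∫ v, homog A s v * cutoff v = -((∫ v, homog A s v * radialCutoff v) / (2 - 2 * (s : ℂ))) := by
  have hlim := (isConormal_homog hA s 0).tendsto_ruleError (by linarith) one_pos
  have hint : (ruleError 1 fun v => homog A s v * cutoff ((2 : ℝ) ^ 0 • v)) =
      ∫ v, homog A s v * cutoff v := by
    simp_rw [pow_zero, one_smul]
    exact ruleError_eq_integral (fun v hv => by
      rw [cutoff_eq_zero (by linarith), mul_zero]) le_rfl
  rw [hint] at hlim
  simp_rw [ruleError_one_homog_mul_annulus hA] at hlim
  have hcJ := integral_homog_mul_annulus hA (s : ℂ)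
  have hq : (2 : ℂ) ^ (2 - 2 * (s : ℂ)) = (((2 : ℝ) ^ (-(2 - 2 * s)) : ℝ) : ℂ)⁻¹ := by
    rw [Real.rpow_neg zero_le_two, Complex.ofReal_inv, inv_inv, Complex.ofReal_cpow zero_le_two]
    push_cast
    rfl
  have hr0 : 0 < (2 : ℝ) ^ (-(2 - 2 * s)) := by positivity
  have hr1 : (2 : ℝ) ^ (-(2 - 2 * s)) < 1 :=
    Real.rpow_lt_one_of_one_lt_of_neg one_lt_two (by linarith)
  rw [hq] at hcJ
  exact eq_neg_div_of_tendsto_geometric hr0 hr1 hs hlim hcJ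

/-- In the sum with `scaledZeta`, the punctured sums cancel and so do the integral and the pole
term; only the series of rule errors survives. -/
theorem ruleError_homog_mul_cutoff (hA : (A.map Complex.re).PosDef) {s : ℝ} (hs : s < 1) {h : ℝ}
    (hh : 0 < h) (h1 : h ≤ 1) :
    (ruleError h fun v => homog A s v * cutoff v) +
      ((h ^ (2 - 2 * s) : ℝ) : ℂ) * epsteinZeta A s = -∑' k, zetaTerm A h s k := by
  have hs' : (s : ℂ) ≠ 1 := by exact_mod_cast hs.ne
  have e1 := scaledZeta_eq hA hh h1 hs'
  have e2 : ((h ^ (2 - 2 * s) : ℝ) : ℂ) = (h : ℂ) ^ (2 - 2 * (s : ℂ)) := by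
    rw [Complex.ofReal_cpow hh.le]; push_cast; rfl
  rw [e2, ← e1, ruleError, integral_homog_mul_cutoff hA hs, scaledZeta]
  ring

/-- Homogeneity reduces the cutoff at scale `2^{-k₀}` and step `h` to the unit cutoff at step
`2^{k₀} h`; the remaining series is bounded by any power of `h`. -/
theorem exists_norm_ruleError_homog_add_le (hA : (A.map Complex.re).PosDef) {s : ℝ} (hs : s < 1)
    (k₀ : ℕ) (M : ℕ) :
    ∃ C : ℝ, ∀ h : ℝ, 0 < h → (2 : ℝ) ^ k₀ * h ≤ 1 →
      ‖(ruleError h fun v => homog A s v * cutoff ((2 : ℝ) ^ k₀ • v)) +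
        ((h ^ (2 - 2 * s) : ℝ) : ℂ) * epsteinZeta A s‖ ≤ C * h ^ M := by
  obtain ⟨N, hN, C, hC0, hC⟩ := exists_norm_zetaTerm_le hA ‖(s : ℂ)‖ M
  set a : ℝ := (2 : ℝ) ^ k₀
  have ha : 0 < a := by positivity
  refine ⟨a ^ (2 * s - 2) * (C * a ^ M * 2), fun h hh h1 => ?_⟩
  have hah : 0 < a * h := by positivity
  have e1 : ∀ v, homog A s v * cutoff (a • v) =
      ((a ^ (2 * s) : ℝ) : ℂ) * (homog A s (a • v) * cutoff (a • v)) := by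
    intro v
    rw [homog_smul_ofReal hA s ha, ← mul_assoc, ← mul_assoc, ← Complex.ofReal_mul,
      ← Real.rpow_add ha, add_neg_cancel, Real.rpow_zero, Complex.ofReal_one, one_mul]
  have e2 : (ruleError h fun v => homog A s v * cutoff (a • v)) +
      ((h ^ (2 - 2 * s) : ℝ) : ℂ) * epsteinZeta A s = ((a ^ (2 * s - 2) : ℝ) : ℂ) *
      ((ruleError (a * h) fun v => homog A s v * cutoff v) +
        (((a * h) ^ (2 - 2 * s) : ℝ) : ℂ) * epsteinZeta A s) := by
    simp_rw [e1]
    rw [ruleError_const_mul, ruleError_comp_smul ha h (fun v => homog A s v * cutoff v), mul_add,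
      ← mul_assoc, ← mul_assoc]
    congr 2
    · rw [Real.rpow_sub ha]; push_cast; norm_cast
    · rw [← Complex.ofReal_mul, Real.mul_rpow ha.le hh.le, ← mul_assoc, ← Real.rpow_add ha]
      simp
  rw [e2, ruleError_homog_mul_cutoff hA hs hah h1, norm_mul, norm_neg, Complex.norm_real,
    Real.norm_of_nonneg (by positivity), mul_assoc]
  gcongr
  calc ‖∑' k, zetaTerm A (a * h) s k‖ ≤ C * (a * h) ^ N * 2 :=
        tsum_of_norm_bounded (hasSum_geometric_two.mul_left _) fun k => hC s le_rfl _ hah h1 k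
    _ ≤ C * (a * h) ^ M * 2 := by
        gcongr C * ?_ * 2
        exact pow_le_pow_of_le_one hah.le h1 hN
    _ = _ := by ring

/-! ### The complexified distance and the blow-up of the surface -/

theorem contDiff_distSq : ContDiff ℝ ∞ distSq := by
  refine ContDiff.sum fun k _ => ContDiff.pow ?_ 2
  exact ((EuclideanSpace.proj (𝕜 := ℂ) k).contDiff (n := ∞)).restrict_scalars ℝ

theorem distSq_real_smul (t : ℝ) (x : Space) : distSq (t • x) = (t : ℂ) ^ 2 * distSq x := by
  simp [distSq, Finset.mul_sum, mul_pow]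

theorem distSq_fderiv (X : Plane → Space) (u : Plane) :
    distSq (fderiv ℝ X 0 u) = planeForm (firstFundamentalForm X 0) u := by
  have hu : fderiv ℝ X 0 u = u 0 • partialDeriv X 0 0 + u 1 • partialDeriv X 1 0 := by
    have hv : u = ∑ i : Fin 2, u i • EuclideanSpace.single i (1 : ℝ) := by
      ext i
      fin_cases i <;> simp [Fin.sum_univ_two]
    calc fderiv ℝ X 0 u = fderiv ℝ X 0 (∑ i : Fin 2, u i • EuclideanSpace.single i (1 : ℝ)) :=
          congrArg _ hv
      _ = _ := by rw [map_sum, Fin.sum_univ_two, map_smul, map_smul]; rfl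
  rw [hu, planeForm_eq_sum]
  simp only [distSq, firstFundamentalForm, Fin.sum_univ_two, Fin.sum_univ_three, Matrix.of_apply,
    PiLp.add_apply, PiLp.smul_apply, Complex.real_smul]
  ring

/-- The principal root halves the argument, which stays in the principal range, so the exponents
multiply without a change of branch. -/
theorem dist_cpow (x : Space) (s : ℝ) :
    dist x ^ ((2 * s : ℝ) : ℂ) = distSq x ^ (s : ℂ) := by
  have h1 : (Complex.log (distSq x) * (1 / 2 : ℂ)).im = Complex.arg (distSq x) / 2 := by
    have : (1 / 2 : ℂ) = ((1 / 2 : ℝ) : ℂ) := by push_cast; rfl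
    rw [this, Complex.im_mul_ofReal, Complex.log_im]
    ring
  rw [dist, ← Complex.cpow_mul]
  · push_cast
    congr 1
    ring
  · rw [h1]; linarith [Complex.neg_pi_lt_arg (distSq x), Real.pi_pos]
  · rw [h1]; linarith [Complex.arg_le_pi (distSq x), Real.pi_pos]

theorem integrand_eq (X : Plane → Space) (g : Plane → ℂ) (s : ℝ) (v : Plane) :
    integrand X g s v = g v * distSq (X v) ^ (-(s : ℂ)) := by
  rw [integrand, dist_cpow, Complex.cpow_neg, div_eq_mul_inv]

theorem eq_zero_of_smul_eq_zero {E : Type*} [NormedAddCommGroup E] [NormedSpace ℝ E] {φ : ℝ → E}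
    (hφ : Continuous φ) (h : ∀ t, t • φ t = 0) (t : ℝ) : φ t = 0 := by
  have : φ = fun _ => 0 := hφ.ext_on (dense_compl_singleton (0 : ℝ)) continuous_const fun t ht =>
    (smul_eq_zero.1 (h t)).resolve_left ht
  exact congrFun this t

/-- The blow-up of a parametrized surface at the origin: `r(X(tu))² = t² H(t,u)`. -/
theorem exists_blowup {X : Plane → Space} (hX : ContDiff ℝ ∞ X) (hX0 : X 0 = 0) :
    ∃ H : ℝ × Plane → ℂ, ContDiff ℝ ∞ H ∧
      (∀ (t : ℝ) (u : Plane), distSq (X (t • u)) = (t : ℂ) ^ 2 * H (t, u)) ∧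
      ∀ u, H (0, u) = planeForm (firstFundamentalForm X 0) u := by
  have hf : ContDiff ℝ ∞ fun p : ℝ × Plane => X (p.1 • p.2) :=
    hX.comp (contDiff_fst.smul contDiff_snd)
  obtain ⟨Y, hY, hXY⟩ := exists_contDiff_eq_smul hf fun u => by simp [hX0]
  refine ⟨fun p => distSq (Y p), contDiff_distSq.comp hY, fun t u => ?_, fun u => ?_⟩
  · change _ = (t : ℂ) ^ 2 * distSq (Y (t, u))
    rw [← distSq_real_smul, ← hXY]
  -- With `X(tu) = t Y(t,u)`, the derivative in `t` at `0` is `Y(0,u)` on one side and `DX(0)u` on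
  -- the other.
  · suffices h : Y (0, u) = fderiv ℝ X 0 u by
      change distSq (Y (0, u)) = _
      rw [h, distSq_fderiv]
    have h1 : HasDerivAt (fun t : ℝ => t • u) u 0 := by
      simpa using (hasDerivAt_id (0 : ℝ)).smul_const u
    have h2 := (hX.differentiable (by simp) ((0 : ℝ) • u)).hasFDerivAt.comp_hasDerivAt 0 h1
    have h3 : HasDerivAt (fun t : ℝ => t • Y (t, u)) (Y (0, u)) 0 := by
      have hYd : DifferentiableAt ℝ (fun t : ℝ => Y (t, u)) 0 :=
        (hY.comp (contDiff_id.prodMk contDiff_const)).differentiable (by simp) 0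
      simpa using (hasDerivAt_id (0 : ℝ)).fun_smul hYd.hasDerivAt
    have h4 : (X ∘ fun t : ℝ => t • u) = fun t : ℝ => t • Y (t, u) := funext fun t => hXY t u
    rw [h4, zero_smul] at h2
    exact h3.unique h2

/-- A smooth function of a parameter which is even and vanishes at `0` is divisible by its square. -/
theorem exists_contDiff_eq_sq_mul {f : ℝ × Plane → ℂ} (hf : ContDiff ℝ ∞ f)
    (h0 : ∀ u, f (0, u) = 0) (heven : ∀ t u, f (-t, u) = f (t, u)) :
    ∃ k : ℝ × Plane → ℂ, ContDiff ℝ ∞ k ∧ (∀ t u, f (t, u) = (t : ℂ) ^ 2 * k (t, u)) ∧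
      ∀ u, (∀ t, f (t, u) = 0) → ∀ t, k (t, u) = 0 := by
  obtain ⟨k₁, hk₁, h1⟩ := exists_contDiff_eq_smul hf h0
  -- Evenness of `f = t k₁` makes `k₁` odd in `t`, so Hadamard's lemma applies a second time.
  have hodd : ∀ u, k₁ (0, u) = 0 := by
    intro u
    have := eq_zero_of_smul_eq_zero (φ := fun t => k₁ (t, u) + k₁ (-t, u))
      ((hk₁.continuous.comp (by fun_prop)).add (hk₁.continuous.comp (by fun_prop))) (fun t => by
        have e1 := h1 t u
        have e2 := h1 (-t) u
        rw [heven, e1, neg_smul] at e2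
        rw [smul_add, e2, neg_add_cancel]) 0
    simpa using this
  obtain ⟨k₂, hk₂, h2⟩ := exists_contDiff_eq_smul hk₁ hodd
  refine ⟨k₂, hk₂, fun t u => ?_, fun u hu => ?_⟩
  · rw [h1, h2, Complex.real_smul, Complex.real_smul]
    ring
  -- The quotient inherits the vanishing of `f` along `u`, by continuity at `t = 0`; it thus stays
  -- supported in the annulus.
  · have hc1 : Continuous fun t => k₁ (t, u) := hk₁.continuous.comp (by fun_prop)
    have hc2 : Continuous fun t => k₂ (t, u) := hk₂.continuous.comp (by fun_prop)
    exact eq_zero_of_smul_eq_zero hc2 fun t => by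
      rw [← h2]
      exact eq_zero_of_smul_eq_zero hc1 (fun t => by rw [← h1, hu]) t

/-- On the annulus the integrand at `tu` is `t^{-2s}` times a smooth function of `(t, u)`, invariant
under `(t,u) ↦ (-t,-u)`. Averaging over `±u` makes it even in `t`, so that after subtracting the
value at `t = 0` a factor `t²` comes out: the gain of two degrees. -/
theorem exists_isConormal_integrand {X : Plane → Space} (hX : ContDiff ℝ ∞ X) (hX0 : X 0 = 0)
    (hA : ((firstFundamentalForm X 0).map Complex.re).PosDef) {g : Plane → ℂ}
    (hg : ContDiff ℝ ∞ g) (s : ℝ) :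
    ∃ (k₀ : ℕ) (w₁ w₂ : ℕ → Plane → ℂ), IsConormal (integrand X g s) k₀ (-(2 * s)) w₁ ∧
      IsConormal (fun v => (integrand X g s v + integrand X g s (-v)) / 2 -
        g 0 * homog (firstFundamentalForm X 0) s v) k₀ (2 - 2 * s) w₂ := by
  set A := firstFundamentalForm X 0
  obtain ⟨H, hH, hXH, hH0⟩ := exists_blowup hX hX0
  have hHneg : ∀ t u, H (-t, -u) = H (t, u) := by
    intro t u
    -- The identity defining `H` can be divided by `t²` only for `t ≠ 0`; at `t = 0` parity of the
    -- quadratic form is used.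
    rcases eq_or_ne t 0 with rfl | ht
    · rw [neg_zero, hH0, hH0, planeForm_neg]
    · have e1 := hXH (-t) (-u)
      rw [neg_smul_neg, hXH t u] at e1
      have ht' : (t : ℂ) ^ 2 ≠ 0 := by exact_mod_cast pow_ne_zero 2 ht
      push_cast at e1
      rw [neg_sq] at e1
      exact (mul_left_cancel₀ ht' e1).symm
  have hK : IsCompact {u : Plane | 1 / 4 ≤ ‖u‖ ∧ ‖u‖ ≤ 1} := by
    have : {u : Plane | 1 / 4 ≤ ‖u‖ ∧ ‖u‖ ≤ 1} = Metric.closedBall 0 1 ∩ {u | 1 / 4 ≤ ‖u‖} := by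
      ext u; simp [and_comm]
    rw [this]
    exact (isCompact_closedBall _ _).inter_right (isClosed_le continuous_const continuous_norm)
  -- Tube argument: `Re H(0,u) = Re Q_A(u) > 0` on the compact annulus, so positivity persists for
  -- all small `t` at once.
  have hev : ∀ᶠ t in 𝓝 (0 : ℝ), ∀ u ∈ {u : Plane | 1 / 4 ≤ ‖u‖ ∧ ‖u‖ ≤ 1}, 0 < (H (t, u)).re := by
    refine hK.eventually_forall_of_forall_eventually fun u hu => ?_
    have hu0 : u ≠ 0 := fun h => by
      have := hu.1
      rw [h, norm_zero] at this
      norm_num at this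
    have h1 : 0 < (H (0, u)).re := by
      rw [hH0]; exact planeForm_re_pos hA hu0
    exact ((Complex.continuous_re.comp hH.continuous).continuousAt (x := ((0 : ℝ), u))).eventually_const_lt h1
  obtain ⟨ε, hε, hεH⟩ := Metric.eventually_nhds_iff.1 hev
  -- Localizing in `t` keeps `H` in the slit plane wherever its power matters, so `f₁` is globally
  -- smooth; `β = 1` at every scale `2^{-k}` used later.
  set β : ContDiffBump (0 : ℝ) := ⟨ε / 4, ε / 2, by positivity, by linarith⟩
  have hβ : ContDiff ℝ ∞ fun t : ℝ => ((β t : ℝ) : ℂ) := Complex.ofRealCLM.contDiff.comp β.contDiff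
  have hβ0 : ∀ t : ℝ, ε / 2 ≤ |t| → β t = 0 := fun t ht => β.zero_of_le_dist (by simpa using ht)
  have hβ1 : ∀ t : ℝ, |t| ≤ ε / 4 → β t = 1 := fun t ht => β.one_of_mem_closedBall (by simpa using ht)
  set f₁ : ℝ × Plane → ℂ := fun p =>
    (β p.1 : ℂ) * (annulus p.2 * (g (p.1 • p.2) * H p ^ (-(s : ℂ)))) with hf₁
  have hf₁d : ContDiff ℝ ∞ f₁ := by
    refine contDiff_iff_contDiffAt.2 fun p => ?_
    have hz : ∀ U : Set (ℝ × Plane), IsOpen U → p ∈ U → (∀ q ∈ U, f₁ q = 0) →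
        ContDiffAt ℝ ∞ f₁ p := fun U hU hp h =>
      (contDiffAt_const (c := (0 : ℂ))).congr_of_eventuallyEq
        (eventually_of_mem (hU.mem_nhds hp) h)
    by_cases h1 : ε / 2 < |p.1|
    · exact hz {q | ε / 2 < |q.1|} (isOpen_lt continuous_const (by fun_prop)) h1 fun q hq => by
        simp only [hf₁, hβ0 q.1 (le_of_lt hq), Complex.ofReal_zero, zero_mul]
    by_cases h2 : ‖p.2‖ < 1 / 4
    · exact hz {q | ‖q.2‖ < 1 / 4} (isOpen_lt (by fun_prop) continuous_const) h2 fun q hq => by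
        simp only [hf₁, annulus_eq_zero_of_le (le_of_lt hq), zero_mul, mul_zero]
    by_cases h3 : 1 < ‖p.2‖
    · exact hz {q | 1 < ‖q.2‖} (isOpen_lt continuous_const (by fun_prop)) h3 fun q hq => by
        simp only [hf₁, annulus_eq_zero_of_one_le (le_of_lt hq), zero_mul, mul_zero]
    have hp : H p ∈ Complex.slitPlane := Or.inl (hεH (y := p.1) (by
      rw [Real.dist_eq, sub_zero]; linarith) p.2 ⟨not_lt.1 h2, not_lt.1 h3⟩)
    have hgd : ContDiff ℝ ∞ fun p : ℝ × Plane => g (p.1 • p.2) :=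
      hg.comp (contDiff_fst.smul contDiff_snd)
    exact (hβ.comp contDiff_fst).contDiffAt.mul ((contDiff_annulus.comp contDiff_snd).contDiffAt.mul
      (hgd.contDiffAt.mul (contDiffAt_cpow_of_slitPlane hH.contDiffAt contDiffAt_const hp)))
  have hf₁neg : ∀ t u, f₁ (-t, -u) = f₁ (t, u) := fun t u => by
    simp only [hf₁, hHneg, annulus_neg, neg_smul_neg, β.neg]
  have hf₁z : ∀ t u, annulus u = 0 → f₁ (t, u) = 0 := fun t u hu => by
    simp only [hf₁, hu, zero_mul, mul_zero]
  have hF : ∀ t : ℝ, 0 < t → t ≤ ε / 4 → ∀ v, integrand X g s (t • v) * annulus v =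
      ((t ^ (-(2 * s)) : ℝ) : ℂ) * f₁ (t, v) := by
    intro t ht ht1 v
    by_cases hv : annulus v = 0
    · rw [hf₁z t v hv, hv, mul_zero, mul_zero]
    have h1 : 1 / 4 ≤ ‖v‖ := by
      by_contra! h; exact hv (annulus_eq_zero_of_le h.le)
    have h2 : ‖v‖ ≤ 1 := by
      by_contra! h; exact hv (annulus_eq_zero_of_one_le h.le)
    have hHp : 0 < (H (t, v)).re := hεH (y := t) (by
      rw [Real.dist_eq, sub_zero, abs_of_pos ht]; linarith) v ⟨h1, h2⟩
    have hsl : H (t, v) ∈ Complex.slitPlane := Or.inl hHp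
    rw [integrand_eq, hXH, sq_mul_cpow ht (Complex.slitPlane_ne_zero hsl),
      Complex.ofReal_cpow ht.le]
    simp only [hf₁]
    rw [hβ1 t (by rwa [abs_of_pos ht])]
    push_cast
    ring_nf
  have hφ : ∀ t : ℝ, 0 < t → ∀ v, g 0 * homog A s (t • v) * annulus v =
      ((t ^ (-(2 * s)) : ℝ) : ℂ) * f₁ (0, v) := by
    intro t ht v
    rw [homog_smul_ofReal hA s ht]
    simp only [hf₁]
    rw [hβ1 0 (by simp; positivity), hH0, zero_smul, homog]
    push_cast
    ring
  set f₂ : ℝ × Plane → ℂ := fun p =>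
    (f₁ p + f₁ (p.1, -p.2)) / 2 - (β p.1 : ℂ) * f₁ (0, p.2) with hf₂
  have hf₂d : ContDiff ℝ ∞ f₂ :=
    ((hf₁d.add (hf₁d.comp (contDiff_fst.prodMk contDiff_snd.neg))).div_const 2).sub
      ((hβ.comp contDiff_fst).mul (hf₁d.comp (contDiff_const.prodMk contDiff_snd)))
  have hf₂0 : ∀ u, f₂ (0, u) = 0 := fun u => by
    have := hf₁neg 0 u
    rw [neg_zero] at this
    simp only [hf₂]
    rw [this, hβ1 0 (by simp; positivity)]
    push_cast
    ring
  have hf₂even : ∀ t u, f₂ (-t, u) = f₂ (t, u) := fun t u => by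
    have e1 := hf₁neg t u
    have e2 := hf₁neg t (-u)
    rw [neg_neg] at e2
    simp only [hf₂]
    rw [e1, e2, β.neg, add_comm]
  have hf₂z : ∀ t u, annulus u = 0 → f₂ (t, u) = 0 := fun t u hu => by
    simp only [hf₂]
    rw [hf₁z _ _ hu, hf₁z _ _ hu, hf₁z _ _ (by rw [annulus_neg, hu])]
    simp
  obtain ⟨k, hk, hk2, hkz⟩ := exists_contDiff_eq_sq_mul hf₂d hf₂0 hf₂even
  -- The initial scale: `2^{-k} ≤ ε/4` for all `k > k₀`.
  obtain ⟨k₀, hk₀⟩ := pow_unbounded_of_one_lt (ε / 4)⁻¹ (one_lt_two : (1 : ℝ) < 2)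
  have htk : ∀ k > k₀, ((2 : ℝ) ^ k)⁻¹ ≤ ε / 4 := fun k hk => by
    refine inv_le_of_inv_le₀ (by positivity) (hk₀.le.trans ?_)
    exact pow_le_pow_right₀ one_le_two (by omega)
  have hann0 : annulus (0 : Plane) = 0 := annulus_eq_zero_of_le (by simp)
  refine ⟨k₀, _, _, isConormal_of_contDiff hf₁d (fun t v hv => hf₁z t v (annulus_eq_zero_of_one_le hv))
    (fun t => hf₁z t 0 hann0) fun k hk v => hF _ (by positivity) (htk k hk) v,
    isConormal_of_contDiff hk (fun t v hv => hkz v (fun t => hf₂z t v (annulus_eq_zero_of_one_le hv)) t)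
    (fun t => hkz 0 (fun t => hf₂z t 0 hann0) t) fun n hn v => ?_⟩
  have ht : 0 < ((2 : ℝ) ^ n)⁻¹ := by positivity
  have ht1 := htk n hn
  set t : ℝ := ((2 : ℝ) ^ n)⁻¹
  have e1 := hF t ht ht1 v
  have e2 := hF t ht ht1 (-v)
  rw [smul_neg, annulus_neg] at e2
  have e3 := hφ t ht v
  have e4 : ((t ^ (2 - 2 * s) : ℝ) : ℂ) = ((t ^ (-(2 * s)) : ℝ) : ℂ) * (t : ℂ) ^ 2 := by
    rw [sub_eq_add_neg, add_comm, Real.rpow_add ht]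
    push_cast
    norm_cast
  rw [e4, mul_assoc, ← hk2]
  simp only [hf₂]
  rw [hβ1 t (by rwa [abs_of_pos ht])]
  push_cast
  linear_combination (e1 + e2) / 2 - e3

/-! ### The smooth remainder, the even part, and the conclusion -/

theorem contDiffAt_integrand {X : Plane → Space} (hX : ContDiff ℝ ∞ X) {g : Plane → ℂ}
    (hg : ContDiff ℝ ∞ g) (hr : ∀ v ∈ tsupport g, v ≠ 0 → distSq (X v) ∈ Complex.slitPlane) (s : ℝ)
    {v : Plane} (hv : v ≠ 0) : ContDiffAt ℝ ∞ (integrand X g s) v := by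
  by_cases hvg : v ∈ tsupport g
  · have : integrand X g s = fun v => g v * distSq (X v) ^ (-(s : ℂ)) :=
      funext fun v => integrand_eq X g s v
    rw [this]
    exact hg.contDiffAt.mul (contDiffAt_cpow_of_slitPlane (contDiff_distSq.comp hX).contDiffAt
      contDiffAt_const (hr v hvg hv))
  · refine (contDiffAt_const (c := (0 : ℂ))).congr_of_eventuallyEq ?_
    filter_upwards [notMem_tsupport_iff_eventuallyEq.1 hvg] with w hw
    simp [integrand, hw]

variable {F : Plane → ℂ}

theorem contDiff_mul_one_sub_cutoff (hF : ∀ v ≠ 0, ContDiffAt ℝ ∞ F v) (a : ℝ) :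
    ContDiff ℝ ∞ fun v => F v * (1 - cutoff (a • v)) := by
  refine contDiff_iff_contDiffAt.2 fun v => ?_
  rcases eq_or_ne v 0 with rfl | hv
  · refine (contDiffAt_const (c := (0 : ℂ))).congr_of_eventuallyEq ?_
    have h1 : ∀ᶠ w : Plane in 𝓝 0, ‖a • w‖ < 1 / 4 :=
      (by fun_prop : Continuous fun w : Plane => ‖a • w‖).continuousAt.eventually_lt_const (by simp)
    filter_upwards [h1] with w hw
    rw [cutoff_eq_one hw.le, sub_self, mul_zero]
  · exact (hF v hv).mul (contDiff_const.sub (contDiff_cutoff_smul a)).contDiffAt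

/-- With `a ≥ 1` the cutoff is `0` near every point of `‖v‖ ≥ 1`, so the decay hypothesis applies
unchanged there; the unit ball is compact. -/
theorem integrable_norm_iteratedFDeriv_mul_one_sub_cutoff (hF : ∀ v ≠ 0, ContDiffAt ℝ ∞ F v)
    {a : ℝ} (ha : 1 ≤ a)
    (hI : ∀ n : ℕ, IntegrableOn (fun v => ‖iteratedFDeriv ℝ n F v‖) {v | 1 ≤ ‖v‖}) (n : ℕ) :
    Integrable fun v => ‖iteratedFDeriv ℝ n (fun v => F v * (1 - cutoff (a • v))) v‖ := by
  have hcont := ((contDiff_mul_one_sub_cutoff hF a).continuous_iteratedFDeriv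
    (m := n) (by exact_mod_cast le_top)).norm
  have hm : MeasurableSet {v : Plane | 1 ≤ ‖v‖} := measurableSet_le measurable_const measurable_norm
  rw [← integrableOn_univ]
  refine (((hI n).congr_fun (fun v hv => ?_) hm).union
    (hcont.continuousOn.integrableOn_compact (isCompact_closedBall (0 : Plane) 1))).mono_set
    fun v _ => ?_
  · have h1 : (fun v => F v * (1 - cutoff (a • v))) =ᶠ[𝓝 v] F := by
      filter_upwards [continuous_norm.continuousAt.eventually_const_lt
        (lt_of_lt_of_le (by norm_num : (1 / 2 : ℝ) < 1) hv)] with w hw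
      rw [cutoff_eq_zero, sub_zero, mul_one]
      rw [norm_smul, Real.norm_of_nonneg (by linarith)]
      nlinarith [norm_nonneg w]
    simp only [(h1.iteratedFDeriv ℝ n).eq_of_nhds]
  · rcases le_total 1 ‖v‖ with h | h
    · exact Or.inl h
    · exact Or.inr (by simpa using h)

theorem gridPoint_neg (h : ℝ) (j : Fin 2 → ℤ) : gridPoint h (-j) = -gridPoint h j := by
  ext i; simp [gridPoint]

/-- The reflection of the punctured lattice. -/
def puncturedLatticeNeg : PuncturedLattice ≃ PuncturedLattice :=
  (Equiv.neg (Fin 2 → ℤ)).subtypeEquiv fun _ => neg_ne_zero.symm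

theorem gridPoint_puncturedLatticeNeg (h : ℝ) (j : PuncturedLattice) :
    gridPoint h (puncturedLatticeNeg j).1 = -gridPoint h j.1 := gridPoint_neg h j.1

theorem ruleError_comp_neg (h : ℝ) (F : Plane → ℂ) :
    (ruleError h fun v => F (-v)) = ruleError h F := by
  rw [ruleError, ruleError, integral_neg_eq_self, puncturedSum, puncturedSum,
    ← puncturedLatticeNeg.tsum_eq]
  simp_rw [gridPoint_puncturedLatticeNeg, neg_neg]

theorem mul_cutoff_smul_eq_zero (F : Plane → ℂ) (k : ℕ) {v : Plane} (hv : 1 ≤ ‖v‖) :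
    F v * cutoff ((2 : ℝ) ^ k • v) = 0 := by
  rw [cutoff_eq_zero, mul_zero]
  rw [norm_smul, Real.norm_of_nonneg (by positivity)]
  have : (1 : ℝ) ≤ (2 : ℝ) ^ k := one_le_pow₀ one_le_two
  nlinarith [norm_nonneg v]

theorem summable_mul_cutoff (F : Plane → ℂ) (k : ℕ) {h : ℝ} (hh : 0 < h) :
    Summable fun j : PuncturedLattice =>
      (fun v => F v * cutoff ((2 : ℝ) ^ k • v)) (gridPoint h j.1) * (h : ℂ) ^ 2 :=
  summable_of_eq_zero (F := fun v => F v * cutoff ((2 : ℝ) ^ k • v)) (R := 1)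
    (fun _ hv => mul_cutoff_smul_eq_zero F k hv) hh

/-- Only the even part of a function contributes to the error of the punctured trapezoidal rule. -/
theorem ruleError_eq_even_part {k : ℕ} {h : ℝ} (hh : 0 < h) {φ : Plane → ℂ}
    (hF : Integrable fun v => F v * cutoff ((2 : ℝ) ^ k • v))
    (hφ : Integrable fun v => φ v * cutoff ((2 : ℝ) ^ k • v))
    (hW : Integrable fun v => ((F v + F (-v)) / 2 - φ v) * cutoff ((2 : ℝ) ^ k • v)) :
    (ruleError h fun v => F v * cutoff ((2 : ℝ) ^ k • v)) =
      (ruleError h fun v => ((F v + F (-v)) / 2 - φ v) * cutoff ((2 : ℝ) ^ k • v)) +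
        ruleError h fun v => φ v * cutoff ((2 : ℝ) ^ k • v) := by
  have hneg : ∀ v, F (-v) * cutoff ((2 : ℝ) ^ k • -v) = F (-v) * cutoff ((2 : ℝ) ^ k • v) :=
    fun v => by rw [smul_neg, cutoff_neg]
  have e1 := ruleError_comp_neg h fun v => F v * cutoff ((2 : ℝ) ^ k • v)
  have hF' : Integrable fun v => F (-v) * cutoff ((2 : ℝ) ^ k • v) := by
    have := hF.comp_neg
    simpa only [hneg] using this
  simp only [hneg] at e1
  have e2 := ruleError_add hF hF' (summable_mul_cutoff F k hh)
    (summable_mul_cutoff (fun v => F (-v)) k hh)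
  have e3 := ruleError_add hW hφ (summable_mul_cutoff (fun v => (F v + F (-v)) / 2 - φ v) k hh)
    (summable_mul_cutoff φ k hh)
  have e4 : ∀ v, F v * cutoff ((2 : ℝ) ^ k • v) + F (-v) * cutoff ((2 : ℝ) ^ k • v) =
      2 * (((F v + F (-v)) / 2 - φ v) * cutoff ((2 : ℝ) ^ k • v) +
        φ v * cutoff ((2 : ℝ) ^ k • v)) := fun v => by ring
  simp_rw [e4] at e2
  rw [ruleError_const_mul, e3, e1] at e2
  linear_combination -e2 / 2

/-- Three errors are added: the part away from the origin (any order), the model `g(0) Q_A^{-s}`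
corrected by the zeta term (any order), and the even remainder of degree `2 - 2s`, which alone
dictates the rate `h^{(2-2s)+2}`. -/
theorem exists_norm_ruleError_integrand_add_le {X : Plane → Space} (hX : ContDiff ℝ ∞ X)
    (hX0 : X 0 = 0) (hA : ((firstFundamentalForm X 0).map Complex.re).PosDef) {g : Plane → ℂ}
    (hg : ContDiff ℝ ∞ g) (hr : ∀ v ∈ tsupport g, v ≠ 0 → distSq (X v) ∈ Complex.slitPlane)
    {s : ℝ} (hs : s < 1)
    (hdecay : ∀ n : ℕ, IntegrableOn (fun v => ‖iteratedFDeriv ℝ n (integrand X g s) v‖)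
      {v | 1 ≤ ‖v‖}) :
    Integrable (integrand X g s) ∧
      (∀ h : ℝ, 0 < h → Summable fun j : PuncturedLattice =>
        integrand X g s (gridPoint h j.1) * (h : ℂ) ^ 2) ∧
      ∃ C δ : ℝ, 0 < δ ∧ ∀ h : ℝ, 0 < h → h ≤ δ →
        ‖ruleError h (integrand X g s) + epsteinZeta (firstFundamentalForm X 0) s * g 0 *
          ((h ^ (2 - 2 * s) : ℝ) : ℂ)‖ ≤ C * h ^ (4 - 2 * s) := by
  obtain ⟨k₀, w₁, w₂, h₁, h₂⟩ := exists_isConormal_integrand hX hX0 hA hg s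
  set A := firstFundamentalForm X 0
  set F := integrand X g s
  have hFd : ∀ v ≠ 0, ContDiffAt ℝ ∞ F v := fun v hv => contDiffAt_integrand hX hg hr s hv
  have ha : (1 : ℝ) ≤ (2 : ℝ) ^ k₀ := one_le_pow₀ one_le_two
  set G : Plane → ℂ := fun v => F v * (1 - cutoff ((2 : ℝ) ^ k₀ • v)) with hG
  have hGd : ContDiff ℝ ∞ G := contDiff_mul_one_sub_cutoff hFd _
  have hGI := integrable_norm_iteratedFDeriv_mul_one_sub_cutoff hFd ha hdecay
  have hG0 : G 0 = 0 := by simp [hG, cutoff_eq_one]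
  have hsplit : F = fun v => F v * cutoff ((2 : ℝ) ^ k₀ • v) + G v := by
    funext v; simp only [hG]; ring
  have hFc : Integrable fun v => F v * cutoff ((2 : ℝ) ^ k₀ • v) := h₁.integrable (by linarith)
  have hGi : Integrable G := by
    have := hGI 0
    simp only [norm_iteratedFDeriv_zero] at this
    exact (integrable_norm_iff hGd.continuous.aestronglyMeasurable).1 this
  have hGs : ∀ h : ℝ, 0 < h → Summable fun j : PuncturedLattice =>
      G (gridPoint h j.1) * (h : ℂ) ^ 2 := fun h hh =>
    ((summable_gridPoint hGd hGI hh).of_norm.subtype {j | j ≠ 0}).mul_right _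
  refine ⟨by rw [hsplit]; exact hFc.add hGi, fun h hh => ?_, ?_⟩
  · have := (summable_mul_cutoff F k₀ hh).add (hGs h hh)
    refine this.congr fun j => ?_
    rw [← add_mul, ← congrFun hsplit (gridPoint h j.1)]
  · obtain ⟨N', hN'⟩ := exists_nat_gt (4 - 2 * s)
    set N := max N' 2
    have hN : 4 - 2 * s ≤ N := hN'.le.trans (by exact_mod_cast le_max_left _ _)
    obtain ⟨C₁, hC₁⟩ := h₂.exists_norm_ruleError_le (by linarith)
    obtain ⟨C₂, hC₂⟩ := exists_norm_ruleError_homog_add_le hA hs k₀ N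
    obtain ⟨C₃, hC₃⟩ := exists_norm_ruleError_le_of_integrable hGd hGI (le_max_right N' 2) hG0
    have hφi : Integrable fun v => g 0 * homog A s v * cutoff ((2 : ℝ) ^ k₀ • v) := by
      simp_rw [mul_assoc]
      exact ((isConormal_homog hA s k₀).integrable (by linarith)).const_mul _
    -- The bound on `h` ensures `2^{k₀} h ≤ 1`, as the rescaled zeta identity requires.
    refine ⟨C₁ + ‖g 0‖ * |C₂| + |C₃|, ((2 : ℝ) ^ k₀)⁻¹, by positivity, fun h hh hδ => ?_⟩
    have hah : (2 : ℝ) ^ k₀ * h ≤ 1 := by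
      calc _ ≤ (2 : ℝ) ^ k₀ * ((2 : ℝ) ^ k₀)⁻¹ := by gcongr
        _ = 1 := mul_inv_cancel₀ (by positivity)
    have h1 : h ≤ 1 := (le_mul_of_one_le_left hh.le ha).trans hah
    have e1 : ruleError h F = (ruleError h fun v => F v * cutoff ((2 : ℝ) ^ k₀ • v)) +
        ruleError h G := by
      conv_lhs => rw [hsplit]
      exact ruleError_add hFc hGi (summable_mul_cutoff F k₀ hh) (hGs h hh)
    have e2 := ruleError_eq_even_part hh hFc hφi (h₂.integrable (by linarith))
    have e3 : (ruleError h fun v => g 0 * homog A s v * cutoff ((2 : ℝ) ^ k₀ • v)) =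
        g 0 * ruleError h fun v => homog A s v * cutoff ((2 : ℝ) ^ k₀ • v) := by
      simp_rw [mul_assoc]
      exact ruleError_const_mul h (g 0) _
    have hpow : h ^ N ≤ h ^ (4 - 2 * s) := by
      rw [← Real.rpow_natCast]
      exact Real.rpow_le_rpow_of_exponent_ge hh h1 hN
    have b1 := hC₁ h hh h1
    have b2 := hC₂ h hh hah
    have b3 := hC₃ h hh h1
    rw [show 2 - 2 * s + 2 = 4 - 2 * s by ring] at b1
    rw [e1, e2, e3]
    set x₁ := ruleError h fun v => ((F v + F (-v)) / 2 - g 0 * homog A s v) *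
      cutoff ((2 : ℝ) ^ k₀ • v)
    set x₂ := ruleError h fun v => homog A s v * cutoff ((2 : ℝ) ^ k₀ • v)
    set z := epsteinZeta A s
    set y := ((h ^ (2 - 2 * s) : ℝ) : ℂ)
    calc ‖x₁ + g 0 * x₂ + ruleError h G + z * g 0 * y‖ =
          ‖x₁ + g 0 * (x₂ + y * z) + ruleError h G‖ := by ring_nf
      _ ≤ ‖x₁‖ + ‖g 0‖ * ‖x₂ + y * z‖ + ‖ruleError h G‖ := by
          rw [← norm_mul]
          exact norm_add₃_le
      _ ≤ C₁ * h ^ (4 - 2 * s) + ‖g 0‖ * (|C₂| * h ^ (4 - 2 * s)) + |C₃| * h ^ (4 - 2 * s) := by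
          gcongr
          · exact b2.trans (mul_le_mul (le_abs_self _) hpow (by positivity) (abs_nonneg _))
          · exact b3.trans (mul_le_mul (le_abs_self _) hpow (by positivity) (abs_nonneg _))
      _ = _ := by ring

end TrapezoidalRule

end

theorem mainTheorem2
    (X : TrapezoidalRule.Plane → TrapezoidalRule.Space) (hX : ContDiff ℝ ∞ X) (hX0 : X 0 = 0)
    (hA : ((TrapezoidalRule.firstFundamentalForm X 0).map Complex.re).PosDef)
    (g : TrapezoidalRule.Plane → ℂ) (hg : ContDiff ℝ ∞ g)
    (hr : ∀ v ∈ tsupport g, v ≠ 0 → TrapezoidalRule.distSq (X v) ∈ Complex.slitPlane)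
    (s : ℝ) (hs : s < 1)
    (hdecay : ∀ n : ℕ, IntegrableOn
      (fun v => ‖iteratedFDeriv ℝ n (TrapezoidalRule.integrand X g s) v‖) {v | 1 ≤ ‖v‖} volume) :
    TrapezoidalRule.IsEpsteinZeta (TrapezoidalRule.firstFundamentalForm X 0)
        (TrapezoidalRule.epsteinZeta (TrapezoidalRule.firstFundamentalForm X 0)) ∧
      Integrable (TrapezoidalRule.integrand X g s) volume ∧
      (∀ h : ℝ, 0 < h → Summable fun j : TrapezoidalRule.PuncturedLattice =>
        TrapezoidalRule.integrand X g s (TrapezoidalRule.gridPoint h j.1) * (h : ℂ) ^ 2) ∧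
      (fun h : ℝ => (∫ v, TrapezoidalRule.integrand X g s v)
          - TrapezoidalRule.puncturedTrapezoidal X g s h
          + TrapezoidalRule.epsteinZeta (TrapezoidalRule.firstFundamentalForm X 0) (s : ℂ)
            * g 0 * ((h ^ (2 - 2 * s) : ℝ) : ℂ))
        =O[𝓝[>] 0] fun h : ℝ => h ^ (4 - 2 * s) := by
  obtain ⟨h1, h2, C, δ, hδ, h3⟩ :=
    TrapezoidalRule.exists_norm_ruleError_integrand_add_le hX hX0 hA hg hr hs hdecay
  refine ⟨TrapezoidalRule.isEpsteinZeta_epsteinZeta hA, h1, h2, IsBigO.of_bound C ?_⟩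
  filter_upwards [self_mem_nhdsWithin, nhdsWithin_le_nhds (Iic_mem_nhds hδ)] with h hh hhδ
  have hh0 : 0 < h := hh
  rw [Real.norm_of_nonneg (by positivity : 0 ≤ h ^ (4 - 2 * s))]
  -- `puncturedTrapezoidal` unfolds to `puncturedSum` of the integrand, so the two expressions agree
  -- definitionally.
  exact h3 h hh0 hhδ
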